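/- **Setting.** The alphabet $\mathfrak X\subset\mathbb R^d$ consists of $d_y$ vectors (tokens); $\mathfrak X^*$ is the set of finite token sequences. A concept $z\in\mathfrak Z$ has the prior $\mathbb P_{\mathcal Z}$ and determines conditional laws $\mathbb P(\cdot\mid S,z)$ of the next token, $S\in\mathfrak X^*$ (measurable in $z$). Put $\mathbb P(x\mid S)=\int\mathbb P(x\mid S,z)\,\mathbb P_{\mathcal Z}(dz\mid S)$, where $\mathbb P_{\mathcal Z}(\cdot\mid S)$ is the posterior. *Network.* For a parameter $\theta$, $\mathbb P_\theta(\cdot\mid S)$ is computed from the matrix $X^{(0)}\in\mathbb R^{L\times d}$ of the $L$ tokens of $S$ by $D\ge1$ layers $Y^{(t)}=\Pi\big[\sum_{i=1}^h \mathrm{softmax}(X W_i^{Q}(XW_i^{K})^\top)XW_i^{V}+\gamma_1X\big]$, $X^{(t)}=\Pi\big[\mathrm{ReLU}(Y^{(t)}A_1)A_2+\gamma_2Y^{(t)}\big]$ (here $X=X^{(t-1)}$, all weights depend on $t$, $W^Q_i,W^K_i\in\mathbb R^{d\times d_h}$, $W^V_i\in\mathbb R^{d\times d}$, $A_1\in\mathbb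 R^{d\times d_F}$, $A_2\in\mathbb R^{d_F\times d}$, softmax acts on rows and $\Pi$ projects every row onto the unit $\ell_2$ ball), and by $\mathbb P_\theta(\cdot\mid S)=\mathrm{softmax}(\mathbf 1^\top X^{(D)}A/(L\tau))$, $A\in\mathbb R^{d\times d_y}$, $0<\tau\le1$. The set $\Theta$ consists of the $\theta$ with $\|A^\top\|_{1,2}\le B_A$, $|\gamma_1|,|\gamma_2|\le1$, $\|A_j\|_F\le B_{A,j}$ ($j=1,2$), $\|W^Q_i\|_F\le B_Q$, $\|W_i^K\|_F\le B_K$, $\|W_i^V\|_F\le B_V$ in all layers, where all these bounds are at least $1$. Let $\bar B=\tau^{-1}RhB_AB_{A,1}B_{A,2}B_QB_KB_V$ and $\bar D=D^2d(d_F+d_h+d)+d\,d_y$, and assume $1\le h\le\bar D$. *Pretraining.* The data are $N$ independent trajectories of $T_p+1$ tokens: $z\sim\mathbb P_{\mathcal Z}$, $x_{t+1}\sim\mathbb P(\cdot\mid S_t,z)$ with $S_t=(x_1,\dots,x_t)$. Let $\hat\theta$ be any minimizer over $\Theta$ of $-\frac1{NT_p}\sum_{n\le N}\sum_{t\le T_p}\log\mathbb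 P_\theta(x^n_{t+1}\mid S^n_t)$. Let $\mathbb P_{\mathcal D}$ be the average of the laws of $S_1,\dots,S_{T_p}$. Assume that for every $z$ the tokens of $S_1,\dots,S_{T_p}$ have $\ell_2$ norm at most $R$ almost surely, where $R\ge1$, and that $\mathbb P(x\mid S,z)\ge c_0>0$ for all $z$, all $x$ and all nonempty $S$. Let $t_{\rm mix}$ be the least $k\ge1$ such that for all $z$, all $i\ge1$ with $i+k\le T_p$, and all $S,S'$ of positive probability for $S_i$ given $z$, the conditional laws of $S_{i+k}$ given $(S_i=S,z)$ and given $(S_i=S',z)$ have total variation distance at most $1/4$. Put $$\Delta_{\rm pre}(N,T_p,\delta)=\inf_{\theta^*\in\Theta}\sqrt{\mathbb E_{S\sim\mathbb P_{\mathcal D}}\mathrm{KL}\big(\mathbb P(\cdot\mid S)\,\|\,\mathbb P_{\theta^*}(\cdot\mid S)\big)}+\frac{t_{\rm mix}^{1/4}\log(1/\delta)}{(NT_p)^{1/4}}+\sqrt{\frac{t_{\rm mix}}{NT_p}}\Big(\bar D\log(1+NT_p\bar B)+\log\frac1\delta\Big),$$ $b_y=(1+d_y e^{B_A/\tau})^{-1}$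 and $b^*=\log\max\{c_0^{-1},b_y^{-1}\}$. *In-context learning.* For a concept $z_*$, examples are generated by $\tilde c_t\sim\mathbb P(\cdot\mid\tilde c_1,r_1,\dots,\tilde c_{t-1},r_{t-1},z_*)$ and $r_t\sim\mathbb P(\cdot\mid\mathtt{prompt}_{t-1},z_*)$, where $\mathtt{prompt}_{t-1}=(\tilde c_1,r_1,\dots,\tilde c_{t-1},r_{t-1},\tilde c_t)$; the probability of a covariate $\tilde c\in\mathfrak X^*$ after $S$ is the product of the nominal conditional probabilities of its tokens times a weight $w(S,\tilde c)$ that does not depend on the concept (fixed lengths, delimiters and random stopping are allowed). The expected ICL regret of $\theta$ against $z_*$ is $$\mathrm{Reg}_T(\theta,z_*)=\mathbb E\Big[\frac1T\sum_{t=1}^T\log\mathbb P(r_t\mid\mathtt{prompt}_{t-1},z_*)-\frac1T\sum_{t=1}^T\log\mathbb P_{\theta}(r_t\mid\mathtt{prompt}_{t-1})\,\Big|\,z_*\Big],$$ and $\mathbb P_{\mathcal D_{\tt ICL}}(\cdot\mid z_*)$ is the average of the laws of $\mathtt{prompt}_0,\dots,\mathtt{prompt}_{T-1}$ given $z_*$.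 **Theorem.** There is an absolute constant $C>0$ such that in this setting, for all $N,T_p,T\ge1$ and $0<\delta<1$: 1. (Concept drawn from the prior.) Let $z_*\sim\mathbb P_{\mathcal Z}$. If $\log(1/\mathbb P_{\mathcal Z}(z_*))\le\beta<\infty$ almost surely and $\mathbb P_{\mathcal D_{\tt ICL}}(S):=\mathbb E_{z_*}\mathbb P_{\mathcal D_{\tt ICL}}(S\mid z_*)\le\kappa\,\mathbb P_{\mathcal D}(S)$ for all $S\in\mathfrak X^*$, then with probability at least $1-\delta$ over the pretraining data $$\mathbb E_{z_*}\big[\mathrm{Reg}_T(\hat\theta,z_*)\big]\le C\Big(\frac{\beta}{T}+b^*\kappa\,\Delta_{\rm pre}(N,T_p,\delta)\Big).$$ 2. (Fixed concept.) Let $z_*\in\mathfrak Z$ be fixed. If $\log(1/\mathbb P_{\mathcal Z}(z_*))\le\beta<\infty$ and $\mathbb P_{\mathcal D_{\tt ICL}}(S\mid z_*)\le\kappa\,\mathbb P_{\mathcal D}(S)$ for all $S\in\mathfrak X^*$, then with probability at least $1-\delta$ over the pretraining data $$\mathrm{Reg}_T(\hat\theta,z_*)\le C\Big(\frac{b^*\beta}{T}+b^*\kappa\,\Delta_{\rm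 pre}(N,T_p,\delta)\Big).$$ Both bounds hold for every minimizer $\hat\theta$ simultaneously. -/

import Mathlib

open scoped ENNReal NNReal

universe u

namespace ICL

/-! ### Vectors, matrices, softmax -/

/-- The Euclidean norm of a vector. -/
noncomputable def l2norm {m : ℕ} (v : Fin m → ℝ) : ℝ := Real.sqrt (∑ i, v i ^ 2)

/-- The Frobenius norm of a matrix. -/
noncomputable def frob {m n : ℕ} (A : Matrix (Fin m) (Fin n) ℝ) : ℝ :=
  Real.sqrt (∑ i, ∑ j, A i j ^ 2)

/-- The norm of the transpose of `A` in `ℓ_{1,2}`: the `ℓ₂` norm of the vector of the `ℓ₁` norms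
of the columns of `Aᵀ`, that is, of the rows of `A`. -/
noncomputable def transposeNorm12 {m n : ℕ} (A : Matrix (Fin m) (Fin n) ℝ) : ℝ :=
  Real.sqrt (∑ i, (∑ j, |A i j|) ^ 2)

/-- The softmax of a vector. -/
noncomputable def softmax {m : ℕ} (v : Fin m → ℝ) : Fin m → ℝ :=
  fun i => Real.exp (v i) / ∑ j, Real.exp (v j)

/-! ### The transformer -/

/-- The hyperparameters of the network: depth `D`, token dimension `d`, query and key dimension
`dh`, number `dF` of neurons, output dimension `dy`, number `h` of heads, temperature `τ`, and the
bounds that define the set of admissible parameters. -/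
structure Config where
  D : ℕ
  d : ℕ
  dh : ℕ
  dF : ℕ
  dy : ℕ
  h : ℕ
  τ : ℝ
  BA : ℝ
  BA1 : ℝ
  BA2 : ℝ
  BQ : ℝ
  BK : ℝ
  BV : ℝ

/-- The parameters of one layer. -/
structure LayerParam (c : Config) where
  γ1 : ℝ
  γ2 : ℝ
  WQ : Fin c.h → Matrix (Fin c.d) (Fin c.dh) ℝ
  WK : Fin c.h → Matrix (Fin c.d) (Fin c.dh) ℝ
  WV : Fin c.h → Matrix (Fin c.d) (Fin c.d) ℝ
  A1 : Matrix (Fin c.d) (Fin c.dF) ℝ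
  A2 : Matrix (Fin c.dF) (Fin c.d) ℝ

/-- The parameters of the whole network. -/
structure Param (c : Config) where
  layer : Fin c.D → LayerParam c
  A : Matrix (Fin c.d) (Fin c.dy) ℝ

/-- Attention with queries `Q`, keys `K`, values `V`; softmax is applied to each row. -/
noncomputable def attn {L k v : ℕ} (Q K : Matrix (Fin L) (Fin k) ℝ)
    (V : Matrix (Fin L) (Fin v) ℝ) : Matrix (Fin L) (Fin v) ℝ :=
  Matrix.of (fun i => softmax ((Q * K.transpose) i)) * V

/-- Multi-head attention. -/
noncomputable def mha {c : Config} {L : ℕ} (l : LayerParam c) (X : Matrix (Fin L) (Fin c.d) ℝ) :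
    Matrix (Fin L) (Fin c.d) ℝ :=
  ∑ i, attn (X * l.WQ i) (X * l.WK i) (X * l.WV i)

/-- The feed-forward module `ReLU(Y A₁) A₂`. -/
noncomputable def ffn {c : Config} {L : ℕ} (l : LayerParam c) (Y : Matrix (Fin L) (Fin c.d) ℝ) :
    Matrix (Fin L) (Fin c.d) ℝ :=
  (Y * l.A1).map (fun a => max a 0) * l.A2

/-- Layer normalization: every row is projected onto the unit `ℓ₂` ball. -/
noncomputable def normRows {L m : ℕ} (X : Matrix (Fin L) (Fin m) ℝ) : Matrix (Fin L) (Fin m) ℝ :=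
  Matrix.of (fun i j => X i j / max 1 (l2norm (X i)))

/-- One layer of the network. -/
noncomputable def applyLayer {c : Config} {L : ℕ} (l : LayerParam c)
    (X : Matrix (Fin L) (Fin c.d) ℝ) : Matrix (Fin L) (Fin c.d) ℝ :=
  let Y := normRows (mha l X + l.γ1 • X)
  normRows (ffn l Y + l.γ2 • Y)

/-- The output `X^{(D)}` of the last layer. -/
noncomputable def hidden {c : Config} {L : ℕ} (θ : Param c) (X : Matrix (Fin L) (Fin c.d) ℝ) :
    Matrix (Fin L) (Fin c.d) ℝ :=
  Fin.foldl c.D (fun Y t => applyLayer (θ.layer t) Y) X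

/-- The output probabilities of the network on the input `X`. -/
noncomputable def output {c : Config} {L : ℕ} (θ : Param c) (X : Matrix (Fin L) (Fin c.d) ℝ) :
    Fin c.dy → ℝ :=
  softmax (fun j => (∑ i, (hidden θ X * θ.A) i j) / (L * c.τ))

/-- Tokens are indexed by `Fin dy`; `emb` lists the vectors of the alphabet. The value is the
probability that the network gives to the next token `x` after the token sequence `S`. -/
noncomputable def modelProb {c : Config} (emb : Fin c.dy ↪ (Fin c.d → ℝ)) (θ : Param c)
    (S : List (Fin c.dy)) (x : Fin c.dy) : ℝ :=
  output θ (Matrix.of (fun i : Fin S.length => emb (S.get i))) x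

/-- The set `Θ` of admissible parameters. -/
def paramSet (c : Config) : Set (Param c) :=
  {θ | transposeNorm12 θ.A ≤ c.BA ∧
    ∀ t, |(θ.layer t).γ1| ≤ 1 ∧ |(θ.layer t).γ2| ≤ 1 ∧
      frob (θ.layer t).A1 ≤ c.BA1 ∧ frob (θ.layer t).A2 ≤ c.BA2 ∧
      ∀ i, frob ((θ.layer t).WQ i) ≤ c.BQ ∧ frob ((θ.layer t).WK i) ≤ c.BK ∧
        frob ((θ.layer t).WV i) ≤ c.BV}

/-! ### The nominal distribution

A concept `z` determines the conditional law `P z S` of the next token after the sequence `S`;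
`P z []` is the law of the first token. -/

/-- The probability that the tokens `xs` follow the sequence `past`. -/
noncomputable def seqProb {V : Type*} (p : List V → PMF V) : List V → List V → ℝ≥0∞
  | _, [] => 1
  | past, x :: xs => p past x * seqProb p (past ++ [x]) xs

/-- The law of the token sequence `k` steps after the sequence `S`: the `k`-step transition kernel
of the Markov chain whose state is the whole token sequence. -/
noncomputable def chainLaw {V : Type*} (p : List V → PMF V) (S : List V) : ℕ → PMF (List V)
  | 0 => PMF.pure S
  | k + 1 => (chainLaw p S k).bind fun S' => (p S').map fun x => S' ++ [x]

/-- The total variation distance. -/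
noncomputable def tv {α : Type*} (p q : PMF α) : ℝ :=
  ⨆ A : Set α, |(p.toOuterMeasure A).toReal - (q.toOuterMeasure A).toReal|

/-- The mixing time of the Markov chains `S₁, …, S_T` induced by the concepts: the least `k ≥ 1`
such that, for each concept, two chains that stand at time `i` in two states of positive
probability have laws at time `i + k ≤ T` at total variation distance at most `1/4`. -/
noncomputable def mixingTime {Z V : Type*} (P : Z → List V → PMF V) (T : ℕ) : ℕ :=
  sInf {k | 1 ≤ k ∧ ∀ z i, 1 ≤ i → i + k ≤ T → ∀ S S' : List V,
    S.length = i → S'.length = i → seqProb (P z) [] S ≠ 0 → seqProb (P z) [] S' ≠ 0 →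
      tv (chainLaw (P z) S k) (chainLaw (P z) S' k) ≤ 1 / 4}

section Pretraining

variable {Z : Type*} [MeasurableSpace Z] {V : Type*}

/-- The nominal predictive probability `P(x | S) = ∫ P(x | S, z) P(z | S) dz`, where the posterior
of the concept is `P(z | S) ∝ P(S | z) P_Z(z)`. -/
noncomputable def predictive (prior : MeasureTheory.Measure Z) (P : Z → List V → PMF V)
    (S : List V) (x : V) : ℝ :=
  ((∫⁻ z, P z S x * seqProb (P z) [] S ∂prior) / ∫⁻ z, seqProb (P z) [] S ∂prior).toReal

/-- The pretraining distribution: the average over `t ∈ {1, …, T}` of the law of `S_t`. -/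
noncomputable def pretrainDist (prior : MeasureTheory.Measure Z) (P : Z → List V → PMF V)
    (T : ℕ) (S : List V) : ℝ≥0∞ :=
  (∑ t ∈ Finset.Icc 1 T, ∫⁻ z, chainLaw (P z) [] t S ∂prior) / T

/-- The law of a pretraining trajectory `(x₁, …, x_{T+1})`: a concept is drawn from the prior, then
the tokens are drawn one after the other. -/
noncomputable def trajectoryLaw [MeasurableSpace V] (prior : MeasureTheory.Measure Z)
    (P : Z → List V → PMF V) (T : ℕ) : MeasureTheory.Measure (Fin (T + 1) → V) :=
  MeasureTheory.Measure.sum fun x : Fin (T + 1) → V =>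
    (∫⁻ z, seqProb (P z) [] (List.ofFn x) ∂prior) • MeasureTheory.Measure.dirac x

/-- The law of the pretraining data: `N` independent trajectories. -/
noncomputable def datasetLaw {m : ℕ} (prior : MeasureTheory.Measure Z)
    (P : Z → List (Fin m) → PMF (Fin m)) (N T : ℕ) :
    MeasureTheory.Measure (Fin N → Fin (T + 1) → Fin m) :=
  MeasureTheory.Measure.pi fun _ => trajectoryLaw prior P T

end Pretraining

/-- The cross-entropy loss of `θ` on the pretraining data `ω`: the average of
`-log P_θ(x_{t+1} | S_t)` over the trajectories and over `t = 1, …, T`. -/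
noncomputable def pretrainLoss {c : Config} (emb : Fin c.dy ↪ (Fin c.d → ℝ)) {N T : ℕ}
    (ω : Fin N → Fin (T + 1) → Fin c.dy) (θ : Param c) : ℝ :=
  -(1 / ((N : ℝ) * T)) * ∑ n, ∑ t : Fin T,
    Real.log (modelProb emb θ ((List.ofFn (ω n)).take (t.val + 1)) (ω n t.succ))

/-- `θ` is an output of the pretraining algorithm on the data `ω`. -/
def IsPretrained {c : Config} (emb : Fin c.dy ↪ (Fin c.d → ℝ)) {N T : ℕ}
    (ω : Fin N → Fin (T + 1) → Fin c.dy) (θ : Param c) : Prop :=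
  θ ∈ paramSet c ∧ ∀ θ' ∈ paramSet c, pretrainLoss emb ω θ ≤ pretrainLoss emb ω θ'

/-! ### The pretraining error bound -/

/-- `D̄ = D² d (d_F + d_h + d) + d d_y`. -/
def Config.Dbar (c : Config) : ℕ := c.D ^ 2 * c.d * (c.dF + c.dh + c.d) + c.d * c.dy

/-- `B̄ = τ⁻¹ R h B_A B_{A,1} B_{A,2} B_Q B_K B_V`. -/
noncomputable def Config.Bbar (c : Config) (R : ℝ) : ℝ :=
  c.τ⁻¹ * R * c.h * c.BA * c.BA1 * c.BA2 * c.BQ * c.BK * c.BV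

/-- `b_y = (1 + d_y exp(B_A / τ))⁻¹`. -/
noncomputable def Config.bY (c : Config) : ℝ := (1 + c.dy * Real.exp (c.BA / c.τ))⁻¹

/-- `b* = log max {c₀⁻¹, b_y⁻¹}`. -/
noncomputable def Config.bstar (c : Config) (c₀ : ℝ) : ℝ := Real.log (max c₀⁻¹ c.bY⁻¹)

/-- The expectation over `S` from the pretraining distribution of the Kullback–Leibler divergence
of `P_θ(· | S)` from `P(· | S)`. -/
noncomputable def approxKL {Z : Type*} [MeasurableSpace Z] {c : Config}
    (prior : MeasureTheory.Measure Z) (P : Z → List (Fin c.dy) → PMF (Fin c.dy))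
    (emb : Fin c.dy ↪ (Fin c.d → ℝ)) (T : ℕ) (θ : Param c) : ℝ :=
  ∑' S, (pretrainDist prior P T S).toReal *
    ∑ x, predictive prior P S x * Real.log (predictive prior P S x / modelProb emb θ S x)

/-- The pretraining error bound `Δ_pre(N, T, δ)`. -/
noncomputable def deltaPre {Z : Type*} [MeasurableSpace Z] {c : Config}
    (prior : MeasureTheory.Measure Z) (P : Z → List (Fin c.dy) → PMF (Fin c.dy))
    (emb : Fin c.dy ↪ (Fin c.d → ℝ)) (R : ℝ) (N T : ℕ) (δ : ℝ) : ℝ :=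
  (⨅ θ : paramSet c, Real.sqrt (approxKL prior P emb T θ.1))
    + (mixingTime P T : ℝ) ^ (1 / 4 : ℝ) * Real.log (1 / δ) / ((N : ℝ) * T) ^ (1 / 4 : ℝ)
    + Real.sqrt (mixingTime P T) / Real.sqrt ((N : ℝ) * T)
      * ((c.Dbar : ℝ) * Real.log (1 + (N : ℝ) * T * c.Bbar R) + Real.log (1 / δ))

/-! ### In-context learning -/

section InContext

variable {Z V : Type*}

/-- The token sequence `(c₁, r₁, …, c_t, r_t)` of a list of examples. -/
def tokens (E : List (List V × V)) : List V := E.flatMap fun e => e.1 ++ [e.2]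

/-- The prompt `(c₁, r₁, …, c_t, r_t, c_{t+1})` of a list of examples. -/
def prompt (E : List (List V × V)) (t : Fin E.length) : List V := tokens (E.take t) ++ (E.get t).1

/-- `K z S` is the law of the next covariate after the token sequence `S` under the concept `z`.
The tokens of the covariate come from the nominal distribution: the probability of the covariate
`q` is the nominal probability of its tokens times a weight that does not involve the concept, such
as the indicator of a fixed length, or that `q` ends with a delimiter, or a stopping
probability. -/
def IsCovariateLaw (P : Z → List V → PMF V) (K : Z → List V → PMF (List V)) : Prop :=
  ∃ w : List V → List V → ℝ≥0∞, ∀ z S q, K z S q = w S q * seqProb (P z) S q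

/-- The law of `t` examples from the concept `z`: covariates come from `K z`, and every response
comes from `P z` given the prompt. -/
noncomputable def examplesLaw (P : Z → List V → PMF V) (K : Z → List V → PMF (List V)) (z : Z) :
    ℕ → PMF (List (List V × V))
  | 0 => PMF.pure []
  | t + 1 => (examplesLaw P K z t).bind fun E => (K z (tokens E)).bind fun q =>
      (P z (tokens E ++ q)).map fun r => E ++ [(q, r)]

/-- The law of the prompt that consists of `t` examples and one more covariate. -/
noncomputable def promptLaw (P : Z → List V → PMF V) (K : Z → List V → PMF (List V)) (z : Z)
    (t : ℕ) : PMF (List V) :=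
  (examplesLaw P K z t).bind fun E => (K z (tokens E)).map fun q => tokens E ++ q

/-- The prompt distribution under the concept `z`: the average of the laws of
`prompt₀, …, prompt_{T-1}`. -/
noncomputable def promptDist (P : Z → List V → PMF V) (K : Z → List V → PMF (List V)) (T : ℕ)
    (z : Z) (S : List V) : ℝ≥0∞ :=
  (∑ t ∈ Finset.range T, promptLaw P K z t S) / T

/-- The regret of the model `θ` against the concept `z` on a list of examples. -/
noncomputable def regret {c : Config} (P : Z → List (Fin c.dy) → PMF (Fin c.dy))
    (emb : Fin c.dy ↪ (Fin c.d → ℝ)) (z : Z) (θ : Param c)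
    (E : List (List (Fin c.dy) × Fin c.dy)) : ℝ :=
  (E.length : ℝ)⁻¹ * (∑ t, Real.log (P z (prompt E t) (E.get t).2).toReal)
    - (E.length : ℝ)⁻¹ * (∑ t, Real.log (modelProb emb θ (prompt E t) (E.get t).2))

/-- The expected regret over `T` examples from the concept `z`. -/
noncomputable def expectedRegret {c : Config} (P : Z → List (Fin c.dy) → PMF (Fin c.dy))
    (K : Z → List (Fin c.dy) → PMF (List (Fin c.dy))) (emb : Fin c.dy ↪ (Fin c.d → ℝ)) (T : ℕ)
    (θ : Param c) (z : Z) : ℝ :=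
  ∑' E, (examplesLaw P K z T E).toReal * regret P emb z θ E

end InContext

end ICL

set_option linter.unusedSectionVars false

namespace ICL

/-! The regret is split at the Bayesian predictive law: the excess log-loss of the predictive law
over the concept, plus that of the network over the predictive law (`expectedRegret_eq`).

Bayesian model averaging. Let Φ(S) be the logarithm of the marginal probability of S divided by its
probability under the concept (`logEvidenceRatio`). At a response, the divergence of the predictive
law from the concept is exactly the expected decrease of Φ. At a covariate, Φ does not increase on
average, because the ratio is a supermartingale under the concept; here the covariate weight must
not depend on the concept. Φ starts at 0 and stays above -β, since the marginal contains the atom of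
the concept. The total over all examples is therefore at most β (`sum_expect_conceptKL_le`).

The network term. When the concept is averaged over the prior, the response given the prompt follows
the predictive law, so this term is a mean of divergences over prompts; these are nonnegative, and
domination by κ reduces it to κ times the pretraining divergence `approxKL`. Against a fixed concept
the response follows another law. `sum_mul_log_le_of_three` changes the measure at the price of a
constant and of b* times the model averaging regret, which is why b*β/T appears in the second bound.

Pretraining (`approxKL_pretrained_le`). The log-ratio of predictive and model probabilities is
bounded by b*, and its second moment is at most 4b* times its mean, the divergence. A Bernstein
bound over the N independent trajectories then gives the fast rate 1/N; dependence inside a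
trajectory is harmless by convexity. Uniformity over the parameters comes from a finite net, whose
size follows from the Lipschitz bounds for the network.

The rate 1/N suffices because the state of each chain is its whole history: different histories
never merge, so with at least two tokens the mixing time is at least T_p - 1, and 1/N is at most 2
t_mix/(N T_p). The entropy of the net exceeds D̄ log(1 + N T_p B̄) by a factor of order max(h, D) ≤
D̄. One of the two factors √(t_mix/(N T_p)) of the fast rate absorbs it; if D̄ √(t_mix/(N T_p)) > 1,
the claim is trivial because the divergence never exceeds b*. -/

/-! ### Euclidean and Frobenius norms -/

theorem l2norm_eq_norm {m : ℕ} (v : Fin m → ℝ) : l2norm v = ‖WithLp.toLp 2 v‖ := by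
  simp [l2norm, EuclideanSpace.norm_eq]

theorem l2norm_nonneg {m : ℕ} (v : Fin m → ℝ) : 0 ≤ l2norm v := Real.sqrt_nonneg _

theorem frob_nonneg {m n : ℕ} (A : Matrix (Fin m) (Fin n) ℝ) : 0 ≤ frob A := Real.sqrt_nonneg _

theorem l2norm_add_le {m : ℕ} (v w : Fin m → ℝ) : l2norm (v + w) ≤ l2norm v + l2norm w := by
  simp only [l2norm_eq_norm, WithLp.toLp_add]
  exact norm_add_le _ _

theorem l2norm_smul {m : ℕ} (a : ℝ) (v : Fin m → ℝ) : l2norm (a • v) = |a| * l2norm v := by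
  simp only [l2norm_eq_norm, WithLp.toLp_smul, norm_smul, Real.norm_eq_abs]

theorem l2norm_zero {m : ℕ} : l2norm (0 : Fin m → ℝ) = 0 := by simp [l2norm]

theorem l2norm_sum_le {ι : Type*} {m : ℕ} (s : Finset ι) (v : ι → Fin m → ℝ) :
    l2norm (∑ i ∈ s, v i) ≤ ∑ i ∈ s, l2norm (v i) := by
  simp only [l2norm_eq_norm, WithLp.toLp_sum]
  exact norm_sum_le _ _

theorem abs_l2norm_sub_le {m : ℕ} (v w : Fin m → ℝ) : |l2norm v - l2norm w| ≤ l2norm (v - w) := by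
  simp only [l2norm_eq_norm, WithLp.toLp_sub]
  exact abs_norm_sub_norm_le _ _

theorem abs_apply_le_l2norm {m : ℕ} (v : Fin m → ℝ) (i : Fin m) : |v i| ≤ l2norm v := by
  rw [l2norm]
  exact Real.abs_le_sqrt (Finset.single_le_sum (f := fun i => v i ^ 2)
    (fun _ _ => sq_nonneg _) (Finset.mem_univ i))

theorem l2norm_mono {m : ℕ} {v w : Fin m → ℝ} (h : ∀ i, |v i| ≤ |w i|) : l2norm v ≤ l2norm w :=
  Real.sqrt_le_sqrt (Finset.sum_le_sum fun i _ => sq_le_sq.2 (h i))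

theorem abs_dotProduct_le {m : ℕ} (v w : Fin m → ℝ) : |∑ i, v i * w i| ≤ l2norm v * l2norm w := by
  rw [l2norm, l2norm, ← Real.sqrt_mul (Finset.sum_nonneg fun i _ => sq_nonneg _)]
  exact Real.abs_le_sqrt (Finset.sum_mul_sq_le_sq_mul_sq _ _ _)

theorem l2norm_vecMul_le {m n : ℕ} (v : Fin m → ℝ) (A : Matrix (Fin m) (Fin n) ℝ) :
    l2norm (Matrix.vecMul v A) ≤ l2norm v * frob A := by
  rw [l2norm, l2norm, frob, ← Real.sqrt_mul (Finset.sum_nonneg fun i _ => sq_nonneg _)]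
  apply Real.sqrt_le_sqrt
  rw [Finset.sum_comm (f := fun i j => A i j ^ 2), Finset.mul_sum]
  exact Finset.sum_le_sum fun j _ =>
    Finset.sum_mul_sq_le_sq_mul_sq Finset.univ v fun i => A i j

theorem frob_le_of_abs_le {m n : ℕ} {A : Matrix (Fin m) (Fin n) ℝ} {a : ℝ} (ha : 0 ≤ a)
    (h : ∀ i j, |A i j| ≤ a) {s : ℝ} (hs : (m * n : ℕ) ≤ s) : frob A ≤ s * a := by
  have hs0 : 0 ≤ s := le_trans (Nat.cast_nonneg _) hs
  apply Real.sqrt_le_iff.2 ⟨by positivity, ?_⟩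
  calc ∑ i, ∑ j, A i j ^ 2 ≤ ∑ _i : Fin m, ∑ _j : Fin n, a ^ 2 := by
        refine Finset.sum_le_sum fun i _ => Finset.sum_le_sum fun j _ => ?_
        exact sq_le_sq.2 (by rw [abs_of_nonneg ha]; exact h i j)
    _ = (m * n : ℕ) * a ^ 2 := by simp; ring
    -- The square root of m n is given away, so that a single integer such as D̄ can bound the
    -- factor for every weight matrix.
    _ ≤ (m * n : ℕ) ^ 2 * a ^ 2 := by
        gcongr
        rcases Nat.eq_zero_or_pos (m * n) with h0 | h0
        · simp [h0]
        · exact_mod_cast Nat.le_self_pow two_ne_zero _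
    _ ≤ s ^ 2 * a ^ 2 := by gcongr
    _ = (s * a) ^ 2 := by ring

theorem abs_apply_le_frob {m n : ℕ} (A : Matrix (Fin m) (Fin n) ℝ) (i : Fin m) (j : Fin n) :
    |A i j| ≤ frob A := by
  refine Real.abs_le_sqrt ?_
  calc A i j ^ 2 ≤ ∑ j, A i j ^ 2 :=
        Finset.single_le_sum (f := fun j => A i j ^ 2) (fun _ _ => sq_nonneg _) (Finset.mem_univ j)
    _ ≤ _ := Finset.single_le_sum (f := fun i => ∑ j, A i j ^ 2)
        (fun _ _ => Finset.sum_nonneg fun _ _ => sq_nonneg _) (Finset.mem_univ i)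

theorem frob_le_transposeNorm12 {m n : ℕ} (A : Matrix (Fin m) (Fin n) ℝ) :
    frob A ≤ transposeNorm12 A := by
  refine Real.sqrt_le_sqrt (Finset.sum_le_sum fun i _ => ?_)
  simp_rw [← sq_abs (A i _)]
  exact Finset.sum_sq_le_sq_sum_of_nonneg fun j _ => abs_nonneg _

theorem l2norm_vecMul_sub_le {m n : ℕ} {x x' : Fin m → ℝ} {W W' : Matrix (Fin m) (Fin n) ℝ}
    {e ε B R : ℝ} (hx : l2norm (x - x') ≤ e) (hW : frob (W - W') ≤ ε) (hB : frob W ≤ B)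
    (hR : l2norm x' ≤ R) :
    l2norm (Matrix.vecMul x W - Matrix.vecMul x' W') ≤ e * B + R * ε := by
  have h : Matrix.vecMul x W - Matrix.vecMul x' W'
      = Matrix.vecMul (x - x') W + Matrix.vecMul x' (W - W') := by
    rw [Matrix.sub_vecMul, Matrix.vecMul_sub]; abel
  rw [h]
  refine (l2norm_add_le _ _).trans (add_le_add ?_ ?_)
  · exact (l2norm_vecMul_le _ _).trans (mul_le_mul hx hB (frob_nonneg _) ((l2norm_nonneg _).trans hx))
  · exact (l2norm_vecMul_le _ _).trans (mul_le_mul hR hW (frob_nonneg _) ((l2norm_nonneg _).trans hR))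

/-! ### Softmax -/

theorem sum_exp_pos {m : ℕ} [NeZero m] (v : Fin m → ℝ) : 0 < ∑ j, Real.exp (v j) :=
  Finset.sum_pos (fun _ _ => Real.exp_pos _) ⟨0, Finset.mem_univ _⟩

theorem softmax_pos {m : ℕ} (v : Fin m → ℝ) (i : Fin m) : 0 < softmax v i := by
  have : NeZero m := ⟨by rintro rfl; exact i.elim0⟩
  exact div_pos (Real.exp_pos _) (sum_exp_pos v)

theorem sum_softmax {m : ℕ} [NeZero m] (v : Fin m → ℝ) : ∑ i, softmax v i = 1 := by
  simp only [softmax, ← Finset.sum_div]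
  exact div_self (sum_exp_pos v).ne'

theorem softmax_le_exp_mul {m : ℕ} {u v : Fin m → ℝ} {a : ℝ} (h : ∀ j, |u j - v j| ≤ a)
    (i : Fin m) : softmax u i ≤ Real.exp (2 * a) * softmax v i := by
  have : NeZero m := ⟨by rintro rfl; exact i.elim0⟩
  have h1 : Real.exp (u i) ≤ Real.exp a * Real.exp (v i) := by
    rw [← Real.exp_add]; exact Real.exp_le_exp.2 (by linarith [(abs_le.1 (h i)).2])
  have h2 : ∑ j, Real.exp (v j) ≤ Real.exp a * ∑ j, Real.exp (u j) := by
    rw [Finset.mul_sum]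
    refine Finset.sum_le_sum fun j _ => ?_
    rw [← Real.exp_add]; exact Real.exp_le_exp.2 (by linarith [(abs_le.1 (h j)).1])
  have hu := sum_exp_pos u
  have hv := sum_exp_pos v
  simp only [softmax]
  rw [div_le_iff₀ hu, two_mul, Real.exp_add]
  calc Real.exp (u i) ≤ Real.exp a * Real.exp (v i) := h1
    _ = Real.exp a * Real.exp (v i) * ((∑ j, Real.exp (v j)) / ∑ j, Real.exp (v j)) := by
        rw [div_self hv.ne', mul_one]
    _ ≤ Real.exp a * Real.exp (v i) *
          ((Real.exp a * ∑ j, Real.exp (u j)) / ∑ j, Real.exp (v j)) := by gcongr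
    _ = _ := by ring

theorem abs_log_softmax_sub_le {m : ℕ} {u v : Fin m → ℝ} {a : ℝ} (h : ∀ j, |u j - v j| ≤ a)
    (i : Fin m) : |Real.log (softmax u i) - Real.log (softmax v i)| ≤ 2 * a := by
  have key : ∀ u v : Fin m → ℝ, (∀ j, |u j - v j| ≤ a) →
      Real.log (softmax u i) - Real.log (softmax v i) ≤ 2 * a := by
    intro u v h
    have := Real.log_le_log (softmax_pos u i) (softmax_le_exp_mul h i)
    rw [Real.log_mul (Real.exp_pos _).ne' (softmax_pos v i).ne', Real.log_exp] at this
    linarith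
  rw [abs_le]
  constructor
  · linarith [key v u (fun j => by rw [abs_sub_comm]; exact h j)]
  · exact key u v h

/-- Softmax is Lipschitz from the sup norm to the ℓ₁ norm with a constant free of m, hence later of
the sequence length. For small a the weights change by factors within exp(±2a), and these relative
errors sum against a probability vector; for large a the trivial bound 2 is enough. -/
theorem sum_abs_softmax_sub_le {m : ℕ} {u v : Fin m → ℝ} {a : ℝ} (ha : 0 ≤ a)
    (h : ∀ j, |u j - v j| ≤ a) : ∑ j, |softmax u j - softmax v j| ≤ 4 * a := by
  rcases Nat.eq_zero_or_pos m with rfl | hm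
  · simpa using ha
  have : NeZero m := ⟨hm.ne'⟩
  by_cases h1 : 2 * a ≤ 1
  · have hexp : Real.exp (2 * a) - 1 ≤ 4 * a := by
      have := Real.abs_exp_sub_one_le (x := 2 * a) (by rw [abs_of_nonneg (by linarith)]; exact h1)
      rw [abs_of_nonneg (by linarith : 0 ≤ 2 * a)] at this
      linarith [le_abs_self (Real.exp (2 * a) - 1)]
    have hexp' : 1 - Real.exp (-(2 * a)) ≤ 4 * a := by
      linarith [Real.add_one_le_exp (-(2 * a))]
    calc ∑ j, |softmax u j - softmax v j| ≤ ∑ j, 4 * a * softmax v j := by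
          refine Finset.sum_le_sum fun j _ => ?_
          have hp := softmax_pos v j
          have b1 := softmax_le_exp_mul h j
          have b2 := softmax_le_exp_mul (fun j => by rw [abs_sub_comm]; exact h j : ∀ j, |v j - u j| ≤ a) j
          have b3 : Real.exp (-(2 * a)) * softmax v j ≤ softmax u j := by
            rw [Real.exp_neg, inv_mul_le_iff₀ (Real.exp_pos _)]; exact b2
          rw [abs_le]
          constructor <;> nlinarith
      _ = 4 * a := by rw [← Finset.mul_sum, sum_softmax, mul_one]
  · calc ∑ j, |softmax u j - softmax v j| ≤ ∑ j, (softmax u j + softmax v j) := by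
          refine Finset.sum_le_sum fun j _ => ?_
          have := softmax_pos u j
          have := softmax_pos v j
          rw [abs_le]; constructor <;> linarith
      _ = 2 := by rw [Finset.sum_add_distrib, sum_softmax, sum_softmax]; norm_num
      _ ≤ 4 * a := by linarith

/-! ### Lipschitz bounds for the layers -/

theorem l2norm_normRows_le {L m : ℕ} (X : Matrix (Fin L) (Fin m) ℝ) (i : Fin L) :
    l2norm (normRows X i) ≤ 1 := by
  have h : normRows X i = (max 1 (l2norm (X i)))⁻¹ • X i := by
    ext j; simp [normRows, div_eq_inv_mul]
  have h0 : (0 : ℝ) < max 1 (l2norm (X i)) := lt_max_of_lt_left one_pos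
  rw [h, l2norm_smul, abs_of_pos (inv_pos.2 h0), inv_mul_le_iff₀ h0, mul_one]
  exact le_max_right _ _

/-- The difference is a rescaled X - Y plus the change of the scale applied to Y, and each part
costs one l2norm (X i - Y i). The crude constant 2 suffices. -/
theorem l2norm_normRows_sub_le {L m : ℕ} (X Y : Matrix (Fin L) (Fin m) ℝ) (i : Fin L) :
    l2norm (normRows X i - normRows Y i) ≤ 2 * l2norm (X i - Y i) := by
  set a := max 1 (l2norm (X i)) with ha
  set b := max 1 (l2norm (Y i)) with hb
  have ha1 : 1 ≤ a := le_max_left _ _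
  have hb1 : 1 ≤ b := le_max_left _ _
  have hab : |b - a| ≤ l2norm (X i - Y i) := by
    rw [abs_sub_comm]
    refine le_trans ?_ (abs_l2norm_sub_le _ _)
    rw [ha, hb, max_comm 1, max_comm 1]
    exact abs_max_sub_max_le_abs _ _ _
  have h : normRows X i - normRows Y i = a⁻¹ • (X i - Y i) + ((b - a) / (a * b)) • Y i := by
    ext j
    have : a ≠ 0 := by positivity
    have : b ≠ 0 := by positivity
    simp only [normRows, Matrix.of_apply, Pi.sub_apply, Pi.add_apply, Pi.smul_apply, smul_eq_mul,
      ← ha, ← hb]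
    field_simp
    ring
  rw [h, two_mul]
  refine (l2norm_add_le _ _).trans (add_le_add ?_ ?_)
  · rw [l2norm_smul, abs_of_pos (by positivity)]
    exact mul_le_of_le_one_left (l2norm_nonneg _) (inv_le_one_of_one_le₀ ha1)
  · rw [l2norm_smul, abs_div, abs_of_pos (by positivity : 0 < a * b), div_mul_eq_mul_div,
      div_le_iff₀ (by positivity)]
    calc |b - a| * l2norm (Y i) ≤ l2norm (X i - Y i) * b :=
          mul_le_mul hab (le_max_right _ _) (l2norm_nonneg _) (l2norm_nonneg _)
      _ ≤ l2norm (X i - Y i) * (a * b) := by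
          have := l2norm_nonneg (X i - Y i)
          gcongr
          nlinarith

theorem mul_apply_eq_vecMul {L m n : ℕ} (X : Matrix (Fin L) (Fin m) ℝ)
    (W : Matrix (Fin m) (Fin n) ℝ) (i : Fin L) : (X * W) i = Matrix.vecMul (X i) W := by
  ext j; simp [Matrix.mul_apply, Matrix.vecMul, dotProduct]

theorem attn_apply {L k v : ℕ} (Q K : Matrix (Fin L) (Fin k) ℝ) (V : Matrix (Fin L) (Fin v) ℝ)
    (i : Fin L) : attn Q K V i = ∑ j, softmax ((Q * K.transpose) i) j • V j := by
  ext l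
  simp [attn, Matrix.mul_apply, Finset.sum_apply]

/-- Changes of the attention weights and changes of the values are treated separately. The former
are measured in ℓ₁ and the weights sum to one, so no factor L arises. -/
theorem l2norm_attn_sub_le {L k v : ℕ} {Q Q' K K' : Matrix (Fin L) (Fin k) ℝ}
    {V V' : Matrix (Fin L) (Fin v) ℝ} {bQ bK bV eQ eK eV : ℝ}
    (hQ : ∀ i, l2norm (Q' i) ≤ bQ) (hK : ∀ i, l2norm (K i) ≤ bK) (hV : ∀ i, l2norm (V i) ≤ bV)
    (dQ : ∀ i, l2norm (Q i - Q' i) ≤ eQ) (dK : ∀ i, l2norm (K i - K' i) ≤ eK)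
    (dV : ∀ i, l2norm (V i - V' i) ≤ eV) (i : Fin L) :
    l2norm (attn Q K V i - attn Q' K' V' i) ≤ 4 * (eQ * bK + bQ * eK) * bV + eV := by
  have hb : 0 ≤ bQ := (l2norm_nonneg _).trans (hQ i)
  have hbK : 0 ≤ bK := (l2norm_nonneg _).trans (hK i)
  have hbV : 0 ≤ bV := (l2norm_nonneg _).trans (hV i)
  have heQ : 0 ≤ eQ := (l2norm_nonneg _).trans (dQ i)
  have heK : 0 ≤ eK := (l2norm_nonneg _).trans (dK i)
  have hscore : ∀ j, |(Q * K.transpose) i j - (Q' * K'.transpose) i j| ≤ eQ * bK + bQ * eK := by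
    intro j
    have h : (Q * K.transpose) i j - (Q' * K'.transpose) i j
        = ∑ l, (Q i - Q' i) l * K j l + ∑ l, Q' i l * (K j - K' j) l := by
      simp only [Matrix.mul_apply, Matrix.transpose_apply, Pi.sub_apply]
      rw [← Finset.sum_add_distrib, ← Finset.sum_sub_distrib]
      exact Finset.sum_congr rfl fun l _ => by ring
    rw [h]
    refine (abs_add_le _ _).trans (add_le_add ?_ ?_)
    · exact (abs_dotProduct_le _ _).trans (mul_le_mul (dQ i) (hK j) (l2norm_nonneg _) heQ)
    · exact (abs_dotProduct_le _ _).trans (mul_le_mul (hQ i) (dK j) (l2norm_nonneg _) hb)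
  have : NeZero L := ⟨by rintro rfl; exact i.elim0⟩
  set p := softmax ((Q * K.transpose) i)
  set p' := softmax ((Q' * K'.transpose) i)
  have h : attn Q K V i - attn Q' K' V' i
      = ∑ j, (p j - p' j) • V j + ∑ j, p' j • (V j - V' j) := by
    rw [attn_apply, attn_apply, ← Finset.sum_sub_distrib, ← Finset.sum_add_distrib]
    exact Finset.sum_congr rfl fun j _ => by rw [sub_smul, smul_sub]; abel
  rw [h]
  refine (l2norm_add_le _ _).trans (add_le_add ?_ ?_)
  · calc l2norm (∑ j, (p j - p' j) • V j) ≤ ∑ j, l2norm ((p j - p' j) • V j) := l2norm_sum_le _ _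
      _ ≤ ∑ j, |p j - p' j| * bV := by
          refine Finset.sum_le_sum fun j _ => ?_
          rw [l2norm_smul]
          exact mul_le_mul_of_nonneg_left (hV j) (abs_nonneg _)
      _ = (∑ j, |p j - p' j|) * bV := by rw [Finset.sum_mul]
      _ ≤ 4 * (eQ * bK + bQ * eK) * bV :=
          mul_le_mul_of_nonneg_right (sum_abs_softmax_sub_le (by positivity) hscore) hbV
  · calc l2norm (∑ j, p' j • (V j - V' j)) ≤ ∑ j, l2norm (p' j • (V j - V' j)) := l2norm_sum_le _ _
      _ ≤ ∑ j, p' j * eV := by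
          refine Finset.sum_le_sum fun j _ => ?_
          rw [l2norm_smul, abs_of_pos (softmax_pos _ j)]
          exact mul_le_mul_of_nonneg_left (dV j) (softmax_pos _ j).le
      _ = eV := by rw [← Finset.sum_mul, sum_softmax, one_mul]

theorem sum_matrix_apply {ι : Type*} {L m : ℕ} (s : Finset ι) (f : ι → Matrix (Fin L) (Fin m) ℝ)
    (i : Fin L) : (∑ j ∈ s, f j) i = ∑ j ∈ s, f j i := by
  ext l; simp [Matrix.sum_apply, Finset.sum_apply]

/-- The parameters of the layers `l` and `l'` differ by at most `ε`, matrix by matrix. -/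
structure LayerClose {c : Config} (ε : ℝ) (l l' : LayerParam c) : Prop where
  γ1 : |l.γ1 - l'.γ1| ≤ ε
  γ2 : |l.γ2 - l'.γ2| ≤ ε
  WQ : ∀ i, frob (l.WQ i - l'.WQ i) ≤ ε
  WK : ∀ i, frob (l.WK i - l'.WK i) ≤ ε
  WV : ∀ i, frob (l.WV i - l'.WV i) ≤ ε
  A1 : frob (l.A1 - l'.A1) ≤ ε
  A2 : frob (l.A2 - l'.A2) ≤ ε

/-- The constraints that define the admissible parameters of one layer. -/
def LayerBounded {c : Config} (l : LayerParam c) : Prop :=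
  |l.γ1| ≤ 1 ∧ |l.γ2| ≤ 1 ∧ frob l.A1 ≤ c.BA1 ∧ frob l.A2 ≤ c.BA2 ∧
    ∀ i, frob (l.WQ i) ≤ c.BQ ∧ frob (l.WK i) ≤ c.BK ∧ frob (l.WV i) ≤ c.BV

/-- The standing assumptions on the hyperparameters. -/
structure Config.Valid (c : Config) : Prop where
  D : 1 ≤ c.D
  h : 1 ≤ c.h
  hD : c.h ≤ c.Dbar
  τ_pos : 0 < c.τ
  τ_le : c.τ ≤ 1
  BA : 1 ≤ c.BA
  BA1 : 1 ≤ c.BA1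
  BA2 : 1 ≤ c.BA2
  BQ : 1 ≤ c.BQ
  BK : 1 ≤ c.BK
  BV : 1 ≤ c.BV

theorem l2norm_smul_sub_le {m : ℕ} {a a' : ℝ} {v v' : Fin m → ℝ} {e ε R : ℝ}
    (ha : |a - a'| ≤ ε) (ha1 : |a| ≤ 1) (hv : l2norm (v - v') ≤ e) (hR : l2norm v' ≤ R) :
    l2norm (a • v - a' • v') ≤ e + R * ε := by
  have h : a • v - a' • v' = a • (v - v') + (a - a') • v' := by
    rw [smul_sub, sub_smul]; abel
  rw [h]
  refine (l2norm_add_le _ _).trans (add_le_add ?_ ?_)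
  · rw [l2norm_smul]
    exact (mul_le_of_le_one_left (l2norm_nonneg _) ha1).trans hv
  · rw [l2norm_smul, mul_comm]
    exact mul_le_mul hR ha (abs_nonneg _) ((l2norm_nonneg _).trans hR)

theorem l2norm_mha_sub_le {c : Config} (hc : c.Valid) {L : ℕ} {l l' : LayerParam c}
    (hl : LayerBounded l) (hl' : LayerBounded l') {ε e R : ℝ} (he : 0 ≤ e) (hε : 0 ≤ ε)
    (hR : 1 ≤ R) (hll : LayerClose ε l l') {X X' : Matrix (Fin L) (Fin c.d) ℝ}
    (hX : ∀ i, l2norm (X i) ≤ R) (hX' : ∀ i, l2norm (X' i) ≤ R)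
    (hXX : ∀ i, l2norm (X i - X' i) ≤ e) (i : Fin L) :
    l2norm (mha l X i - mha l' X' i) ≤ 9 * (c.h * R ^ 3 * (c.BQ * c.BK * c.BV)) * (e + ε) := by
  obtain ⟨-, -, -, -, hW⟩ := hl
  obtain ⟨-, -, -, -, hW'⟩ := hl'
  have hBQ := hc.BQ
  have hBK := hc.BK
  have hBV := hc.BV
  have grow : ∀ {B : ℝ}, 1 ≤ B → e * B + R * ε ≤ R * B * (e + ε) := by
    intro B hB
    have h1 : e * B ≤ R * (e * B) := le_mul_of_one_le_left (by positivity) hR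
    have h2 : R * ε ≤ R * (B * ε) := by
      gcongr; exact le_mul_of_one_le_left hε hB
    nlinarith
  have bound : ∀ {n : ℕ} {Y : Matrix (Fin L) (Fin c.d) ℝ} {W : Matrix (Fin c.d) (Fin n) ℝ} {B : ℝ},
      (∀ i, l2norm (Y i) ≤ R) → frob W ≤ B → ∀ i, l2norm ((Y * W) i) ≤ R * B := by
    intro n Y W B hY hB i
    rw [mul_apply_eq_vecMul]
    exact (l2norm_vecMul_le _ _).trans
      (mul_le_mul (hY i) hB (frob_nonneg _) (by positivity))
  have diff : ∀ {n : ℕ} {W W' : Matrix (Fin c.d) (Fin n) ℝ} {B : ℝ}, 1 ≤ B →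
      frob (W - W') ≤ ε → frob W ≤ B →
      ∀ i, l2norm ((X * W) i - (X' * W') i) ≤ R * B * (e + ε) := by
    intro n W W' B hB1 hWW hB i
    rw [mul_apply_eq_vecMul, mul_apply_eq_vecMul]
    exact (l2norm_vecMul_sub_le (hXX i) hWW hB (hX' i)).trans (grow hB1)
  have head : ∀ k, l2norm (attn (X * l.WQ k) (X * l.WK k) (X * l.WV k) i
      - attn (X' * l'.WQ k) (X' * l'.WK k) (X' * l'.WV k) i)
      ≤ 9 * (R ^ 3 * (c.BQ * c.BK * c.BV)) * (e + ε) := by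
    intro k
    refine (l2norm_attn_sub_le (bound hX' (hW' k).1) (bound hX (hW k).2.1) (bound hX (hW k).2.2)
      (diff hBQ (hll.WQ k) (hW k).1) (diff hBK (hll.WK k) (hW k).2.1)
      -- The constant 9 is 4·2 for the two perturbations of the scores (queries and keys) plus 1 for
      -- the values; R³ collects the row norms of queries, keys and values.
      (diff hBV (hll.WV k) (hW k).2.2) i).trans ?_
    have h3 : R * c.BV * (e + ε) ≤ R ^ 3 * (c.BQ * c.BK * c.BV) * (e + ε) := by
      have h4 : R ≤ R ^ 3 := le_self_pow₀ hR (by norm_num)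
      have h5 : c.BV ≤ c.BQ * c.BK * c.BV :=
        le_mul_of_one_le_left (by positivity) (one_le_mul_of_one_le_of_one_le hBQ hBK)
      gcongr
    linear_combination h3
  have hsum : mha l X i - mha l' X' i = ∑ k, (attn (X * l.WQ k) (X * l.WK k) (X * l.WV k) i
      - attn (X' * l'.WQ k) (X' * l'.WK k) (X' * l'.WV k) i) := by
    rw [mha, mha, sum_matrix_apply, sum_matrix_apply, Finset.sum_sub_distrib]
  rw [hsum]
  calc _ ≤ _ := l2norm_sum_le _ _
    _ ≤ ∑ _k : Fin c.h, 9 * (R ^ 3 * (c.BQ * c.BK * c.BV)) * (e + ε) :=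
        Finset.sum_le_sum fun k _ => head k
    _ = _ := by simp; ring

theorem l2norm_ffn_sub_le {c : Config} (hc : c.Valid) {L : ℕ} {l l' : LayerParam c}
    (hl : LayerBounded l) (hl' : LayerBounded l') {ε e : ℝ} (he : 0 ≤ e) (hε : 0 ≤ ε)
    (hll : LayerClose ε l l') {Y Y' : Matrix (Fin L) (Fin c.d) ℝ}
    (hY' : ∀ i, l2norm (Y' i) ≤ 1)
    (hYY : ∀ i, l2norm (Y i - Y' i) ≤ e) (i : Fin L) :
    l2norm (ffn l Y i - ffn l' Y' i) ≤ 2 * (c.BA1 * c.BA2) * (e + ε) := by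
  have h1 := hc.BA1
  have h2 := hc.BA2
  have hpre : l2norm ((Y * l.A1) i - (Y' * l'.A1) i) ≤ e * c.BA1 + 1 * ε := by
    rw [mul_apply_eq_vecMul, mul_apply_eq_vecMul]
    exact l2norm_vecMul_sub_le (hYY i) hll.A1 hl.2.2.1 (hY' i)
  have hrelu : l2norm (((Y * l.A1).map fun a => max a 0) i - ((Y' * l'.A1).map fun a => max a 0) i)
      ≤ e * c.BA1 + 1 * ε :=
    (l2norm_mono fun j => abs_max_sub_max_le_abs _ _ _).trans hpre
  have hb : l2norm (((Y' * l'.A1).map fun a => max a 0) i) ≤ c.BA1 := by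
    calc _ ≤ l2norm ((Y' * l'.A1) i) := l2norm_mono fun j => by
          simpa using abs_max_sub_max_le_abs ((Y' * l'.A1) i j) 0 0
      _ ≤ 1 * c.BA1 := by
          rw [mul_apply_eq_vecMul]
          exact (l2norm_vecMul_le _ _).trans
            (mul_le_mul (hY' i) hl'.2.2.1 (frob_nonneg _) zero_le_one)
      _ = c.BA1 := one_mul _
  rw [ffn, ffn, mul_apply_eq_vecMul, mul_apply_eq_vecMul]
  refine (l2norm_vecMul_sub_le hrelu hll.A2 hl.2.2.2.1 hb).trans ?_
  have h3 : 1 * ε * c.BA2 ≤ c.BA1 * c.BA2 * ε := by nlinarith [mul_nonneg hε (by linarith : 0 ≤ c.BA2)]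
  have h4 : c.BA1 * ε ≤ c.BA1 * c.BA2 * ε := by nlinarith [mul_nonneg hε (by linarith : 0 ≤ c.BA1)]
  have h5 : 0 ≤ c.BA1 * c.BA2 * e := by positivity
  nlinarith

theorem one_le_prod_attn {c : Config} (hc : c.Valid) {R : ℝ} (hR : 1 ≤ R) :
    1 ≤ c.h * R ^ 3 * (c.BQ * c.BK * c.BV) := by
  have h1 : (1 : ℝ) ≤ c.h := by exact_mod_cast hc.h
  exact one_le_mul_of_one_le_of_one_le (one_le_mul_of_one_le_of_one_le h1 (one_le_pow₀ hR))
    (one_le_mul_of_one_le_of_one_le (one_le_mul_of_one_le_of_one_le hc.BQ hc.BK) hc.BV)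

theorem one_le_prod_ffn {c : Config} (hc : c.Valid) : 1 ≤ c.BA1 * c.BA2 :=
  one_le_mul_of_one_le_of_one_le hc.BA1 hc.BA2

/-- The constant is 126 = 2·3·21: each normalization doubles the error; the first half of the layer
gives 20 = 2(9 + 1), its parameter error raises this to 21, and the feed-forward module with its
skip connection contributes 2 + 1. -/
theorem l2norm_applyLayer_sub_le {c : Config} (hc : c.Valid) {L : ℕ} {l l' : LayerParam c}
    (hl : LayerBounded l) (hl' : LayerBounded l') {ε e R : ℝ} (he : 0 ≤ e) (hε : 0 ≤ ε)
    (hR : 1 ≤ R) (hll : LayerClose ε l l') {X X' : Matrix (Fin L) (Fin c.d) ℝ}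
    (hX : ∀ i, l2norm (X i) ≤ R) (hX' : ∀ i, l2norm (X' i) ≤ R)
    (hXX : ∀ i, l2norm (X i - X' i) ≤ e) (i : Fin L) :
    l2norm (applyLayer l X i - applyLayer l' X' i) ≤
      126 * (c.h * R ^ 3 * (c.BQ * c.BK * c.BV) * (c.BA1 * c.BA2)) * (e + ε) := by
  have ha := one_le_prod_attn hc hR
  have hf := one_le_prod_ffn hc
  set a := c.h * R ^ 3 * (c.BQ * c.BK * c.BV) with ha_def
  set f := c.BA1 * c.BA2 with hf_def
  set Y := normRows (mha l X + l.γ1 • X) with hY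
  set Y' := normRows (mha l' X' + l'.γ1 • X') with hY'
  have hYY : ∀ i, l2norm (Y i - Y' i) ≤ 20 * a * (e + ε) := by
    intro i
    refine (l2norm_normRows_sub_le _ _ i).trans ?_
    have h : (mha l X + l.γ1 • X) i - (mha l' X' + l'.γ1 • X') i
        = (mha l X i - mha l' X' i) + (l.γ1 • X i - l'.γ1 • X' i) := by
      ext j; simp only [Matrix.add_apply, Matrix.smul_apply, Pi.sub_apply, Pi.add_apply,
        Pi.smul_apply]; ring
    rw [h]
    have h1 := l2norm_mha_sub_le hc hl hl' he hε hR hll hX hX' hXX i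
    have h2 := l2norm_smul_sub_le hll.γ1 hl.1 (hXX i) (hX' i)
    have h3 := l2norm_add_le (mha l X i - mha l' X' i) (l.γ1 • X i - l'.γ1 • X' i)
    have hRa : R ≤ a := by
      have h4 : R ≤ R ^ 3 := le_self_pow₀ hR (by norm_num)
      have h5 : (1 : ℝ) ≤ c.h := by exact_mod_cast hc.h
      have h6 : 1 ≤ c.BQ * c.BK * c.BV :=
        one_le_mul_of_one_le_of_one_le (one_le_mul_of_one_le_of_one_le hc.BQ hc.BK) hc.BV
      calc R ≤ R ^ 3 := h4
        _ ≤ c.h * R ^ 3 := le_mul_of_one_le_left (by positivity) h5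
        _ ≤ a := le_mul_of_one_le_right (by positivity) h6
    have h7 : e ≤ a * e := le_mul_of_one_le_left he ha
    have h8 : R * ε ≤ a * ε := mul_le_mul_of_nonneg_right hRa hε
    rw [← ha_def] at h1
    linarith
  have hZ := l2norm_ffn_sub_le hc hl hl' (by positivity) hε hll
    (fun i => l2norm_normRows_le _ i) hYY i
  have hS := l2norm_smul_sub_le hll.γ2 hl.2.1 (hYY i) (l2norm_normRows_le _ i)
  have h : (ffn l Y + l.γ2 • Y) i - (ffn l' Y' + l'.γ2 • Y') i
      = (ffn l Y i - ffn l' Y' i) + (l.γ2 • Y i - l'.γ2 • Y' i) := by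
    ext j; simp only [Matrix.add_apply, Matrix.smul_apply, Pi.sub_apply, Pi.add_apply,
      Pi.smul_apply]; ring
  have h0 : l2norm (applyLayer l X i - applyLayer l' X' i)
      ≤ 2 * l2norm ((ffn l Y + l.γ2 • Y) i - (ffn l' Y' + l'.γ2 • Y') i) :=
    l2norm_normRows_sub_le _ _ i
  rw [h] at h0
  have h3 := l2norm_add_le (ffn l Y i - ffn l' Y' i) (l.γ2 • Y i - l'.γ2 • Y' i)
  rw [← hf_def] at hZ
  have h9 : 20 * a * (e + ε) + ε ≤ 21 * a * (e + ε) := by nlinarith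
  have h10 : 0 ≤ 20 * a * (e + ε) + ε := by positivity
  have h11 : 20 * a * (e + ε) + ε ≤ f * (20 * a * (e + ε) + ε) := le_mul_of_one_le_left h10 hf
  have h12 : f * (20 * a * (e + ε) + ε) ≤ f * (21 * a * (e + ε)) := by gcongr
  linear_combination h0 + 2 * h3 + 2 * hZ + 2 * hS + 2 * h11 + 6 * h12

theorem layer_const_le {c : Config} (hc : c.Valid) {R : ℝ} (hR : 1 ≤ R) :
    c.h * R ^ 3 * (c.BQ * c.BK * c.BV) * (c.BA1 * c.BA2) ≤ c.Bbar R ^ 3 := by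
  have h1 : (1 : ℝ) ≤ c.h := by exact_mod_cast hc.h
  have hτ : 1 ≤ c.τ⁻¹ := (one_le_inv₀ hc.τ_pos).2 hc.τ_le
  have hBA := hc.BA
  have hBQ := hc.BQ
  have hBK := hc.BK
  have hBV := hc.BV
  have hA1 := hc.BA1
  have hA2 := hc.BA2
  have e1 : c.Bbar R ^ 3 = (c.τ⁻¹ ^ 3 * c.BA ^ 3) * (c.h ^ 3 * R ^ 3 * (c.BQ ^ 3 * c.BK ^ 3 * c.BV ^ 3)
      * (c.BA1 ^ 3 * c.BA2 ^ 3)) := by rw [Config.Bbar]; ring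
  rw [e1]
  have h3 : ∀ {x : ℝ}, 1 ≤ x → x ≤ x ^ 3 := fun hx => le_self_pow₀ hx (by norm_num)
  calc _ ≤ c.h ^ 3 * R ^ 3 * (c.BQ ^ 3 * c.BK ^ 3 * c.BV ^ 3) * (c.BA1 ^ 3 * c.BA2 ^ 3) := by
        gcongr <;> apply h3 <;> assumption
    _ ≤ _ := le_mul_of_one_le_left (by positivity)
        (one_le_mul_of_one_le_of_one_le (one_le_pow₀ hτ) (one_le_pow₀ hBA))

theorem one_le_Bbar {c : Config} (hc : c.Valid) {R : ℝ} (hR : 1 ≤ R) : 1 ≤ c.Bbar R := by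
  have h1 : (1 : ℝ) ≤ c.h := by exact_mod_cast hc.h
  have hτ : 1 ≤ c.τ⁻¹ := (one_le_inv₀ hc.τ_pos).2 hc.τ_le
  rw [Config.Bbar]
  have mul {x y : ℝ} (hx : 1 ≤ x) (hy : 1 ≤ y) : 1 ≤ x * y := one_le_mul_of_one_le_of_one_le hx hy
  exact mul (mul (mul (mul (mul (mul (mul (mul hτ hR) h1) hc.BA) hc.BA1) hc.BA2) hc.BQ) hc.BK) hc.BV

/-- The sum of the row error and ε, not the error alone, grows geometrically from layer to layer,
since each layer injects a new parameter error ε. The row bound R is needed for the input only;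
later rows lie in the unit ball and R ≥ 1. -/
theorem foldl_applyLayer_sub_le {c : Config} (hc : c.Valid) {L n : ℕ}
    {l l' : Fin n → LayerParam c} (hl : ∀ t, LayerBounded (l t)) (hl' : ∀ t, LayerBounded (l' t))
    {ε R : ℝ} (hε : 0 ≤ ε) (hR : 1 ≤ R) (hll : ∀ t, LayerClose ε (l t) (l' t))
    {X : Matrix (Fin L) (Fin c.d) ℝ} (hX : ∀ i, l2norm (X i) ≤ R) (i : Fin L) :
    l2norm (Fin.foldl n (fun Y t => applyLayer (l t) Y) X i) ≤ R ∧
    l2norm (Fin.foldl n (fun Y t => applyLayer (l' t) Y) X i) ≤ R ∧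
    l2norm (Fin.foldl n (fun Y t => applyLayer (l t) Y) X i -
      Fin.foldl n (fun Y t => applyLayer (l' t) Y) X i) + ε ≤ (127 * c.Bbar R ^ 3) ^ n * ε := by
  induction n generalizing i with
  | zero => simp [hX i, l2norm_zero]
  | succ n ih =>
    rw [Fin.foldl_succ_last, Fin.foldl_succ_last]
    have IH := fun i => ih (l := fun t => l t.castSucc) (l' := fun t => l' t.castSucc)
      (fun t => hl _) (fun t => hl' _) (fun t => hll _) i
    have hle1 : ∀ Y : Matrix (Fin L) (Fin c.d) ℝ, ∀ l : LayerParam c, l2norm (applyLayer l Y i) ≤ R :=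
      fun Y l => (l2norm_normRows_le _ _).trans hR
    refine ⟨hle1 _ _, hle1 _ _, ?_⟩
    have hB := layer_const_le hc hR
    have ha := one_le_mul_of_one_le_of_one_le (one_le_prod_attn hc hR) (one_le_prod_ffn hc)
    -- The largest row error that the induction hypothesis allows, chosen so that e + ε is the
    -- geometric bound.
    set e := (127 * c.Bbar R ^ 3) ^ n * ε - ε with he
    have he0 : 0 ≤ e := by
      have h1 := (IH i).2.2
      have h2 := l2norm_nonneg (Fin.foldl n (fun Y t => applyLayer (l t.castSucc) Y) X i -
        Fin.foldl n (fun Y t => applyLayer (l' t.castSucc) Y) X i)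
      linarith
    have hstep := l2norm_applyLayer_sub_le hc (hl (Fin.last n)) (hl' (Fin.last n)) he0 hε hR (hll _)
      (fun i => (IH i).1) (fun i => (IH i).2.1) (fun i => by linarith [(IH i).2.2]) i
    have hee : e + ε = (127 * c.Bbar R ^ 3) ^ n * ε := by rw [he]; ring
    rw [hee] at hstep
    set w := (127 * c.Bbar R ^ 3) ^ n * ε with hw
    have hpow : 1 ≤ (127 * c.Bbar R ^ 3) ^ n := one_le_pow₀ (by linarith)
    have hwε : ε ≤ w := le_mul_of_one_le_left hε hpow
    have hw0 : 0 ≤ w := hε.trans hwε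
    calc _ ≤ 126 * c.Bbar R ^ 3 * w + ε := by
          refine add_le_add_left (hstep.trans ?_) ε
          gcongr
      _ ≤ 126 * c.Bbar R ^ 3 * w + c.Bbar R ^ 3 * w := by
          have : w ≤ c.Bbar R ^ 3 * w := le_mul_of_one_le_left hw0 (ha.trans hB)
          linarith
      _ = (127 * c.Bbar R ^ 3) ^ (n + 1) * ε := by rw [hw, pow_succ]; ring

theorem LayerBounded.of_mem {c : Config} {θ : Param c} (hθ : θ ∈ paramSet c) (t : Fin c.D) :
    LayerBounded (θ.layer t) := hθ.2 t

/-! ### The output layer: range and stability of the model probabilities -/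

theorem l2norm_hidden_le {c : Config} (hD : 1 ≤ c.D) {L : ℕ} (θ : Param c)
    (X : Matrix (Fin L) (Fin c.d) ℝ) (i : Fin L) : l2norm (hidden θ X i) ≤ 1 := by
  obtain ⟨D, d, dh, dF, dy, h, τ, BA, BA1, BA2, BQ, BK, BV⟩ := c
  obtain ⟨n, rfl⟩ : ∃ n, D = n + 1 := ⟨D - 1, by simp only at hD; omega⟩
  rw [hidden, Fin.foldl_succ_last]
  exact l2norm_normRows_le _ _

/-- The entries of the input of the last softmax. -/
noncomputable def logit {c : Config} {L : ℕ} (θ : Param c) (X : Matrix (Fin L) (Fin c.d) ℝ)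
    (j : Fin c.dy) : ℝ := (∑ i, (hidden θ X * θ.A) i j) / (L * c.τ)

theorem abs_sum_div_le {L : ℕ} {f : Fin L → ℝ} {a τ : ℝ} (ha : 0 ≤ a) (hτ : 0 < τ)
    (h : ∀ i, |f i| ≤ a) : |(∑ i, f i) / (L * τ)| ≤ a / τ := by
  rcases Nat.eq_zero_or_pos L with rfl | hL
  -- For an empty sequence the quotient is 0 / 0 = 0.
  · simp; positivity
  have hL' : (0 : ℝ) < L := by exact_mod_cast hL
  rw [abs_div, abs_of_pos (by positivity : 0 < L * τ), div_le_div_iff₀ (by positivity) hτ]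
  have : |∑ i, f i| ≤ L * a :=
    (Finset.abs_sum_le_sum_abs _ _).trans
      ((Finset.sum_le_sum fun i _ => h i).trans (by simp))
  nlinarith

/-- Two distinct entries of a row of `A` differ by at most the ℓ₁ norm of that row, so the gap is
one B_A/τ and not two. This is the exponent in the definition of b_y. -/
theorem logit_sub_le {c : Config} (hc : c.Valid) {L : ℕ} {θ : Param c} (hθ : θ ∈ paramSet c)
    (X : Matrix (Fin L) (Fin c.d) ℝ) (j k : Fin c.dy) :
    logit θ X j - logit θ X k ≤ c.BA / c.τ := by
  rcases eq_or_ne j k with rfl | hjk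
  · rw [sub_self]; exact div_nonneg (by linarith [hc.BA]) hc.τ_pos.le
  rw [logit, logit, ← sub_div, ← Finset.sum_sub_distrib]
  refine (le_abs_self _).trans (abs_sum_div_le (by linarith [hc.BA]) hc.τ_pos fun i => ?_)
  have h : (hidden θ X * θ.A) i j - (hidden θ X * θ.A) i k
      = ∑ l, hidden θ X i l * (θ.A l j - θ.A l k) := by
    rw [Matrix.mul_apply, Matrix.mul_apply, ← Finset.sum_sub_distrib]
    exact Finset.sum_congr rfl fun l _ => by ring
  rw [h]
  refine (abs_dotProduct_le _ _).trans ?_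
  have h2 : l2norm (fun l => θ.A l j - θ.A l k) ≤ transposeNorm12 θ.A := by
    refine Real.sqrt_le_sqrt (Finset.sum_le_sum fun l _ => sq_le_sq.2 ?_)
    rw [abs_of_nonneg (Finset.sum_nonneg fun _ _ => abs_nonneg _ : 0 ≤ ∑ j, |θ.A l j|)]
    refine (abs_sub _ _).trans ?_
    rw [← Finset.sum_pair (f := fun j => |θ.A l j|) hjk]
    exact Finset.sum_le_sum_of_subset_of_nonneg (Finset.subset_univ _) fun _ _ _ => abs_nonneg _
  calc _ ≤ 1 * c.BA := mul_le_mul (l2norm_hidden_le hc.D _ _ _) (h2.trans hθ.1)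
        (l2norm_nonneg _) zero_le_one
    _ = c.BA := one_mul _

theorem modelProb_pos {c : Config} (emb : Fin c.dy ↪ (Fin c.d → ℝ)) (θ : Param c)
    (S : List (Fin c.dy)) (x : Fin c.dy) : 0 < modelProb emb θ S x := by
  rw [modelProb, output]
  exact softmax_pos _ _

theorem sum_modelProb {c : Config} [NeZero c.dy] (emb : Fin c.dy ↪ (Fin c.d → ℝ)) (θ : Param c)
    (S : List (Fin c.dy)) : ∑ x, modelProb emb θ S x = 1 := sum_softmax _

theorem bY_le_modelProb {c : Config} (hc : c.Valid) (emb : Fin c.dy ↪ (Fin c.d → ℝ))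
    {θ : Param c} (hθ : θ ∈ paramSet c) (S : List (Fin c.dy)) (x : Fin c.dy) :
    c.bY ≤ modelProb emb θ S x := by
  have : NeZero c.dy := ⟨fun h => by
    have := x.2
    omega⟩
  set X := Matrix.of (fun i : Fin S.length => emb (S.get i))
  change c.bY ≤ Real.exp (logit θ X x) / ∑ j, Real.exp (logit θ X j)
  rw [Config.bY, inv_eq_one_div, div_le_div_iff₀ (by positivity) (sum_exp_pos _), one_mul]
  calc ∑ j, Real.exp (logit θ X j)
      ≤ ∑ _j : Fin c.dy, Real.exp (c.BA / c.τ) * Real.exp (logit θ X x) := by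
        refine Finset.sum_le_sum fun j _ => ?_
        rw [← Real.exp_add]
        exact Real.exp_le_exp.2 (by linarith [logit_sub_le hc hθ X j x])
    _ = Real.exp (logit θ X x) * (c.dy * Real.exp (c.BA / c.τ)) := by simp; ring
    _ ≤ Real.exp (logit θ X x) * (1 + c.dy * Real.exp (c.BA / c.τ)) := by gcongr; linarith

theorem abs_log_modelProb_sub_le {c : Config} (hc : c.Valid) (emb : Fin c.dy ↪ (Fin c.d → ℝ))
    {R ε : ℝ} (hR : 1 ≤ R) (hε : 0 ≤ ε) {θ θ' : Param c} (hθ : θ ∈ paramSet c)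
    (hθ' : θ' ∈ paramSet c) (hA : frob (θ.A - θ'.A) ≤ ε)
    (hll : ∀ t, LayerClose ε (θ.layer t) (θ'.layer t)) {S : List (Fin c.dy)}
    (hS : ∀ x ∈ S, l2norm (emb x) ≤ R) (x : Fin c.dy) :
    |Real.log (modelProb emb θ S x) - Real.log (modelProb emb θ' S x)| ≤
      2 * (c.Bbar R * ((127 * c.Bbar R ^ 3) ^ c.D * ε)) := by
  set X : Matrix (Fin S.length) (Fin c.d) ℝ := Matrix.of (fun i : Fin S.length => emb (S.get i))
    with hXdef
  refine abs_log_softmax_sub_le (u := logit θ X) (v := logit θ' X) (fun j => ?_) x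
  have hX : ∀ i, l2norm (X i) ≤ R := fun i => hS _ (List.get_mem _ _)
  have hfold := fun i => (foldl_applyLayer_sub_le hc (fun t => LayerBounded.of_mem hθ t)
    (fun t => LayerBounded.of_mem hθ' t) hε hR hll hX i).2.2
  set w := (127 * c.Bbar R ^ 3) ^ c.D * ε with hw
  have hBA := hc.BA
  have hτ := hc.τ_pos
  have hw0 : 0 ≤ w := by
    have := one_le_Bbar hc hR
    positivity
  have hrow : ∀ i, |(hidden θ X * θ.A) i j - (hidden θ' X * θ'.A) i j| ≤ c.BA * w := by
    intro i
    have h1 : l2norm (hidden θ X i - hidden θ' X i) ≤ w - ε := by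
      have := hfold i
      simp only [hidden]
      linarith
    have h2 := l2norm_vecMul_sub_le h1 hA ((frob_le_transposeNorm12 _).trans hθ.1)
      (l2norm_hidden_le hc.D θ' X i)
    have h3 := abs_apply_le_l2norm
      (Matrix.vecMul (hidden θ X i) θ.A - Matrix.vecMul (hidden θ' X i) θ'.A) j
    rw [Pi.sub_apply, ← mul_apply_eq_vecMul, ← mul_apply_eq_vecMul] at h3
    refine (h3.trans h2).trans ?_
    nlinarith
  rw [logit, logit, ← sub_div, ← Finset.sum_sub_distrib]
  refine (abs_sum_div_le (by positivity) hτ hrow).trans ?_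
  have h1 : (1 : ℝ) ≤ c.h := by exact_mod_cast hc.h
  -- The factors of B̄ that do not occur in B_A/τ are all at least 1, so they may be inserted.
  have h6 : 1 ≤ c.BA1 * c.BA2 * (c.BQ * c.BK * c.BV) * (R * c.h) :=
    one_le_mul_of_one_le_of_one_le (one_le_mul_of_one_le_of_one_le (one_le_prod_ffn hc)
      (one_le_mul_of_one_le_of_one_le (one_le_mul_of_one_le_of_one_le hc.BQ hc.BK) hc.BV))
      (one_le_mul_of_one_le_of_one_le hR h1)
  have h7 : c.Bbar R * w = c.BA * w / c.τ * (c.BA1 * c.BA2 * (c.BQ * c.BK * c.BV) * (R * c.h)) := by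
    rw [Config.Bbar, div_eq_mul_inv]; ring
  rw [h7]
  exact le_mul_of_one_le_right (by positivity) h6

/-! ### Covering the parameter set -/

theorem bounds_le_Bbar {c : Config} (hc : c.Valid) {R : ℝ} (hR : 1 ≤ R) :
    c.BA ≤ c.Bbar R ∧ c.BA1 ≤ c.Bbar R ∧ c.BA2 ≤ c.Bbar R ∧ c.BQ ≤ c.Bbar R ∧
      c.BK ≤ c.Bbar R ∧ c.BV ≤ c.Bbar R := by
  have h1 : (1 : ℝ) ≤ c.h := by exact_mod_cast hc.h
  have hτ : 1 ≤ c.τ⁻¹ := (one_le_inv₀ hc.τ_pos).2 hc.τ_le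
  have mul {x y : ℝ} (hx : 1 ≤ x) (hy : 1 ≤ y) : 1 ≤ x * y := one_le_mul_of_one_le_of_one_le hx hy
  have h0 := mul (mul hτ hR) h1
  have hA := mul h0 hc.BA
  have hA1 := mul hA hc.BA1
  have hA2 := mul hA1 hc.BA2
  have hQ := mul hA2 hc.BQ
  have hK := mul hQ hc.BK
  have up {x y z : ℝ} (hz : 0 ≤ z) (h : z ≤ x) (hy : 1 ≤ y) : z ≤ x * y :=
    h.trans (le_mul_of_one_le_right (hz.trans h) hy)
  have last {x y : ℝ} (hx : 1 ≤ x) (hy : 1 ≤ y) : y ≤ x * y :=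
    le_mul_of_one_le_left (by linarith) hx
  have pA : 0 ≤ c.BA := by linarith [hc.BA]
  have pA1 : 0 ≤ c.BA1 := by linarith [hc.BA1]
  have pA2 : 0 ≤ c.BA2 := by linarith [hc.BA2]
  have pQ : 0 ≤ c.BQ := by linarith [hc.BQ]
  have pK : 0 ≤ c.BK := by linarith [hc.BK]
  rw [Config.Bbar]
  refine ⟨?_, ?_, ?_, ?_, ?_, last hK hc.BV⟩
  · exact up pA (up pA (up pA (up pA (up pA (last h0 hc.BA) hc.BA1) hc.BA2) hc.BQ) hc.BK) hc.BV
  · exact up pA1 (up pA1 (up pA1 (up pA1 (last hA hc.BA1) hc.BA2) hc.BQ) hc.BK) hc.BV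
  · exact up pA2 (up pA2 (up pA2 (last hA1 hc.BA2) hc.BQ) hc.BK) hc.BV
  · exact up pQ (up pQ (last hA2 hc.BQ) hc.BK) hc.BV
  · exact up pK (last hQ hc.BK) hc.BV

/-- The index set of the scalar parameters of the network. -/
abbrev CoordIndex (c : Config) : Type :=
  (Fin c.D × (Bool ⊕ (Bool × Fin c.h × Fin c.d × Fin c.dh) ⊕ (Fin c.h × Fin c.d × Fin c.d) ⊕
    (Fin c.d × Fin c.dF) ⊕ (Fin c.dF × Fin c.d))) ⊕ (Fin c.d × Fin c.dy)

/-- The scalar parameters of the network. -/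
def coord {c : Config} (θ : Param c) : CoordIndex c → ℝ
  | .inl (t, .inl b) => if b then (θ.layer t).γ1 else (θ.layer t).γ2
  | .inl (t, .inr (.inl (b, k, i, j))) =>
      if b then (θ.layer t).WQ k i j else (θ.layer t).WK k i j
  | .inl (t, .inr (.inr (.inl (k, i, j)))) => (θ.layer t).WV k i j
  | .inl (t, .inr (.inr (.inr (.inl (i, j))))) => (θ.layer t).A1 i j
  | .inl (t, .inr (.inr (.inr (.inr (i, j))))) => (θ.layer t).A2 i j
  | .inr (i, j) => θ.A i j

theorem card_coordIndex (c : Config) : Fintype.card (CoordIndex c) =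
    c.D * (2 + (2 * (c.h * (c.d * c.dh)) + (c.h * (c.d * c.d) + (c.d * c.dF + c.dF * c.d))))
      + c.d * c.dy := by
  simp

theorem abs_coord_le {c : Config} (hc : c.Valid) {R : ℝ} (hR : 1 ≤ R) {θ : Param c}
    (hθ : θ ∈ paramSet c) (i : CoordIndex c) : |coord θ i| ≤ c.Bbar R := by
  obtain ⟨hA, hA1, hA2, hQ, hK, hV⟩ := bounds_le_Bbar hc hR
  have h1 := one_le_Bbar hc hR
  obtain ⟨hθA, hθl⟩ := hθ
  rcases i with ⟨t, b | ⟨b, k, i, j⟩ | ⟨k, i, j⟩ | ⟨i, j⟩ | ⟨i, j⟩⟩ | ⟨i, j⟩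
  · obtain ⟨g1, g2, -⟩ := hθl t
    cases b
    · exact g2.trans h1
    · exact g1.trans h1
  · obtain ⟨-, -, -, -, w⟩ := hθl t
    cases b
    · exact (abs_apply_le_frob _ i j).trans ((w k).2.1.trans hK)
    · exact (abs_apply_le_frob _ i j).trans ((w k).1.trans hQ)
  · exact (abs_apply_le_frob _ i j).trans (((hθl t).2.2.2.2 k).2.2.trans hV)
  · exact (abs_apply_le_frob _ i j).trans ((hθl t).2.2.1.trans hA1)
  · exact (abs_apply_le_frob _ i j).trans ((hθl t).2.2.2.1.trans hA2)
  · exact (abs_apply_le_frob _ i j).trans ((frob_le_transposeNorm12 _).trans (hθA.trans hA))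

theorem Config.Valid.d_pos {c : Config} (hc : c.Valid) : 1 ≤ c.d := by
  have h1 := hc.h.trans hc.hD
  by_contra h
  have : c.d = 0 := by omega
  simp [Config.Dbar, this] at h1

theorem sizes_le_Dbar {c : Config} (hc : c.Valid) : 1 ≤ c.Dbar ∧ c.D ≤ c.Dbar ∧
    c.d * c.dh ≤ c.Dbar ∧ c.d * c.d ≤ c.Dbar ∧ c.d * c.dF ≤ c.Dbar ∧ c.dF * c.d ≤ c.Dbar ∧
    c.d * c.dy ≤ c.Dbar := by
  have hD2 : c.D ≤ c.D ^ 2 := Nat.le_self_pow two_ne_zero _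
  have hD := hc.D
  have hd := hc.d_pos
  have hd2 : 1 ≤ c.d * c.d := Nat.mul_pos hd hd
  have e : c.Dbar = c.D ^ 2 * (c.d * c.dF + c.d * c.dh + c.d * c.d) + c.d * c.dy := by
    rw [Config.Dbar]; ring
  have hD1 : 1 ≤ c.D ^ 2 := hD.trans hD2
  have key : c.d * c.dF + c.d * c.dh + c.d * c.d
      ≤ c.D ^ 2 * (c.d * c.dF + c.d * c.dh + c.d * c.d) := Nat.le_mul_of_pos_left _ hD1
  have key2 : c.D ^ 2 * 1 ≤ c.D ^ 2 * (c.d * c.dF + c.d * c.dh + c.d * c.d) :=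
    Nat.mul_le_mul_left _ (by omega)
  have e2 : c.dF * c.d = c.d * c.dF := mul_comm _ _
  refine ⟨hc.h.trans hc.hD, ?_, ?_, ?_, ?_, ?_, ?_⟩ <;> omega

/-- The left side is the order of the entropy: every coordinate needs a precision exponentially
small in the depth, which costs a second factor D. The square of D in D̄ covers the layers, but D̄
counts neither the heads nor the depth for the output matrix; max(h, D) pays for these. -/
theorem card_coordIndex_mul_le {c : Config} (hc : c.Valid) :
    Fintype.card (CoordIndex c) * c.D ≤ 4 * (max c.h c.D * c.Dbar) := by
  have hd := hc.d_pos
  have hh := hc.h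
  rw [card_coordIndex]
  set m := max c.h c.D with hm
  have hhm : c.h ≤ m := le_max_left _ _
  have hDm : c.D ≤ m := le_max_right _ _
  have h1 : 1 ≤ m := hh.trans hhm
  have hd2 : 1 ≤ c.d * c.d := Nat.mul_pos hd hd
  have h2 : 2 + (2 * (c.h * (c.d * c.dh)) + (c.h * (c.d * c.d) + (c.d * c.dF + c.dF * c.d)))
      ≤ 4 * (m * (c.d * (c.dF + c.dh + c.d))) := by
    have a1 : c.h * (c.d * c.dh) ≤ m * (c.d * c.dh) := Nat.mul_le_mul_right _ hhm
    have a2 : c.h * (c.d * c.d) ≤ m * (c.d * c.d) := Nat.mul_le_mul_right _ hhm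
    have a3 : c.d * c.dF ≤ m * (c.d * c.dF) := Nat.le_mul_of_pos_left _ h1
    have a4 : 1 ≤ m * (c.d * c.d) := Nat.mul_pos h1 hd2
    have e1 : m * (c.d * (c.dF + c.dh + c.d)) = m * (c.d * c.dF) + m * (c.d * c.dh) + m * (c.d * c.d) := by
      ring
    have e2 : c.dF * c.d = c.d * c.dF := mul_comm _ _
    omega
  calc _ ≤ (c.D * (4 * (m * (c.d * (c.dF + c.dh + c.d)))) + c.d * c.dy) * c.D := by gcongr
    _ = 4 * (m * (c.D ^ 2 * c.d * (c.dF + c.dh + c.d))) + c.D * (c.d * c.dy) := by ring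
    _ ≤ 4 * (m * (c.D ^ 2 * c.d * (c.dF + c.dh + c.d))) + 4 * (m * (c.d * c.dy)) := by
        have : c.D * (c.d * c.dy) ≤ m * (c.d * c.dy) := Nat.mul_le_mul_right _ hDm
        omega
    _ = _ := by rw [Config.Dbar]; ring

theorem layerClose_of_coord {c : Config} (hc : c.Valid) {θ θ' : Param c} {a : ℝ} (ha : 0 ≤ a)
    (h : ∀ i, |coord θ i - coord θ' i| ≤ a) :
    frob (θ.A - θ'.A) ≤ c.Dbar * a ∧ ∀ t, LayerClose (c.Dbar * a) (θ.layer t) (θ'.layer t) := by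
  obtain ⟨h1, -, hdh, hdd, hdF, hFd, hdy⟩ := sizes_le_Dbar hc
  have h1' : a ≤ c.Dbar * a := le_mul_of_one_le_left ha (by exact_mod_cast h1)
  refine ⟨frob_le_of_abs_le ha (fun i j => h (.inr (i, j))) (by exact_mod_cast hdy), fun t => ?_⟩
  constructor
  · exact (h (.inl (t, .inl true))).trans h1'
  · exact (h (.inl (t, .inl false))).trans h1'
  · exact fun k => frob_le_of_abs_le ha (fun i j => h (.inl (t, .inr (.inl (true, k, i, j)))))
      (by exact_mod_cast hdh)
  · exact fun k => frob_le_of_abs_le ha (fun i j => h (.inl (t, .inr (.inl (false, k, i, j)))))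
      (by exact_mod_cast hdh)
  · exact fun k => frob_le_of_abs_le ha (fun i j => h (.inl (t, .inr (.inr (.inl (k, i, j))))))
      (by exact_mod_cast hdd)
  · exact frob_le_of_abs_le ha (fun i j => h (.inl (t, .inr (.inr (.inr (.inl (i, j)))))))
      (by exact_mod_cast hdF)
  · exact frob_le_of_abs_le ha (fun i j => h (.inl (t, .inr (.inr (.inr (.inr (i, j)))))))
      (by exact_mod_cast hFd)

/-- A set of vectors with entries bounded by `B` has, up to an error `a` in every entry, at most
`(2 ⌈B / a⌉ + 1) ^ n` elements. -/
theorem exists_finset_forall_abs_sub_le {α ι : Type*} [Fintype ι] (s : Set α) (f : α → ι → ℝ)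
    {a B : ℝ} (ha : 0 < a) (hB : ∀ x ∈ s, ∀ i, |f x i| ≤ B) :
    ∃ t : Finset α, (∀ x ∈ t, x ∈ s) ∧ t.card ≤ (2 * ⌈B / a⌉₊ + 1) ^ Fintype.card ι ∧
      ∀ x ∈ s, ∃ y ∈ t, ∀ i, |f x i - f y i| ≤ a := by
  classical
  set K := ⌈B / a⌉₊ with hK
  let code : α → ι → ℤ := fun x i => ⌊f x i / a⌋
  let box : Finset (ι → ℤ) := Fintype.piFinset fun _ => Finset.Icc (-(K : ℤ)) K
  have hmem : ∀ x ∈ s, code x ∈ box := by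
    intro x hx
    refine Fintype.mem_piFinset.2 fun i => Finset.mem_Icc.2 ?_
    have h1 := abs_le.1 (hB x hx i)
    have h2 : B / a ≤ K := Nat.le_ceil _
    constructor
    · refine Int.le_floor.2 ?_
      push_cast
      have : -B / a ≤ f x i / a := by gcongr; exact h1.1
      rw [neg_div] at this
      linarith
    · have h3 : f x i / a ≤ K := le_trans (by gcongr; exact h1.2) h2
      have h4 := (Int.floor_le (f x i / a)).trans h3
      exact_mod_cast h4
  -- Only occupied grid cells are kept, each represented by a point of s, so that the net consists
  -- of admissible parameters.
  let used := box.filter fun b => ∃ x ∈ s, code x = b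
  have hused : ∀ b : used, ∃ x ∈ s, code x = b := fun b => (Finset.mem_filter.1 b.2).2
  choose rep hrep hcode using hused
  refine ⟨used.attach.image rep, ?_, ?_, ?_⟩
  · intro x hx
    obtain ⟨b, -, rfl⟩ := Finset.mem_image.1 hx
    exact hrep b
  · calc _ ≤ used.attach.card := Finset.card_image_le
      _ = used.card := Finset.card_attach
      _ ≤ box.card := Finset.card_filter_le _ _
      _ = (2 * K + 1) ^ Fintype.card ι := by
          simp only [box, Fintype.card_piFinset, Int.card_Icc, Finset.prod_const, Finset.card_univ]
          congr 1
          omega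
  · intro x hx
    have hu : code x ∈ used := Finset.mem_filter.2 ⟨hmem x hx, x, hx, rfl⟩
    refine ⟨rep ⟨_, hu⟩, Finset.mem_image_of_mem _ (Finset.mem_attach _ _), fun i => ?_⟩
    have hfl : ⌊f (rep ⟨_, hu⟩) i / a⌋ = ⌊f x i / a⌋ := congrFun (hcode ⟨_, hu⟩) i
    have := Int.abs_sub_lt_one_of_floor_eq_floor hfl
    rw [← sub_div, abs_div, abs_of_pos ha, div_lt_one ha, abs_sub_comm] at this
    exact this.le

/-- A grid on the scalar parameters becomes a net for the log-probabilities, uniformly over all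
token sequences of bounded tokens. The hypothesis D̄ ≤ n lets log D̄ be absorbed in log(1 + n B̄).
-/
theorem exists_net {c : Config} (hc : c.Valid) (emb : Fin c.dy ↪ (Fin c.d → ℝ)) {R n : ℝ}
    (hR : 1 ≤ R) (hn : 1 ≤ n) (hDn : c.Dbar ≤ n) :
    ∃ net : Finset (Param c), (∀ θ ∈ net, θ ∈ paramSet c) ∧
      Real.log net.card ≤ 72 * (max c.h c.D * c.Dbar : ℕ) * Real.log (1 + n * c.Bbar R) ∧
      ∀ θ ∈ paramSet c, ∃ θ' ∈ net, ∀ S : List (Fin c.dy), (∀ x ∈ S, l2norm (emb x) ≤ R) →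
        ∀ x, |Real.log (modelProb emb θ S x) - Real.log (modelProb emb θ' S x)| ≤ 1 / n := by
  have hB := one_le_Bbar hc hR
  have hD1 : (1 : ℝ) ≤ c.Dbar := by exact_mod_cast (sizes_le_Dbar hc).1
  set B := c.Bbar R with hBdef
  set Λ := (127 * B ^ 3) ^ c.D with hΛ
  have hΛ1 : 1 ≤ Λ := one_le_pow₀ (by linarith [one_le_pow₀ hB (n := 3)])
  -- The mesh that makes the stability bound 2 B Λ (D̄ a) equal to 1/n.
  set a := 1 / (2 * n * c.Dbar * B * Λ) with ha
  have ha0 : 0 < a := by positivity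
  obtain ⟨net, hnet, hcard, hcov⟩ := exists_finset_forall_abs_sub_le (paramSet c) coord ha0
    (fun θ hθ i => abs_coord_le hc hR hθ i)
  refine ⟨net, hnet, ?_, fun θ hθ => ?_⟩
  · set G := 1 + n * B with hG
    have hnB : 1 ≤ n * B := one_le_mul_of_one_le_of_one_le hn hB
    have hG2 : 2 ≤ G := by linarith
    have hnG : n ≤ G := by nlinarith
    have hBG : B ≤ G := by nlinarith
    -- Every factor, including the numerical ones since G ≥ 2, is bounded by a power of G; 8 + 10 D
    -- ≤ 18 D. With the parameter count this yields 18·4 = 72.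
    have hq : (2 * ⌈B / a⌉₊ + 1 : ℝ) ≤ G ^ (18 * c.D) := by
      have h1 : (⌈B / a⌉₊ : ℝ) < B / a + 1 := Nat.ceil_lt_add_one (by positivity)
      have h2 : B / a = 2 * n * c.Dbar * B ^ 2 * Λ := by rw [ha]; field_simp
      have h3 : 1 ≤ n * c.Dbar * B ^ 2 * Λ :=
        one_le_mul_of_one_le_of_one_le (one_le_mul_of_one_le_of_one_le
          (one_le_mul_of_one_le_of_one_le hn hD1) (one_le_pow₀ hB)) hΛ1
      have h4 : Λ ≤ (G ^ 10) ^ c.D := by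
        rw [hΛ]
        gcongr
        calc 127 * B ^ 3 ≤ 2 ^ 7 * G ^ 3 := by gcongr; norm_num
          _ ≤ G ^ 7 * G ^ 3 := by gcongr
          _ = G ^ 10 := by ring
      calc (2 * ⌈B / a⌉₊ + 1 : ℝ) ≤ 2 ^ 4 * (n * c.Dbar * B ^ 2 * Λ) := by linarith
        _ ≤ G ^ 4 * (G * G * G ^ 2 * (G ^ 10) ^ c.D) := by
            have : (c.Dbar : ℝ) ≤ G := hDn.trans hnG
            gcongr
        _ = G ^ (8 + 10 * c.D) := by rw [← pow_mul, pow_add]; ring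
        _ ≤ G ^ (18 * c.D) := pow_le_pow_right₀ (by linarith) (by have := hc.D; omega)
    have hlogG : 0 ≤ Real.log G := Real.log_nonneg (by linarith)
    rcases Nat.eq_zero_or_pos net.card with h0 | h0
    · rw [h0]; simp only [Nat.cast_zero, Real.log_zero]; positivity
    calc Real.log net.card ≤ Real.log ((G ^ (18 * c.D)) ^ Fintype.card (CoordIndex c)) := by
          refine Real.log_le_log (by exact_mod_cast h0) ?_
          calc (net.card : ℝ) ≤ (2 * ⌈B / a⌉₊ + 1 : ℝ) ^ Fintype.card (CoordIndex c) := by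
                exact_mod_cast hcard
            _ ≤ _ := by gcongr
      _ = 18 * ((Fintype.card (CoordIndex c) * c.D : ℕ) : ℝ) * Real.log G := by
          rw [Real.log_pow, Real.log_pow]; push_cast; ring
      _ ≤ 18 * ((4 * (max c.h c.D * c.Dbar) : ℕ) : ℝ) * Real.log G := by
          have := card_coordIndex_mul_le hc
          exact mul_le_mul_of_nonneg_right
            (mul_le_mul_of_nonneg_left (by exact_mod_cast this) (by norm_num)) hlogG
      _ = _ := by push_cast; ring
  · obtain ⟨θ', hθ', hclose⟩ := hcov θ hθ
    refine ⟨θ', hθ', fun S hS x => ?_⟩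
    obtain ⟨hA, hl⟩ := layerClose_of_coord hc ha0.le hclose
    refine (abs_log_modelProb_sub_le hc emb hR (by positivity) hθ (hnet _ hθ') hA hl hS x).trans
      (le_of_eq ?_)
    rw [← hBdef, ← hΛ, ha]
    field_simp

/-! ### Laws of token sequences -/

section Sequences

variable {V : Type*}

theorem seqProb_append (p : List V → PMF V) (past xs ys : List V) :
    seqProb p past (xs ++ ys) = seqProb p past xs * seqProb p (past ++ xs) ys := by
  induction xs generalizing past with
  | nil => simp [seqProb]
  | cons x xs ih =>
    simp only [List.cons_append, seqProb, ih, mul_assoc, List.append_assoc, List.nil_append]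

theorem seqProb_concat (p : List V → PMF V) (past xs : List V) (x : V) :
    seqProb p past (xs ++ [x]) = seqProb p past xs * p (past ++ xs) x := by
  rw [seqProb_append]; simp [seqProb]

theorem seqProb_le_one (p : List V → PMF V) (past xs : List V) : seqProb p past xs ≤ 1 := by
  induction xs generalizing past with
  | nil => simp [seqProb]
  | cons x xs ih => exact mul_le_one' (PMF.coe_le_one _ _) (ih _)

theorem map_concat_apply (q : PMF V) (S : List V) (x : V) :
    (q.map fun y => S ++ [y]) (S ++ [x]) = q x := by
  classical
  rw [PMF.map_apply, tsum_eq_single x]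
  · simp
  · intro y hy
    simp [Ne.symm hy]

theorem map_concat_apply_of_ne (q : PMF V) {S l : List V} (h : S ≠ l) (x : V) :
    (q.map fun y => S ++ [y]) (l ++ [x]) = 0 := by
  classical
  rw [PMF.map_apply, ENNReal.tsum_eq_zero]
  intro y
  rw [if_neg]
  intro h2
  exact h (List.append_inj_left' h2 rfl).symm

theorem chainLaw_nil_apply (p : List V → PMF V) (t : ℕ) (l : List V) :
    chainLaw p [] t l = if l.length = t then seqProb p [] l else 0 := by
  induction t generalizing l with
  | zero =>
    rcases l with _ | ⟨a, l⟩ <;> simp [chainLaw, seqProb]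
  | succ t ih =>
    rw [chainLaw, PMF.bind_apply]
    rcases List.eq_nil_or_concat l with rfl | ⟨l, x, rfl⟩
    · simp
    · rw [tsum_eq_single l]
      · rw [List.concat_eq_append, map_concat_apply, ih, seqProb_concat]
        simp
      · intro S hS
        rw [List.concat_eq_append, map_concat_apply_of_ne _ hS, mul_zero]

theorem isPrefix_of_mem_support_chainLaw (p : List V → PMF V) (S : List V) (k : ℕ) :
    ∀ l ∈ (chainLaw p S k).support, S <+: l := by
  induction k with
  | zero => simp [chainLaw]
  | succ k ih =>
    intro l hl
    simp only [chainLaw, PMF.mem_support_bind_iff, PMF.mem_support_map_iff] at hl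
    obtain ⟨S', hS', x, -, rfl⟩ := hl
    exact (ih S' hS').trans (List.prefix_append _ _)

end Sequences

/-! ### Finite sums over token sequences -/

section Sums

variable {V : Type*} [Fintype V]

theorem sum_ofFn_succ (n : ℕ) (F : List V → ℝ) :
    ∑ x : Fin (n + 1) → V, F (List.ofFn x) = ∑ x : Fin n → V, ∑ a, F (List.ofFn x ++ [a]) := by
  rw [← (Fin.snocEquiv fun _ => V).sum_comp, Fintype.sum_prod_type, Finset.sum_comm]
  refine Finset.sum_congr rfl fun x _ => Finset.sum_congr rfl fun a _ => ?_
  rw [List.ofFn_succ', List.concat_eq_append]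
  simp [Fin.snocEquiv]

/-- The weights W are consistent, so the last tokens can be summed out one at a time. -/
theorem sum_take_ofFn {W : List V → ℝ} (hW : ∀ S, ∑ a, W (S ++ [a]) = W S) {k n : ℕ} (hk : k ≤ n)
    (g : List V → ℝ) :
    ∑ x : Fin n → V, W (List.ofFn x) * g ((List.ofFn x).take k)
      = ∑ x : Fin k → V, W (List.ofFn x) * g (List.ofFn x) := by
  induction n, hk using Nat.le_induction with
  | base =>
    refine Finset.sum_congr rfl fun x _ => ?_
    rw [List.take_of_length_le (by simp)]
  | succ n hn ih =>
    rw [sum_ofFn_succ n fun l => W l * g (l.take k), ← ih]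
    refine Finset.sum_congr rfl fun x _ => ?_
    rw [← hW, Finset.sum_mul]
    refine Finset.sum_congr rfl fun a _ => ?_
    rw [List.take_append_of_le_length (by simpa using hn)]

theorem take_ofFn_succ {T : ℕ} (x : Fin (T + 1) → V) (t : Fin T) :
    (List.ofFn x).take (t.val + 2) = (List.ofFn x).take (t.val + 1) ++ [x t.succ] := by
  have h : t.val + 1 < (List.ofFn x).length := by simp
  rw [← List.take_append_getElem h]
  simp

theorem sum_trajectory {W : List V → ℝ} (hW : ∀ S, ∑ a, W (S ++ [a]) = W S) {T : ℕ}
    (G : List V → V → ℝ) (t : Fin T) :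
    ∑ x : Fin (T + 1) → V, W (List.ofFn x) * G ((List.ofFn x).take (t.val + 1)) (x t.succ)
      = ∑ y : Fin (t.val + 1) → V, ∑ a, W (List.ofFn y ++ [a]) * G (List.ofFn y) a := by
  classical
  -- A prefix and its next token form the prefix of length t + 2, where the zero-based index t
  -- stands for time t + 1; the value at the empty list is never used.
  let g : List V → ℝ := fun l => if h : l ≠ [] then G l.dropLast (l.getLast h) else 0
  have hg : ∀ l a, g (l ++ [a]) = G l a := by intro l a; simp [g]
  have h1 := sum_take_ofFn hW (k := t.val + 2) (n := T + 1) (by omega) g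
  rw [sum_ofFn_succ (t.val + 1) fun l => W l * g l] at h1
  simp only [hg] at h1
  rw [← h1]
  refine Finset.sum_congr rfl fun x _ => ?_
  rw [take_ofFn_succ, hg]

theorem tsum_length_eq (n : ℕ) (F : List V → ℝ) :
    ∑' S : List V, (if S.length = n then F S else 0) = ∑ y : Fin n → V, F (List.ofFn y) := by
  rw [← tsum_fintype (L := .unconditional _)]
  rw [← (List.ofFn_injective (α := V) (n := n)).tsum_eq (f := fun S => if S.length = n then F S else 0)]
  · simp
  · intro S hS
    have : S.length = n := by
      by_contra h
      simp [h] at hS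
    subst this
    exact ⟨S.get, List.ofFn_get S⟩

theorem summable_length_eq (n : ℕ) (F : List V → ℝ) :
    Summable fun S : List V => if S.length = n then F S else 0 := by
  refine summable_of_hasFiniteSupport ((List.finite_length_eq V n).subset ?_)
  intro S hS
  by_contra h
  simp only [Set.mem_ofPred_eq] at h
  simp [h] at hS

end Sums

/-! ### Marginal probabilities and the predictive law -/

section Evidence

variable {Z : Type*} [MeasurableSpace Z] {V : Type*}

/-- The marginal probability of the token sequence `S`. -/
noncomputable def evidence (prior : MeasureTheory.Measure Z) (P : Z → List V → PMF V)
    (S : List V) : ℝ≥0∞ := ∫⁻ z, seqProb (P z) [] S ∂prior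

theorem measurable_seqProb {P : Z → List V → PMF V} (hP : ∀ S x, Measurable fun z => P z S x)
    (past S : List V) : Measurable fun z => seqProb (P z) past S := by
  induction S generalizing past with
  | nil => simp [seqProb]
  | cons x S ih => simp only [seqProb]; exact (hP _ _).mul (ih _)

variable {prior : MeasureTheory.Measure Z} [MeasureTheory.IsProbabilityMeasure prior]
  {P : Z → List V → PMF V}

theorem evidence_le_one (S : List V) : evidence prior P S ≤ 1 := by
  calc evidence prior P S ≤ ∫⁻ _, 1 ∂prior := MeasureTheory.lintegral_mono fun z => seqProb_le_one _ _ _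
    _ = 1 := by simp

theorem evidence_ne_top (S : List V) : evidence prior P S ≠ ∞ :=
  ne_top_of_le_ne_top ENNReal.one_ne_top (evidence_le_one S)

theorem evidence_nil : evidence prior P [] = 1 := by simp [evidence, seqProb]

theorem evidence_append_le (S S' : List V) : evidence prior P (S ++ S') ≤ evidence prior P S :=
  MeasureTheory.lintegral_mono fun z => by
    rw [seqProb_append]; exact mul_le_of_le_one_right' (seqProb_le_one _ _ _)

theorem predictive_eq (S : List V) (x : V) : predictive prior P S x
    = (evidence prior P (S ++ [x])).toReal / (evidence prior P S).toReal := by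
  simp only [predictive, evidence, seqProb_concat, List.nil_append, ENNReal.toReal_div, mul_comm]

theorem evidence_mul_predictive (S : List V) (x : V) :
    (evidence prior P S).toReal * predictive prior P S x
      = (evidence prior P (S ++ [x])).toReal := by
  rw [predictive_eq]
  -- At zero evidence the quotient is 0, and monotonicity makes the right side 0 as well, so the
  -- chain rule needs no positivity.
  by_cases h : evidence prior P S = 0
  · have : evidence prior P (S ++ [x]) = 0 := le_antisymm (h ▸ evidence_append_le S [x]) bot_le
    simp [h, this]
  · exact mul_div_cancel₀ _ (ENNReal.toReal_ne_zero.2 ⟨h, evidence_ne_top S⟩)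

theorem exists_seqProb_ne_zero {S : List V} (h : evidence prior P S ≠ 0) :
    ∃ z, seqProb (P z) [] S ≠ 0 := by
  by_contra! h2
  exact h (by simp [evidence, h2])

variable [Fintype V]

theorem sum_evidence (hP : ∀ S x, Measurable fun z => P z S x) (S : List V) :
    ∑ a, evidence prior P (S ++ [a]) = evidence prior P S := by
  simp only [evidence]
  rw [← MeasureTheory.lintegral_finsetSum _ fun a _ => measurable_seqProb hP _ _]
  refine MeasureTheory.lintegral_congr fun z => ?_
  simp only [seqProb_concat, List.nil_append, ← Finset.mul_sum]
  rw [← tsum_fintype (L := .unconditional _), PMF.tsum_coe, mul_one]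

theorem sum_toReal_evidence (hP : ∀ S x, Measurable fun z => P z S x) (S : List V) :
    ∑ a, (evidence prior P (S ++ [a])).toReal = (evidence prior P S).toReal := by
  rw [← sum_evidence hP S, ENNReal.toReal_sum fun a _ => evidence_ne_top _]

theorem predictive_nonneg (S : List V) (x : V) : 0 ≤ predictive prior P S x :=
  ENNReal.toReal_nonneg

theorem sum_predictive (hP : ∀ S x, Measurable fun z => P z S x) {S : List V}
    (hS : evidence prior P S ≠ 0) : ∑ x, predictive prior P S x = 1 := by
  simp only [predictive_eq, ← Finset.sum_div, sum_toReal_evidence hP]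
  exact div_self (ENNReal.toReal_ne_zero.2 ⟨hS, evidence_ne_top S⟩)

theorem predictive_le_one (hP : ∀ S x, Measurable fun z => P z S x) {S : List V}
    (hS : evidence prior P S ≠ 0) (x : V) : predictive prior P S x ≤ 1 := by
  rw [← sum_predictive hP hS]
  exact Finset.single_le_sum (fun x _ => predictive_nonneg S x) (Finset.mem_univ x)

/-- The predictive probability is an average over concepts and inherits a lower bound common to all
of them. -/
theorem le_predictive (hP : ∀ S x, Measurable fun z => P z S x) {c₀ : ℝ} (h0 : 0 ≤ c₀)
    {S : List V} {x : V} (h : ∀ z, c₀ ≤ (P z S x).toReal) (hS : evidence prior P S ≠ 0) :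
    c₀ ≤ predictive prior P S x := by
  have hpos := ENNReal.toReal_pos hS (evidence_ne_top S)
  rw [predictive_eq, le_div_iff₀ hpos]
  have h1 : ENNReal.ofReal c₀ * evidence prior P S ≤ evidence prior P (S ++ [x]) := by
    rw [evidence, ← MeasureTheory.lintegral_const_mul _ (measurable_seqProb hP _ _)]
    refine MeasureTheory.lintegral_mono fun z => ?_
    simp only [seqProb_concat, List.nil_append]
    rw [mul_comm]
    gcongr
    exact ENNReal.ofReal_le_of_le_toReal (h z)
  have h2 := ENNReal.toReal_mono (evidence_ne_top _) h1
  rwa [ENNReal.toReal_mul, ENNReal.toReal_ofReal h0] at h2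

theorem toReal_pretrainDist (T : ℕ) (S : List V) : (pretrainDist prior P T S).toReal
    = ∑ t : Fin T, if S.length = t.val + 1 then (evidence prior P S).toReal / T else 0 := by
  have h : ∀ t, ∫⁻ z, chainLaw (P z) [] t S ∂prior
      = if S.length = t then evidence prior P S else 0 := by
    intro t
    simp only [chainLaw_nil_apply, evidence]
    split_ifs <;> simp
  simp only [pretrainDist, h]
  rw [ENNReal.toReal_div, ENNReal.toReal_sum, Finset.sum_div,
    Fin.sum_univ_eq_sum_range
      (fun t => if S.length = t + 1 then (evidence prior P S).toReal / (T : ℝ) else 0)]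
  · refine Finset.sum_nbij' (fun t => t - 1) (fun t => t + 1) ?_ ?_ ?_ ?_ ?_
    · simp only [Finset.mem_Icc, Finset.mem_range]; omega
    · simp only [Finset.mem_Icc, Finset.mem_range]; omega
    · simp only [Finset.mem_Icc]; omega
    · simp
    · intro t ht
      obtain ⟨ht1, -⟩ := Finset.mem_Icc.1 ht
      rw [Nat.sub_add_cancel ht1]
      split_ifs <;> simp
  · intro t _
    split_ifs
    · exact evidence_ne_top S
    · exact ENNReal.zero_ne_top

theorem tsum_pretrainDist_mul (T : ℕ) (f : List V → ℝ) :
    ∑' S, (pretrainDist prior P T S).toReal * f S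
      = (∑ t : Fin T, ∑ y : Fin (t.val + 1) → V,
          (evidence prior P (List.ofFn y)).toReal * f (List.ofFn y)) / T := by
  simp only [toReal_pretrainDist, Finset.sum_mul, ite_mul, zero_mul]
  rw [Summable.tsum_finsetSum fun t _ => summable_length_eq _ _, Finset.sum_div]
  refine Finset.sum_congr rfl fun t _ => ?_
  rw [tsum_length_eq, Finset.sum_div]
  exact Finset.sum_congr rfl fun y _ => by ring

/-- The expectation over a trajectory of an average over time of a function of the current
sequence and the next token. -/
theorem sum_trajectory_average (hP : ∀ S x, Measurable fun z => P z S x) (T : ℕ)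
    (G : List V → V → ℝ) :
    ∑ x : Fin (T + 1) → V, (evidence prior P (List.ofFn x)).toReal *
        ((∑ t : Fin T, G ((List.ofFn x).take (t.val + 1)) (x t.succ)) / T)
      = ∑' S, (pretrainDist prior P T S).toReal * ∑ a, predictive prior P S a * G S a := by
  rw [tsum_pretrainDist_mul]
  simp_rw [← mul_div_assoc]
  rw [← Finset.sum_div]
  congr 1
  simp_rw [Finset.mul_sum]
  rw [Finset.sum_comm]
  refine Finset.sum_congr rfl fun t _ => ?_
  rw [sum_trajectory (W := fun S => (evidence prior P S).toReal) (sum_toReal_evidence hP) G t]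
  refine Finset.sum_congr rfl fun y _ => Finset.sum_congr rfl fun a _ => ?_
  rw [← mul_assoc, evidence_mul_predictive]

theorem sum_evidence_ofFn (hP : ∀ S x, Measurable fun z => P z S x) (n : ℕ) :
    ∑ x : Fin n → V, evidence prior P (List.ofFn x) = 1 := by
  have h := sum_take_ofFn (W := fun S => (evidence prior P S).toReal) (sum_toReal_evidence hP) (Nat.zero_le n) fun _ => 1
  simp only [mul_one, evidence_nil, List.ofFn_zero, ENNReal.toReal_one, Finset.sum_const,
    Finset.card_univ, Fintype.card_unique, one_smul] at h
  rw [← ENNReal.toReal_sum fun a _ => evidence_ne_top _] at h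
  rw [← ENNReal.ofReal_toReal (a := ∑ x : Fin n → V, evidence prior P (List.ofFn x))
    (ENNReal.sum_ne_top.2 fun a _ => evidence_ne_top _), h, ENNReal.ofReal_one]

variable [MeasurableSpace V] [MeasurableSingletonClass V]

theorem trajectoryLaw_eq (T : ℕ) : trajectoryLaw prior P T
    = ∑ x : Fin (T + 1) → V, evidence prior P (List.ofFn x) • MeasureTheory.Measure.dirac x := by
  rw [trajectoryLaw, MeasureTheory.Measure.sum_fintype]
  rfl

theorem isProbabilityMeasure_trajectoryLaw (hP : ∀ S x, Measurable fun z => P z S x) (T : ℕ) :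
    MeasureTheory.IsProbabilityMeasure (trajectoryLaw prior P T) := by
  constructor
  rw [trajectoryLaw_eq]
  simp [-List.ofFn_succ, sum_evidence_ofFn hP]

theorem integral_trajectoryLaw (T : ℕ) (f : (Fin (T + 1) → V) → ℝ) :
    ∫ x, f x ∂(trajectoryLaw prior P T)
      = ∑ x : Fin (T + 1) → V, (evidence prior P (List.ofFn x)).toReal * f x := by
  rw [trajectoryLaw_eq, MeasureTheory.integral_finsetSum_measure]
  · simp [MeasureTheory.integral_smul_measure]
  · intro x _
    exact (MeasureTheory.integrable_dirac (by simp)).smul_measure (evidence_ne_top _)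

/-- Log-ratios are controlled only where the evidence is positive; this restricts every estimate to
such trajectories. -/
theorem ae_trajectoryLaw (T : ℕ) :
    ∀ᵐ x ∂(trajectoryLaw prior P T), evidence prior P (List.ofFn x) ≠ 0 := by
  rw [trajectoryLaw_eq, MeasureTheory.ae_iff]
  simp only [MeasureTheory.Measure.coe_finsetSum, Finset.sum_apply,
    MeasureTheory.Measure.smul_apply, Finset.sum_eq_zero_iff, Finset.mem_univ, true_imp_iff]
  intro x
  by_cases h : evidence prior P (List.ofFn x) = 0
  · simp [-List.ofFn_succ, h]
  · simp [-List.ofFn_succ, h]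

end Evidence

/-! ### The mixing time -/

theorem toOuterMeasure_toReal_le_one {α : Type*} (p : PMF α) (A : Set α) :
    (p.toOuterMeasure A).toReal ≤ 1 := by
  have h : p.toOuterMeasure A ≤ 1 :=
    ((p.toOuterMeasure).mono (Set.subset_univ A)).trans
      ((PMF.toOuterMeasure_apply_eq_one_iff p Set.univ).2 (Set.subset_univ _)).le
  exact ENNReal.toReal_mono ENNReal.one_ne_top h

theorem le_tv {α : Type*} (p q : PMF α) (A : Set α) :
    |(p.toOuterMeasure A).toReal - (q.toOuterMeasure A).toReal| ≤ tv p q := by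
  refine le_ciSup (f := fun A : Set α =>
    |(p.toOuterMeasure A).toReal - (q.toOuterMeasure A).toReal|) ⟨1, ?_⟩ A
  rintro _ ⟨B, rfl⟩
  have h1 := toOuterMeasure_toReal_le_one p B
  have h2 := toOuterMeasure_toReal_le_one q B
  have h3 : 0 ≤ (p.toOuterMeasure B).toReal := ENNReal.toReal_nonneg
  have h4 : 0 ≤ (q.toOuterMeasure B).toReal := ENNReal.toReal_nonneg
  exact abs_le.2 ⟨by linarith, by linarith⟩

/-- Chains of whole sequences that start in different sequences of the same length never meet. -/
theorem one_le_tv_chainLaw {V : Type*} (p : List V → PMF V) {S S' : List V} (k : ℕ)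
    (hlen : S.length = S'.length) (hne : S ≠ S') : 1 ≤ tv (chainLaw p S k) (chainLaw p S' k) := by
  refine le_trans ?_ (le_tv _ _ {l | S <+: l})
  have h1 : (chainLaw p S k).toOuterMeasure {l | S <+: l} = 1 :=
    (PMF.toOuterMeasure_apply_eq_one_iff _ _).2 (isPrefix_of_mem_support_chainLaw p S k)
  have h2 : (chainLaw p S' k).toOuterMeasure {l | S <+: l} = 0 := by
    rw [PMF.toOuterMeasure_apply_eq_zero_iff, Set.disjoint_left]
    intro l hl hl'
    exact hne ((List.prefix_of_prefix_length_le hl'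
      (isPrefix_of_mem_support_chainLaw p S' k l hl) hlen.le).eq_of_length hlen)
  simp [h1, h2]

theorem mixingTime_spec {Z V : Type*} (P : Z → List V → PMF V) {T : ℕ} (hT : 1 ≤ T) :
    1 ≤ mixingTime P T ∧ mixingTime P T ≤ T ∧ ∀ z i, 1 ≤ i → i + mixingTime P T ≤ T →
      ∀ S S' : List V, S.length = i → S'.length = i → seqProb (P z) [] S ≠ 0 →
        seqProb (P z) [] S' ≠ 0 →
          tv (chainLaw (P z) S (mixingTime P T)) (chainLaw (P z) S' (mixingTime P T)) ≤ 1 / 4 := by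
  -- At k = T there is no time i ≥ 1 left to test, so the set is nonempty and its infimum is
  -- attained.
  have hmem : T ∈ {k | 1 ≤ k ∧ ∀ z i, 1 ≤ i → i + k ≤ T → ∀ S S' : List V,
      S.length = i → S'.length = i → seqProb (P z) [] S ≠ 0 → seqProb (P z) [] S' ≠ 0 →
      tv (chainLaw (P z) S k) (chainLaw (P z) S' k) ≤ 1 / 4} :=
    ⟨hT, fun z i hi hiT => absurd hiT (by omega)⟩
  obtain ⟨h1, h2⟩ := Nat.sInf_mem ⟨T, hmem⟩
  exact ⟨h1, Nat.sInf_le hmem, h2⟩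

/-- Two histories that differ in their second token remain at distance one forever, so no k with 2 +
k ≤ T can mix. This converts a bound in 1/N into one in terms of the mixing time. -/
theorem le_mixingTime_add_one {Z V : Type*} [Nonempty Z] [Nontrivial V] (P : Z → List V → PMF V)
    (hP : ∀ z S x, S ≠ [] → P z S x ≠ 0) {T : ℕ} (hT : 1 ≤ T) : T ≤ mixingTime P T + 1 := by
  obtain ⟨-, -, h⟩ := mixingTime_spec P hT
  by_contra hlt
  obtain ⟨z⟩ := ‹Nonempty Z›
  obtain ⟨a, b, hab⟩ := exists_pair_ne V
  obtain ⟨x, hx⟩ := (P z []).support_nonempty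
  have hpos : ∀ y, seqProb (P z) [] [x, y] ≠ 0 := fun y => by
    simp only [seqProb, List.nil_append, mul_one]
    exact mul_ne_zero ((PMF.mem_support_iff _ _).1 hx) (hP z _ y (by simp))
  -- Time 2 and not 1: positivity is assumed after nonempty sequences only, so the first token may
  -- be deterministic.
  have h1 := h z 2 (by norm_num) (by omega) [x, a] [x, b] rfl rfl (hpos a) (hpos b)
  have h2 := one_le_tv_chainLaw (P z) (mixingTime P T) (S := [x, a]) (S' := [x, b]) rfl
    (by simpa using hab)
  linarith

/-! ### Concentration of empirical risks -/

section Concentration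

open MeasureTheory

variable {X : Type*} [MeasurableSpace X] [Finite X] [MeasurableSingletonClass X]

/-- The Chernoff bound for a sum of independent copies. -/
theorem measureReal_le_sum_le (μ : Measure X) [IsProbabilityMeasure μ] (N : ℕ) (f : X → ℝ) (a : ℝ)
    {m : ℝ} (hm : ∫ x, Real.exp (f x) ∂μ ≤ Real.exp m) :
    (Measure.pi fun _ : Fin N => μ).real {ω | a ≤ ∑ n, f (ω n)} ≤ Real.exp (N * m - a) := by
  have h1 := mul_meas_ge_le_integral_of_nonneg (μ := Measure.pi fun _ : Fin N => μ)
    (f := fun ω => Real.exp (∑ n, f (ω n))) (ae_of_all _ fun _ => (Real.exp_pos _).le)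
    (Integrable.of_finite) (Real.exp a)
  simp only [Real.exp_le_exp] at h1
  have h2 : ∫ ω, Real.exp (∑ n, f (ω n)) ∂(Measure.pi fun _ : Fin N => μ)
      = (∫ x, Real.exp (f x) ∂μ) ^ N := by
    simp only [Real.exp_sum]
    rw [integral_fintype_prod_eq_prod (fun _ : Fin N => fun x => Real.exp (f x))]
    simp
  rw [h2] at h1
  rw [Real.exp_sub, le_div_iff₀ (Real.exp_pos a), mul_comm]
  refine h1.trans ?_
  rw [Real.exp_nat_mul]
  exact pow_le_pow_left₀ (integral_nonneg fun _ => (Real.exp_pos _).le) hm N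

/-- The exponential moment of a bounded variable whose second moment is controlled by its mean. -/
theorem integral_exp_mul_le (μ : Measure X) [IsProbabilityMeasure μ] {V : X → ℝ} {k s : ℝ}
    (hs : |s| ≤ 1) (hV : ∀ᵐ x ∂μ, |V x| ≤ 1) (hV2 : ∫ x, V x ^ 2 ∂μ ≤ k * ∫ x, V x ∂μ) :
    ∫ x, Real.exp (s * V x) ∂μ ≤ Real.exp ((s + s ^ 2 * k) * ∫ x, V x ∂μ) := by
  calc ∫ x, Real.exp (s * V x) ∂μ ≤ ∫ x, (1 + s * V x + s ^ 2 * V x ^ 2) ∂μ := by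
        refine integral_mono_ae Integrable.of_finite Integrable.of_finite ?_
        filter_upwards [hV] with x hx
        have h1 : |s * V x| ≤ 1 := by
          rw [abs_mul]; exact mul_le_one₀ hs (abs_nonneg _) hx
        -- This is exp y ≤ 1 + y + y² for |y| ≤ 1.
        have h2 := Real.abs_exp_sub_one_sub_id_le h1
        have h3 := le_abs_self (Real.exp (s * V x) - 1 - s * V x)
        nlinarith
    _ = 1 + s * ∫ x, V x ∂μ + s ^ 2 * ∫ x, V x ^ 2 ∂μ := by
        rw [integral_add Integrable.of_finite Integrable.of_finite,
          integral_add Integrable.of_finite Integrable.of_finite,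
          integral_const_mul, integral_const_mul]
        simp
    _ ≤ 1 + (s + s ^ 2 * k) * ∫ x, V x ∂μ := by nlinarith [sq_nonneg s]
    _ ≤ _ := by linarith [Real.add_one_le_exp ((s + s ^ 2 * k) * ∫ x, V x ∂μ)]

/-- A uniform deviation bound of Bernstein type: with probability at least `1 - δ` the empirical
mean of `U` is at most of the order of its mean, and for all members `V θ` of a finite family the
mean is at most of the order of the empirical mean. -/
theorem bernstein_uniform (μ : Measure X) [IsProbabilityMeasure μ] {N : ℕ} {k δ : ℝ} (hk : 1 ≤ k)
    (hδ : 0 < δ) {Θ : Type*} (net : Finset Θ) (V : Θ → X → ℝ) (U : X → ℝ)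
    (hU : ∀ᵐ x ∂μ, |U x| ≤ 1) (hU2 : ∫ x, U x ^ 2 ∂μ ≤ k * ∫ x, U x ∂μ)
    (hV : ∀ θ ∈ net, ∀ᵐ x ∂μ, |V θ x| ≤ 1)
    (hV2 : ∀ θ ∈ net, ∫ x, V θ x ^ 2 ∂μ ≤ k * ∫ x, V θ x ∂μ) :
    1 - δ ≤ (Measure.pi fun _ : Fin N => μ).real {ω |
      ∑ n, U (ω n) ≤ 2 * (N * ∫ x, U x ∂μ) + 2 * k * Real.log (2 / δ) ∧
      ∀ θ ∈ net, N * ∫ x, V θ x ∂μ ≤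
        2 * ∑ n, V θ (ω n) + 4 * k * (Real.log (2 / δ) + Real.log net.card)} := by
  classical
  set ν := Measure.pi fun _ : Fin N => μ with hν
  -- The exponent for which the second-moment term s² k equals s/2, half the linear term. The
  -- empirical and the true mean then agree up to a factor 2, on both sides.
  set s := (2 * k)⁻¹ with hs
  have hs0 : 0 < s := by positivity
  have hs1 : |s| ≤ 1 := by
    rw [abs_of_pos hs0]; exact inv_le_one_of_one_le₀ (by linarith)
  have hsk : s ^ 2 * k = s / 2 := by rw [hs]; field_simp
  have hks : 2 * k * s = 1 := by rw [hs]; field_simp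
  have hUnn : 0 ≤ ∫ x, U x ∂μ := by
    have : 0 ≤ ∫ x, U x ^ 2 ∂μ := integral_nonneg fun _ => sq_nonneg _
    by_contra! h
    nlinarith
  set G := {ω : Fin N → X |
      ∑ n, U (ω n) ≤ 2 * (N * ∫ x, U x ∂μ) + 2 * k * Real.log (2 / δ) ∧
      ∀ θ ∈ net, N * ∫ x, V θ x ∂μ ≤
        2 * ∑ n, V θ (ω n) + 4 * k * (Real.log (2 / δ) + Real.log net.card)} with hG
  set A0 := {ω : Fin N → X | 2 * s * (N * ∫ x, U x ∂μ) + Real.log (2 / δ) ≤ ∑ n, s * U (ω n)}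
  -- Half of the failure probability is reserved for U; the other half is shared equally by the
  -- members of the net.
  set A := fun θ => {ω : Fin N → X | -(s / 2 * (N * ∫ x, V θ x ∂μ)) + (Real.log (2 / δ) +
    Real.log net.card) ≤ ∑ n, -s * V θ (ω n)}
  have hA0 : ν.real A0 ≤ δ / 2 := by
    refine (measureReal_le_sum_le μ N (fun x => s * U x) _
      (integral_exp_mul_le μ hs1 hU hU2)).trans ?_
    rw [hsk, ← Real.exp_log (by positivity : 0 < δ / 2)]
    refine Real.exp_le_exp.2 ?_
    have h1 : Real.log (2 / δ) = - Real.log (δ / 2) := by rw [← Real.log_inv, inv_div]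
    rw [h1]
    have : 0 ≤ s * (N * ∫ x, U x ∂μ) := by positivity
    linarith
  have hA : ∀ θ ∈ net, ν.real (A θ) ≤ δ / 2 / net.card := by
    intro θ hθ
    have hcard : (0 : ℝ) < net.card := by exact_mod_cast Finset.card_pos.2 ⟨θ, hθ⟩
    refine (measureReal_le_sum_le μ N (fun x => -s * V θ x) _
      (integral_exp_mul_le μ (by rwa [abs_neg]) (hV θ hθ) (hV2 θ hθ))).trans ?_
    rw [neg_sq, hsk, ← Real.exp_log (by positivity : 0 < δ / 2 / net.card)]
    refine Real.exp_le_exp.2 (le_of_eq ?_)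
    have h1 : Real.log (2 / δ) = - Real.log (δ / 2) := by rw [← Real.log_inv, inv_div]
    rw [h1, Real.log_div (by positivity) hcard.ne']
    ring
  have hsub : Gᶜ ⊆ A0 ∪ ⋃ θ ∈ net, A θ := by
    intro ω hω
    by_contra hcon
    apply hω
    simp only [Set.mem_union, Set.mem_iUnion, not_or, not_exists] at hcon
    obtain ⟨h0, h1⟩ := hcon
    constructor
    · have h2 := not_le.1 (fun h => h0 (Set.mem_ofPred.2 h))
      rw [← Finset.mul_sum] at h2
      have h3 := mul_lt_mul_of_pos_left h2 (by linarith : 0 < 2 * k)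
      have e1 : 2 * k * (s * ∑ n, U (ω n)) = (2 * k * s) * ∑ n, U (ω n) := by ring
      have e2 : 2 * k * (2 * s * (N * ∫ x, U x ∂μ) + Real.log (2 / δ))
        = 2 * (2 * k * s) * (N * ∫ x, U x ∂μ) + 2 * k * Real.log (2 / δ) := by ring
      rw [e1, e2, hks] at h3
      linarith
    · intro θ hθ
      have h2 := not_le.1 (fun h => h1 θ hθ (Set.mem_ofPred.2 h))
      rw [← Finset.mul_sum] at h2
      have h3 := mul_lt_mul_of_pos_left h2 (by linarith : 0 < 4 * k)
      have e1 : 4 * k * (-s * ∑ n, V θ (ω n)) = -(2 * (2 * k * s) * ∑ n, V θ (ω n)) := by ring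
      have e2 : 4 * k * (-(s / 2 * (N * ∫ x, V θ x ∂μ)) + (Real.log (2 / δ) + Real.log net.card))
        = -((2 * k * s) * (N * ∫ x, V θ x ∂μ)) + 4 * k * (Real.log (2 / δ) + Real.log net.card) := by
        ring
      rw [e1, e2, hks] at h3
      linarith
  have hcompl : ν.real Gᶜ ≤ δ := by
    calc ν.real Gᶜ ≤ ν.real (A0 ∪ ⋃ θ ∈ net, A θ) := measureReal_mono hsub
      _ ≤ ν.real A0 + ν.real (⋃ θ ∈ net, A θ) := measureReal_union_le _ _
      _ ≤ δ / 2 + ∑ θ ∈ net, ν.real (A θ) := add_le_add hA0 (measureReal_biUnion_finset_le _ _)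
      _ ≤ δ / 2 + ∑ _θ ∈ net, δ / 2 / net.card := by gcongr with θ hθ; exact hA θ hθ
      _ ≤ δ / 2 + δ / 2 := by
          rw [Finset.sum_const, nsmul_eq_mul]
          gcongr
          rcases Nat.eq_zero_or_pos net.card with h | h
          · simp [h]; positivity
          · rw [mul_div_cancel₀]
            exact_mod_cast h.ne'
      _ = δ := by ring
  have hmeas : MeasurableSet G := Set.Finite.measurableSet (Set.toFinite _)
  have := probReal_compl_eq_one_sub (μ := ν) hmeas
  linarith

end Concentration

/-! ### Divergences between distributions with bounded log-ratio -/

/-- The function exp(-u) - 1 + u is at least of order u² for u ≤ 2 and grows linearly beyond; in the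
linear range u ≤ b supplies the missing factor. This is the pointwise form of the Bernstein
condition. -/
theorem sq_le_mul_exp_neg_sub {u b : ℝ} (hb : 1 ≤ b) (hu : |u| ≤ b) :
    u ^ 2 ≤ 4 * b * (Real.exp (-u) - 1 + u) := by
  have h0 : 0 ≤ Real.exp (-u) - 1 + u := by linarith [Real.add_one_le_exp (-u)]
  have key : u ^ 2 ≤ 4 * (Real.exp (-u) - 1 + u) → u ^ 2 ≤ 4 * b * (Real.exp (-u) - 1 + u) := by
    intro h
    nlinarith
  rcases le_total u 0 with h | h
  · have := Real.quadratic_le_exp_of_nonneg (neg_nonneg.2 h)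
    exact key (by nlinarith)
  · rcases le_total u 2 with h2 | h2
    · have h3 : 1 - u / 2 ≤ Real.exp (-u / 2) := by linarith [Real.add_one_le_exp (-u / 2)]
      have h4 : Real.exp (-u) = Real.exp (-u / 2) ^ 2 := by rw [← Real.exp_nat_mul]; ring_nf
      have h5 : (1 - u / 2) ^ 2 ≤ Real.exp (-u / 2) ^ 2 := pow_le_pow_left₀ (by linarith) h3 2
      exact key (by rw [h4]; nlinarith)
    · have h3 := Real.exp_pos (-u)
      have h4 := (le_abs_self u).trans hu
      nlinarith

section Divergence

variable {V : Type*} [Fintype V] {p q : V → ℝ}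

/-- With u = log(p/q), the product p (exp(-u) - 1 + u) equals q - p + p u, and q - p sums to zero;
so the pointwise bound sums to a bound of the second moment by the divergence. The fast rate rests
on this. -/
theorem sum_mul_log_sq_le {b : ℝ} (hb : 1 ≤ b) (hp : ∀ x, 0 < p x) (hq : ∀ x, 0 < q x)
    (hp1 : ∑ x, p x = 1) (hq1 : ∑ x, q x = 1) (h : ∀ x, |Real.log (p x / q x)| ≤ b) :
    ∑ x, p x * Real.log (p x / q x) ^ 2 ≤ 4 * b * ∑ x, p x * Real.log (p x / q x) := by
  have h1 : ∑ x, p x * Real.log (p x / q x)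
      = ∑ x, (q x - p x + p x * Real.log (p x / q x)) := by
    rw [Finset.sum_add_distrib, Finset.sum_sub_distrib, hp1, hq1]; ring
  rw [h1, Finset.mul_sum]
  refine Finset.sum_le_sum fun x _ => ?_
  have h2 := mul_le_mul_of_nonneg_left (sq_le_mul_exp_neg_sub hb (h x)) (hp x).le
  have h3 : p x * Real.exp (-Real.log (p x / q x)) = q x := by
    rw [Real.exp_neg, Real.exp_log (div_pos (hp x) (hq x))]
    field_simp [(hp x).ne', (hq x).ne']
  calc _ ≤ _ := h2
    _ = 4 * b * (p x * Real.exp (-Real.log (p x / q x)) - p x + p x * Real.log (p x / q x)) := by ring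
    _ = _ := by rw [h3]

theorem sum_mul_log_nonneg (hp : ∀ x, 0 ≤ p x) (hq : ∀ x, 0 < q x)
    (hp1 : ∑ x, p x = 1) (hq1 : ∑ x, q x = 1) : 0 ≤ ∑ x, p x * Real.log (p x / q x) := by
  have h : ∀ x, p x - q x ≤ p x * Real.log (p x / q x) := by
    intro x
    rcases (hp x).eq_or_lt with h0 | h0
    · rw [← h0]; simp [(hq x).le]
    · have h1 := Real.one_sub_inv_le_log_of_pos (div_pos h0 (hq x))
      have h2 := mul_le_mul_of_nonneg_left h1 h0.le
      rw [inv_div] at h2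
      have : p x * (1 - q x / p x) = p x - q x := by field_simp
      linarith
  calc (0 : ℝ) = ∑ x, (p x - q x) := by rw [Finset.sum_sub_distrib, hp1, hq1]; ring
    _ ≤ _ := Finset.sum_le_sum fun x _ => h x

end Divergence

/-! ### The pretraining error -/

section Pretrain

open MeasureTheory

variable {Z : Type*} [MeasurableSpace Z] {c : Config}

theorem one_le_log_inv_bY {c : Config} (hc : c.Valid) (hdy : 1 ≤ c.dy) : 1 ≤ Real.log c.bY⁻¹ := by
  rw [Config.bY, inv_inv, Real.le_log_iff_exp_le (by positivity)]
  have h1 : (1 : ℝ) ≤ c.dy := by exact_mod_cast hdy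
  have h2 : 1 ≤ c.BA / c.τ := by
    rw [le_div_iff₀ hc.τ_pos]; linarith [hc.BA, hc.τ_le]
  have h3 := Real.exp_le_exp.2 h2
  have h4 := Real.exp_pos (c.BA / c.τ)
  nlinarith

theorem bY_pos (c : Config) : 0 < c.bY := by rw [Config.bY]; positivity

theorem one_le_bstar (hc : c.Valid) (hdy : 1 ≤ c.dy) (c₀ : ℝ) : 1 ≤ c.bstar c₀ :=
  (one_le_log_inv_bY hc hdy).trans
    (Real.log_le_log (inv_pos.2 (bY_pos c)) (le_max_right _ _))

/-- The hypotheses on the nominal distribution. -/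
structure Nominal {Z : Type*} [MeasurableSpace Z] {c : Config} (emb : Fin c.dy ↪ (Fin c.d → ℝ))
    (P : Z → List (Fin c.dy) → PMF (Fin c.dy)) (R c₀ : ℝ) (Tp : ℕ) : Prop where
  measurable : ∀ S x, Measurable fun z => P z S x
  one_le_R : 1 ≤ R
  bounded : ∀ z S, S.length ≤ Tp → seqProb (P z) [] S ≠ 0 → ∀ x ∈ S, l2norm (emb x) ≤ R
  c₀_pos : 0 < c₀
  le_prob : ∀ z S x, S ≠ [] → c₀ ≤ (P z S x).toReal

/-- The log-ratio of the predictive and the model probability of the next token. -/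
noncomputable def logRatio (prior : Measure Z) (P : Z → List (Fin c.dy) → PMF (Fin c.dy))
    (emb : Fin c.dy ↪ (Fin c.d → ℝ)) (θ : Param c) (S : List (Fin c.dy)) (x : Fin c.dy) : ℝ :=
  Real.log (predictive prior P S x / modelProb emb θ S x)

variable {prior : Measure Z} [IsProbabilityMeasure prior]
  {P : Z → List (Fin c.dy) → PMF (Fin c.dy)} {emb : Fin c.dy ↪ (Fin c.d → ℝ)} {R c₀ : ℝ} {Tp : ℕ}

theorem one_le_dy (prior : Measure Z) [IsProbabilityMeasure prior]
    (P : Z → List (Fin c.dy) → PMF (Fin c.dy)) : 1 ≤ c.dy := by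
  have : Nonempty Z := prior.nonempty_of_neZero
  obtain ⟨z⟩ := this
  obtain ⟨x, -⟩ := (P z []).support_nonempty
  have := x.2
  omega

theorem Nominal.predictive_pos (h : Nominal emb P R c₀ Tp) {S : List (Fin c.dy)} (hS : S ≠ [])
    (hM : evidence prior P S ≠ 0) (x : Fin c.dy) : 0 < predictive prior P S x :=
  h.c₀_pos.trans_le (le_predictive h.measurable h.c₀_pos.le (fun z => h.le_prob z S x hS) hM)

theorem logRatio_eq (h : Nominal emb P R c₀ Tp) {S : List (Fin c.dy)} (hS : S ≠ [])
    (hM : evidence prior P S ≠ 0) (θ : Param c) (x : Fin c.dy) :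
    logRatio prior P emb θ S x
      = Real.log (predictive prior P S x) - Real.log (modelProb emb θ S x) :=
  Real.log_div (h.predictive_pos hS hM x).ne' (modelProb_pos _ _ _ _).ne'

theorem abs_logRatio_le (hc : c.Valid) (h : Nominal emb P R c₀ Tp) {θ : Param c}
    (hθ : θ ∈ paramSet c) {S : List (Fin c.dy)} (hS : S ≠ []) (hM : evidence prior P S ≠ 0)
    (x : Fin c.dy) : |logRatio prior P emb θ S x| ≤ c.bstar c₀ := by
  have : NeZero c.dy := ⟨fun h => by have := x.2; omega⟩
  rw [logRatio_eq h hS hM]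
  have h1 : Real.log c₀ ≤ Real.log (predictive prior P S x) :=
    Real.log_le_log h.c₀_pos (le_predictive h.measurable h.c₀_pos.le
      (fun z => h.le_prob z S x hS) hM)
  have h2 : Real.log (predictive prior P S x) ≤ 0 :=
    Real.log_nonpos (predictive_nonneg _ _) (predictive_le_one h.measurable hM x)
  have h3 : Real.log c.bY ≤ Real.log (modelProb emb θ S x) :=
    Real.log_le_log (bY_pos c) (bY_le_modelProb hc emb hθ S x)
  have h4 : Real.log (modelProb emb θ S x) ≤ 0 := by
    refine Real.log_nonpos (modelProb_pos _ _ _ _).le ?_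
    rw [← sum_modelProb emb θ S]
    exact Finset.single_le_sum (f := fun x => modelProb emb θ S x)
      (fun x _ => (modelProb_pos _ _ _ _).le) (Finset.mem_univ x)
  have h5 : -Real.log c₀ ≤ c.bstar c₀ := by
    rw [← Real.log_inv]; exact Real.log_le_log (inv_pos.2 h.c₀_pos) (le_max_left _ _)
  have h6 : -Real.log c.bY ≤ c.bstar c₀ := by
    rw [← Real.log_inv]; exact Real.log_le_log (inv_pos.2 (bY_pos c)) (le_max_right _ _)
  exact abs_le.2 ⟨by linarith, by linarith⟩

/-- The Kullback–Leibler divergence of the model from the predictive law of the next token. -/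
noncomputable def stepKL (prior : Measure Z) (P : Z → List (Fin c.dy) → PMF (Fin c.dy))
    (emb : Fin c.dy ↪ (Fin c.d → ℝ)) (θ : Param c) (S : List (Fin c.dy)) : ℝ :=
  ∑ x, predictive prior P S x * logRatio prior P emb θ S x

theorem stepKL_nonneg (hP : ∀ S x, Measurable fun z => P z S x) (θ : Param c)
    {S : List (Fin c.dy)} (hM : evidence prior P S ≠ 0) : 0 ≤ stepKL prior P emb θ S := by
  have : NeZero c.dy := ⟨by have := one_le_dy prior P; omega⟩
  exact sum_mul_log_nonneg (fun x => predictive_nonneg S x) (fun x => modelProb_pos _ _ _ _)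
    (sum_predictive hP hM) (sum_modelProb _ _ _)

theorem sum_predictive_mul_logRatio_sq_le (hc : c.Valid) (h : Nominal emb P R c₀ Tp) {θ : Param c}
    (hθ : θ ∈ paramSet c) {S : List (Fin c.dy)} (hS : S ≠ []) (hM : evidence prior P S ≠ 0) :
    ∑ x, predictive prior P S x * logRatio prior P emb θ S x ^ 2
      ≤ 4 * c.bstar c₀ * stepKL prior P emb θ S := by
  have hdy := one_le_dy prior P
  have : NeZero c.dy := ⟨by omega⟩
  exact sum_mul_log_sq_le (one_le_bstar hc hdy c₀) (fun x => h.predictive_pos hS hM x)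
    (fun x => modelProb_pos _ _ _ _) (sum_predictive h.measurable hM) (sum_modelProb _ _ _)
    (fun x => abs_logRatio_le hc h hθ hS hM x)

theorem approxKL_eq (T : ℕ) (θ : Param c) : approxKL prior P emb T θ
    = ∑' S, (pretrainDist prior P T S).toReal * stepKL prior P emb θ S := rfl

/-- Pretraining charges only nonempty sequences of positive evidence, exactly those on which the
predictive law is controlled. -/
theorem tsum_pretrainDist_mono {T : ℕ} {f g : List (Fin c.dy) → ℝ}
    (h : ∀ S, S ≠ [] → evidence prior P S ≠ 0 → f S ≤ g S) :
    ∑' S, (pretrainDist prior P T S).toReal * f S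
      ≤ ∑' S, (pretrainDist prior P T S).toReal * g S := by
  rw [tsum_pretrainDist_mul, tsum_pretrainDist_mul]
  refine div_le_div_of_nonneg_right (Finset.sum_le_sum fun t _ => Finset.sum_le_sum fun y _ => ?_)
    (Nat.cast_nonneg _)
  by_cases hM : evidence prior P (List.ofFn y) = 0
  · simp [-List.ofFn_succ, hM]
  · exact mul_le_mul_of_nonneg_left (h _ (by simp) hM) ENNReal.toReal_nonneg

theorem approxKL_nonneg (hP : ∀ S x, Measurable fun z => P z S x) (T : ℕ) (θ : Param c) :
    0 ≤ approxKL prior P emb T θ := by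
  rw [approxKL_eq]
  have := tsum_pretrainDist_mono (prior := prior) (P := P) (T := T) (f := fun _ => 0)
    (g := stepKL prior P emb θ) fun S _ hM => stepKL_nonneg hP θ hM
  simpa using this

/-- The normalized log-ratio of a trajectory, averaged over time. -/
noncomputable def excess (prior : Measure Z) (P : Z → List (Fin c.dy) → PMF (Fin c.dy))
    (emb : Fin c.dy ↪ (Fin c.d → ℝ)) (b : ℝ) (θ : Param c) {T : ℕ}
    (x : Fin (T + 1) → Fin c.dy) : ℝ :=
  (∑ t : Fin T, logRatio prior P emb θ ((List.ofFn x).take (t.val + 1)) (x t.succ) / b) / T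

theorem take_ofFn_spec (h : Nominal emb P R c₀ Tp) {x : Fin (Tp + 1) → Fin c.dy}
    (hx : evidence prior P (List.ofFn x) ≠ 0) (t : Fin Tp) :
    (List.ofFn x).take (t.val + 1) ≠ [] ∧ evidence prior P ((List.ofFn x).take (t.val + 1)) ≠ 0 ∧
      ∀ y ∈ (List.ofFn x).take (t.val + 1), l2norm (emb y) ≤ R := by
  have hM : evidence prior P ((List.ofFn x).take (t.val + 1)) ≠ 0 := by
    intro h0
    refine hx (le_antisymm ?_ bot_le)
    rw [← List.take_append_drop (t.val + 1) (List.ofFn x)]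
    exact (evidence_append_le _ _).trans h0.le
  refine ⟨by simp [-List.ofFn_succ], hM, ?_⟩
  obtain ⟨z, hz⟩ := exists_seqProb_ne_zero hM
  exact h.bounded z _ (by have := t.2; simp) hz

theorem abs_average_le {T : ℕ} {f : Fin T → ℝ} {a : ℝ} (hT : 1 ≤ T) (hf : ∀ t, |f t| ≤ a) :
    |(∑ t, f t) / T| ≤ a := by
  have hT' : (0 : ℝ) < T := by exact_mod_cast hT
  rw [abs_div, abs_of_pos hT', div_le_iff₀ hT']
  calc _ ≤ ∑ t, |f t| := Finset.abs_sum_le_sum_abs _ _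
    _ ≤ ∑ _t : Fin T, a := Finset.sum_le_sum fun t _ => hf t
    _ = a * T := by simp [mul_comm]

theorem abs_excess_le_one (hc : c.Valid) (h : Nominal emb P R c₀ Tp) (hT : 1 ≤ Tp) {θ : Param c}
    (hθ : θ ∈ paramSet c) :
    ∀ᵐ x ∂(trajectoryLaw prior P Tp), |excess prior P emb (c.bstar c₀) θ x| ≤ 1 := by
  filter_upwards [ae_trajectoryLaw (prior := prior) (P := P) Tp] with x hx
  have hb : 0 < c.bstar c₀ :=
    one_pos.trans_le (one_le_bstar hc (one_le_dy prior P) c₀)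
  refine abs_average_le hT fun t => ?_
  obtain ⟨hS, hM, -⟩ := take_ofFn_spec h hx t
  rw [abs_div, abs_of_pos hb, div_le_one hb]
  exact abs_logRatio_le hc h hθ hS hM _

theorem integral_excess (hP : ∀ S x, Measurable fun z => P z S x) (b : ℝ) (θ : Param c) (T : ℕ) :
    ∫ x, excess prior P emb b θ x ∂(trajectoryLaw prior P T) = approxKL prior P emb T θ / b := by
  rw [integral_trajectoryLaw]
  simp only [excess]
  rw [sum_trajectory_average hP T (fun S a => logRatio prior P emb θ S a / b), approxKL_eq,
    ← tsum_div_const]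
  refine tsum_congr fun S => ?_
  rw [stepKL, mul_div_assoc, Finset.sum_div]
  congr 1
  exact Finset.sum_congr rfl fun x _ => by ring

/-- By Cauchy–Schwarz the square of the time average is at most the time average of the squares, so
dependence within a trajectory plays no role. The step bound 4b* and the normalization by b* leave
the constant 4. -/
theorem integral_excess_sq_le (hc : c.Valid) (h : Nominal emb P R c₀ Tp) (hT : 1 ≤ Tp)
    {θ : Param c} (hθ : θ ∈ paramSet c) :
    ∫ x, excess prior P emb (c.bstar c₀) θ x ^ 2 ∂(trajectoryLaw prior P Tp)
      ≤ 4 * ∫ x, excess prior P emb (c.bstar c₀) θ x ∂(trajectoryLaw prior P Tp) := by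
  have hb : 0 < c.bstar c₀ :=
    one_pos.trans_le (one_le_bstar hc (one_le_dy prior P) c₀)
  have hT' : (0 : ℝ) < Tp := by exact_mod_cast hT
  set b := c.bstar c₀ with hbdef
  rw [integral_excess h.measurable, integral_trajectoryLaw]
  calc _ ≤ ∑ x : Fin (Tp + 1) → Fin c.dy, (evidence prior P (List.ofFn x)).toReal *
        ((∑ t : Fin Tp, (logRatio prior P emb θ ((List.ofFn x).take (t.val + 1)) (x t.succ) / b) ^ 2)
          / Tp) := by
        refine Finset.sum_le_sum fun x _ => mul_le_mul_of_nonneg_left ?_ ENNReal.toReal_nonneg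
        rw [excess, div_pow, div_le_div_iff₀ (by positivity) hT']
        have := sq_sum_le_card_mul_sum_sq (s := (Finset.univ : Finset (Fin Tp)))
          (f := fun t => logRatio prior P emb θ ((List.ofFn x).take (t.val + 1)) (x t.succ) / b)
        rw [Finset.card_univ, Fintype.card_fin] at this
        calc _ ≤ _ := mul_le_mul_of_nonneg_right this hT'.le
          _ = _ := by ring
    _ = ∑' S, (pretrainDist prior P Tp S).toReal *
          ∑ a, predictive prior P S a * (logRatio prior P emb θ S a / b) ^ 2 :=
        sum_trajectory_average h.measurable Tp (fun S a => (logRatio prior P emb θ S a / b) ^ 2)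
    _ ≤ ∑' S, (pretrainDist prior P Tp S).toReal * (4 / b * stepKL prior P emb θ S) := by
        refine tsum_pretrainDist_mono fun S hS hM => ?_
        have h1 := sum_predictive_mul_logRatio_sq_le hc h hθ hS hM
        have h2 : ∑ a, predictive prior P S a * (logRatio prior P emb θ S a / b) ^ 2
            = (∑ a, predictive prior P S a * logRatio prior P emb θ S a ^ 2) / b ^ 2 := by
          rw [Finset.sum_div]
          exact Finset.sum_congr rfl fun a _ => by ring
        rw [h2, div_le_iff₀ (by positivity)]
        calc _ ≤ _ := h1
          _ = _ := by rw [← hbdef]; field_simp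
    _ = 4 * (approxKL prior P emb Tp θ / b) := by
        rw [approxKL_eq, ← tsum_div_const, ← tsum_mul_left]
        exact tsum_congr fun S => by ring

theorem approxKL_le_bstar (hc : c.Valid) (h : Nominal emb P R c₀ Tp) (hT : 1 ≤ Tp)
    {θ : Param c} (hθ : θ ∈ paramSet c) : approxKL prior P emb Tp θ ≤ c.bstar c₀ := by
  have hb : 0 < c.bstar c₀ :=
    one_pos.trans_le (one_le_bstar hc (one_le_dy prior P) c₀)
  have := isProbabilityMeasure_trajectoryLaw (prior := prior) h.measurable Tp
  have h1 : ∫ x, excess prior P emb (c.bstar c₀) θ x ∂(trajectoryLaw prior P Tp)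
      ≤ ∫ _, 1 ∂(trajectoryLaw prior P Tp) := by
    refine integral_mono_ae Integrable.of_finite Integrable.of_finite ?_
    filter_upwards [abs_excess_le_one hc h hT hθ] with x hx
    exact (abs_le.1 hx).2
  rw [integral_excess h.measurable, div_le_iff₀ hb] at h1
  simpa using h1

theorem excess_sub (h : Nominal emb P R c₀ Tp) {x : Fin (Tp + 1) → Fin c.dy}
    (hx : evidence prior P (List.ofFn x) ≠ 0) (b : ℝ) (θ θ' : Param c) :
    excess prior P emb b θ x - excess prior P emb b θ' x =
      (∑ t : Fin Tp, (Real.log (modelProb emb θ' ((List.ofFn x).take (t.val + 1)) (x t.succ)) -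
        Real.log (modelProb emb θ ((List.ofFn x).take (t.val + 1)) (x t.succ))) / b) / Tp := by
  rw [excess, excess, ← sub_div, ← Finset.sum_sub_distrib]
  congr 1
  refine Finset.sum_congr rfl fun t _ => ?_
  obtain ⟨hS, hM, -⟩ := take_ofFn_spec h hx t
  rw [logRatio_eq h hS hM, logRatio_eq h hS hM]
  ring

/-- The predictive probabilities cancel in differences, so minimizing the cross-entropy also
minimizes the empirical excess. -/
theorem sum_excess_le (h : Nominal emb P R c₀ Tp) {N : ℕ} {ω : Fin N → Fin (Tp + 1) → Fin c.dy}
    (hω : ∀ n, evidence prior P (List.ofFn (ω n)) ≠ 0) {b : ℝ} (hb : 0 < b) (hN : 1 ≤ N)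
    (hT : 1 ≤ Tp) {θ θ' : Param c} (hloss : pretrainLoss emb ω θ ≤ pretrainLoss emb ω θ') :
    ∑ n, excess prior P emb b θ (ω n) ≤ ∑ n, excess prior P emb b θ' (ω n) := by
  have hT' : (0 : ℝ) < Tp := by exact_mod_cast hT
  have hN' : (0 : ℝ) < N := by exact_mod_cast hN
  rw [← sub_nonpos, ← Finset.sum_sub_distrib]
  have e : ∀ n, excess prior P emb b θ (ω n) - excess prior P emb b θ' (ω n)
      = (∑ t : Fin Tp, Real.log (modelProb emb θ' ((List.ofFn (ω n)).take (t.val + 1)) (ω n t.succ)) -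
        ∑ t : Fin Tp, Real.log (modelProb emb θ ((List.ofFn (ω n)).take (t.val + 1)) (ω n t.succ)))
          / (b * Tp) := by
    intro n
    rw [excess_sub h (hω n), ← Finset.sum_div, Finset.sum_sub_distrib, div_div]
  simp only [e]
  rw [← Finset.sum_div, Finset.sum_sub_distrib]
  refine div_nonpos_of_nonpos_of_nonneg ?_ (by positivity)
  simp only [pretrainLoss, neg_mul, neg_le_neg_iff] at hloss
  have := le_of_mul_le_mul_left hloss (by positivity)
  linarith

theorem abs_excess_sub_le (h : Nominal emb P R c₀ Tp) (hT : 1 ≤ Tp) {θ θ' : Param c} {a b : ℝ}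
    (hb : 1 ≤ b) (hclose : ∀ S : List (Fin c.dy), (∀ x ∈ S, l2norm (emb x) ≤ R) →
        ∀ x, |Real.log (modelProb emb θ S x) - Real.log (modelProb emb θ' S x)| ≤ a)
    {x : Fin (Tp + 1) → Fin c.dy} (hx : evidence prior P (List.ofFn x) ≠ 0) :
    |excess prior P emb b θ x - excess prior P emb b θ' x| ≤ a := by
  rw [excess_sub h hx]
  refine abs_average_le hT fun t => ?_
  rw [abs_div, abs_of_pos (by linarith : 0 < b), abs_sub_comm]
  exact (div_le_self (abs_nonneg _) hb).trans (hclose _ (take_ofFn_spec h hx t).2.2 _)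

end Pretrain

/-! ### The oracle inequality for empirical risk minimizers -/

section PretrainBound

open MeasureTheory

variable {Z : Type*} [MeasurableSpace Z] {c : Config} {prior : Measure Z}
  [IsProbabilityMeasure prior] {P : Z → List (Fin c.dy) → PMF (Fin c.dy)}
  {emb : Fin c.dy ↪ (Fin c.d → ℝ)} {R c₀ : ℝ} {Tp : ℕ}

theorem paramSet_nonempty (hc : c.Valid) : (paramSet c).Nonempty := by
  refine ⟨⟨fun _ => ⟨0, 0, fun _ => 0, fun _ => 0, fun _ => 0, 0, 0⟩, 0⟩, ?_⟩
  have hf : ∀ {m n : ℕ}, frob (0 : Matrix (Fin m) (Fin n) ℝ) = 0 := by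
    intro m n; simp [frob]
  refine ⟨?_, fun t => ?_⟩
  · simp only [transposeNorm12, Matrix.zero_apply, abs_zero, Finset.sum_const_zero]
    norm_num
    linarith [hc.BA]
  · simp only [hf, abs_zero]
    have := hc.BA1
    have := hc.BA2
    have := hc.BQ
    have := hc.BK
    have := hc.BV
    refine ⟨zero_le_one, zero_le_one, by linarith, by linarith, fun _ => ⟨?_, ?_, ?_⟩⟩ <;> linarith

/-- The approximation term of the pretraining error. -/
noncomputable def approxError (prior : Measure Z) (P : Z → List (Fin c.dy) → PMF (Fin c.dy))
    (emb : Fin c.dy ↪ (Fin c.d → ℝ)) (T : ℕ) : ℝ :=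
  ⨅ θ : paramSet c, Real.sqrt (approxKL prior P emb T θ.1)

theorem approxError_nonneg (T : ℕ) : 0 ≤ approxError prior P emb T :=
  Real.iInf_nonneg fun _ => Real.sqrt_nonneg _

theorem exists_sqrt_approxKL_lt (hc : c.Valid) (T : ℕ) {a : ℝ} (ha : 0 < a) :
    ∃ θ ∈ paramSet c, Real.sqrt (approxKL prior P emb T θ) < approxError prior P emb T + a := by
  have : Nonempty (paramSet c) := (paramSet_nonempty hc).to_subtype
  obtain ⟨θ, hθ⟩ := exists_lt_of_ciInf_lt (lt_add_of_pos_right (approxError prior P emb T) ha)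
  exact ⟨θ.1, θ.2, hθ⟩

/-- The term with the fourth root is nonnegative and not needed. -/
theorem le_deltaPre (N T : ℕ) {δ : ℝ} (hδ : 0 < δ) (hδ1 : δ < 1) :
    approxError prior P emb T + Real.sqrt (mixingTime P T) / Real.sqrt ((N : ℝ) * T)
      * ((c.Dbar : ℝ) * Real.log (1 + (N : ℝ) * T * c.Bbar R) + Real.log (1 / δ))
      ≤ deltaPre prior P emb R N T δ := by
  have h1 : 0 ≤ Real.log (1 / δ) := Real.log_nonneg (by rw [le_div_iff₀ hδ]; linarith)
  have h2 : 0 ≤ (mixingTime P T : ℝ) ^ (1 / 4 : ℝ) * Real.log (1 / δ) / ((N : ℝ) * T) ^ (1 / 4 : ℝ) := by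
    positivity
  rw [deltaPre]
  exact add_le_add_left (le_add_of_nonneg_right h2) _

theorem deltaPre_nonneg (hc : c.Valid) (hR : 1 ≤ R) (N T : ℕ) {δ : ℝ} (hδ : 0 < δ) (hδ1 : δ < 1) :
    0 ≤ deltaPre prior P emb R N T δ := by
  refine le_trans ?_ (le_deltaPre N T hδ hδ1)
  have h1 : 0 ≤ Real.log (1 / δ) := Real.log_nonneg (by rw [le_div_iff₀ hδ]; linarith)
  have h2 : 0 ≤ Real.log (1 + (N : ℝ) * T * c.Bbar R) := by
    have := one_le_Bbar hc hR
    exact Real.log_nonneg (le_add_of_nonneg_right (by positivity))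
  have h3 := approxError_nonneg (prior := prior) (P := P) (emb := emb) T
  positivity

theorem approxKL_nonpos_of_dy_eq_one (h : Nominal emb P R c₀ Tp) (hdy : c.dy = 1) (θ : Param c) :
    approxKL prior P emb Tp θ ≤ 0 := by
  have hsub : Subsingleton (Fin c.dy) := by rw [hdy]; infer_instance
  have hne : NeZero c.dy := ⟨by omega⟩
  have key := tsum_pretrainDist_mono (prior := prior) (P := P) (T := Tp)
    (f := stepKL prior P emb θ) (g := fun _ => 0) fun S hS hM => by
      refine le_of_eq (Finset.sum_eq_zero fun x _ => ?_)
      have e : (Finset.univ : Finset (Fin c.dy)) = {x} :=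
        Finset.eq_singleton_iff_unique_mem.2 ⟨Finset.mem_univ _, fun y _ => Subsingleton.elim _ _⟩
      have h1 := sum_predictive h.measurable hM
      have h2 := sum_modelProb emb θ S
      rw [e, Finset.sum_singleton] at h1 h2
      simp [logRatio, h1, h2]
  simpa [approxKL_eq] using key

/-- The arithmetic that turns the deviation bound into the pretraining error. -/
theorem rate_le {N n tm D m LG Ld LM κ κs I X : ℝ} (hN : 1 ≤ N) (hn : 1 ≤ n)
    (hX : X ^ 2 = tm / n) (hX0 : 0 ≤ X) (htm : 1 ≤ tm) (hNn : n ≤ 2 * tm * N)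
    (hXD : X * D ≤ 1) (hD : 1 ≤ D) (hm : 0 ≤ m) (hmD : m ≤ D) (hLG : Real.log 2 ≤ LG) (hLd : 0 ≤ Ld)
    (hLM : LM ≤ 72 * (m * D) * LG) (hκs : κs ≤ I + X)
    (h : N * κ ≤ 4 * (N * κs) + 32 * (Real.log 2 + Ld) + 16 * LM + 3 * N / n) :
    κ ≤ 4 * I + 2400 * (X * (D * LG + Ld)) := by
  have hlog2 : 1 / 2 < Real.log 2 := by linarith [Real.log_two_gt_d9]
  have hN0 : 0 < N := by linarith
  have hn0 : 0 < n := by linarith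
  -- The mixing time is at least half of T_p, so the rate of independent trajectories is bounded by
  -- t_mix/(N T_p) = X².
  have hNinv : 1 / N ≤ 2 * X ^ 2 := by
    rw [hX, div_le_iff₀ hN0, mul_div_assoc', div_mul_eq_mul_div, le_div_iff₀ hn0]; linarith
  have hninv : 1 / n ≤ X ^ 2 := by rw [hX]; gcongr
  have hX1 : X ≤ 1 := by nlinarith
  have hXX : X ^ 2 ≤ X := by nlinarith
  have hXm : X * m ≤ 1 := (mul_le_mul_of_nonneg_left hmD hX0).trans hXD
  have hDLG : Real.log 2 ≤ D * LG := by nlinarith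
  have hLG0 : 0 ≤ LG := by linarith
  have h1 : κ ≤ 4 * κs + (1 / N) * (32 * (Real.log 2 + Ld) + 16 * (72 * (m * D) * LG)) + 3 * (1 / n) := by
    have h2 : κ ≤ (4 * (N * κs) + 32 * (Real.log 2 + Ld) + 16 * LM + 3 * N / n) / N := by
      rw [le_div_iff₀ hN0]; linarith
    refine h2.trans (le_of_sub_nonneg ?_)
    have e : 4 * κs + (1 / N) * (32 * (Real.log 2 + Ld) + 16 * (72 * (m * D) * LG)) + 3 * (1 / n)
        - (4 * (N * κs) + 32 * (Real.log 2 + Ld) + 16 * LM + 3 * N / n) / N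
        = 16 * (72 * (m * D) * LG - LM) / N := by field_simp; ring
    rw [e]
    have : 0 ≤ 72 * (m * D) * LG - LM := by linarith
    positivity
  have h3 : (1 / N) * (32 * (Real.log 2 + Ld) + 16 * (72 * (m * D) * LG))
      ≤ 2 * X ^ 2 * (32 * (Real.log 2 + Ld) + 16 * (72 * (m * D) * LG)) := by
    gcongr
  have h4 : X ^ 2 * (m * D * LG) ≤ X * (D * LG) := by
    have : 0 ≤ X * (D * LG) := by positivity
    calc X ^ 2 * (m * D * LG) = (X * m) * (X * (D * LG)) := by ring
      _ ≤ 1 * (X * (D * LG)) := by gcongr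
      _ = _ := one_mul _
  have h5 : X ^ 2 * (Real.log 2 + Ld) ≤ X * (D * LG + Ld) := by gcongr
  have h6 : X ^ 2 ≤ 2 * (X * (D * LG)) := by nlinarith
  have h7 : X ≤ 2 * (X * (D * LG)) := by nlinarith
  have h8 : 0 ≤ X * Ld := by positivity
  have h9 : 0 ≤ X * (D * LG) := by positivity
  linarith

/-- From the mean at θ one passes to its net point (cost a), to the empirical mean there (factor 2),
back to θ, by minimality to θs, and to the mean at θs (another factor 2). Hence 4 = 2·2, 32 = 2·8 +
16, and 3a from the two passages to the net. The event does not depend on the minimizer. -/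
theorem empirical_risk_bound (hc : c.Valid) (h : Nominal emb P R c₀ Tp) {N : ℕ} (hN : 1 ≤ N)
    (hT : 1 ≤ Tp) {δ a : ℝ} (hδ : 0 < δ) {net : Finset (Param c)}
    (hnet : ∀ θ ∈ net, θ ∈ paramSet c)
    (hcov : ∀ θ ∈ paramSet c, ∃ θ' ∈ net, ∀ S : List (Fin c.dy), (∀ x ∈ S, l2norm (emb x) ≤ R) →
      ∀ x, |Real.log (modelProb emb θ S x) - Real.log (modelProb emb θ' S x)| ≤ a)
    {θs : Param c} (hθs : θs ∈ paramSet c) :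
    1 - δ ≤ (datasetLaw prior P N Tp).real {ω | ∀ θ, IsPretrained emb ω θ →
      N * (approxKL prior P emb Tp θ / c.bstar c₀) ≤ 4 * (N * (approxKL prior P emb Tp θs / c.bstar c₀))
        + 32 * Real.log (2 / δ) + 16 * Real.log net.card + 3 * (N * a)} := by
  have hprob := isProbabilityMeasure_trajectoryLaw (prior := prior) h.measurable Tp
  have hprobN : IsProbabilityMeasure (datasetLaw prior P N Tp) := by
    rw [datasetLaw]; infer_instance
  have hb1 := one_le_bstar hc (one_le_dy prior P) c₀
  have hN' : (1 : ℝ) ≤ N := by exact_mod_cast hN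
  have hbern := bernstein_uniform (trajectoryLaw prior P Tp) (N := N) (k := 4) (by norm_num) hδ net
    (fun θ x => excess prior P emb (c.bstar c₀) θ x)
    (fun x => excess prior P emb (c.bstar c₀) θs x)
    (abs_excess_le_one hc h hT hθs) (integral_excess_sq_le hc h hT hθs)
    (fun θ hθ => abs_excess_le_one hc h hT (hnet θ hθ))
    (fun θ hθ => integral_excess_sq_le hc h hT (hnet θ hθ))
  refine hbern.trans ?_
  rw [← datasetLaw]
  -- The inclusion of events holds only up to data of probability zero, those with a trajectory of
  -- zero evidence.
  refine ENNReal.toReal_mono (measure_ne_top _ _) (measure_mono_ae ?_)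
  have hae : ∀ᵐ ω ∂(datasetLaw prior P N Tp), ∀ i, evidence prior P (List.ofFn (ω i)) ≠ 0 := by
    refine Filter.eventually_all.2 fun i => ?_
    exact (Measure.tendsto_eval_ae_ae (μ := fun _ : Fin N => trajectoryLaw prior P Tp)
      (i := i)).eventually (ae_trajectoryLaw Tp)
  filter_upwards [hae] with ω hω hgood θ hθ
  obtain ⟨hgs, hgnet⟩ := hgood
  obtain ⟨θ', hθ', hclose⟩ := hcov θ hθ.1
  have hb0 : 0 < c.bstar c₀ := by linarith
  have hsum := sum_excess_le h hω hb0 hN hT (hθ.2 θs hθs)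
  have hsum' : ∑ i, excess prior P emb (c.bstar c₀) θ' (ω i)
      ≤ ∑ i, excess prior P emb (c.bstar c₀) θ (ω i) + N * a := by
    have : ∀ i, excess prior P emb (c.bstar c₀) θ' (ω i)
        ≤ excess prior P emb (c.bstar c₀) θ (ω i) + a := fun i => by
      linarith [(abs_le.1 (abs_excess_sub_le h hT hb1 hclose (hω i))).1]
    refine (Finset.sum_le_sum fun i _ => this i).trans (le_of_eq ?_)
    rw [Finset.sum_add_distrib]
    simp
  have hmean : ∫ x, excess prior P emb (c.bstar c₀) θ x ∂(trajectoryLaw prior P Tp)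
      ≤ ∫ x, excess prior P emb (c.bstar c₀) θ' x ∂(trajectoryLaw prior P Tp) + a := by
    have h1 : ∫ x, excess prior P emb (c.bstar c₀) θ x ∂(trajectoryLaw prior P Tp)
        ≤ ∫ x, (excess prior P emb (c.bstar c₀) θ' x + a) ∂(trajectoryLaw prior P Tp) := by
      refine integral_mono_ae Integrable.of_finite Integrable.of_finite ?_
      filter_upwards [ae_trajectoryLaw (prior := prior) (P := P) Tp] with x hx
      linarith [(abs_le.1 (abs_excess_sub_le h hT hb1 hclose hx)).2]
    rw [integral_add Integrable.of_finite Integrable.of_finite] at h1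
    simpa using h1
  have hnet' := hgnet θ' hθ'
  rw [integral_excess h.measurable] at hmean hgs
  have h1 := mul_le_mul_of_nonneg_left hmean (by linarith : (0 : ℝ) ≤ N)
  rw [mul_add] at h1
  linarith

/-- The divergence is at most b*, hence its root is at most b*. The approximation error thus enters
through its square root. -/
theorem approxKL_div_bstar_le (hc : c.Valid) (h : Nominal emb P R c₀ Tp) (hT : 1 ≤ Tp)
    {θ : Param c} (hθ : θ ∈ paramSet c) : approxKL prior P emb Tp θ / c.bstar c₀
      ≤ Real.sqrt (approxKL prior P emb Tp θ) := by
  have hb1 := one_le_bstar hc (one_le_dy prior P) c₀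
  have h1 := approxKL_le_bstar (prior := prior) hc h hT hθ
  have h2 := approxKL_nonneg (prior := prior) (emb := emb) h.measurable Tp θ
  rw [div_le_iff₀ (by linarith)]
  calc approxKL prior P emb Tp θ
      = Real.sqrt (approxKL prior P emb Tp θ) * Real.sqrt (approxKL prior P emb Tp θ) :=
        (Real.mul_self_sqrt h2).symm
    _ ≤ _ := by
        refine mul_le_mul_of_nonneg_left ?_ (Real.sqrt_nonneg _)
        rw [Real.sqrt_le_left (by linarith)]
        nlinarith

theorem approxKL_pretrained_le (hc : c.Valid) (h : Nominal emb P R c₀ Tp) {N : ℕ} (hN : 1 ≤ N)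
    (hT : 1 ≤ Tp) {δ : ℝ} (hδ : 0 < δ) (hδ1 : δ < 1) :
    1 - δ ≤ (datasetLaw prior P N Tp).real {ω | ∀ θ, IsPretrained emb ω θ →
      approxKL prior P emb Tp θ ≤ 2400 * (c.bstar c₀ * deltaPre prior P emb R N Tp δ)} := by
  have hdy := one_le_dy prior P
  have hprob := isProbabilityMeasure_trajectoryLaw (prior := prior) h.measurable Tp
  have hprobN : IsProbabilityMeasure (datasetLaw prior P N Tp) := by
    rw [datasetLaw]; infer_instance
  have hb1 := one_le_bstar hc hdy c₀
  have hR := h.one_le_R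
  have hΔ0 := deltaPre_nonneg (prior := prior) (P := P) (emb := emb) hc hR N Tp hδ hδ1
  have trivial_case : (∀ θ ∈ paramSet c, approxKL prior P emb Tp θ ≤
      2400 * (c.bstar c₀ * deltaPre prior P emb R N Tp δ)) →
      1 - δ ≤ (datasetLaw prior P N Tp).real {ω | ∀ θ, IsPretrained emb ω θ →
        approxKL prior P emb Tp θ ≤ 2400 * (c.bstar c₀ * deltaPre prior P emb R N Tp δ)} := by
    intro hall
    have : {ω : Fin N → Fin (Tp + 1) → Fin c.dy | ∀ θ, IsPretrained emb ω θ →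
        approxKL prior P emb Tp θ ≤ 2400 * (c.bstar c₀ * deltaPre prior P emb R N Tp δ)}
        = Set.univ := Set.eq_univ_of_forall fun ω θ hθ => hall θ hθ.1
    rw [this, probReal_univ]
    linarith
  -- With a single token both laws are the same point mass; the lower bound for the mixing time
  -- fails there, so the case is separate.
  rcases hdy.eq_or_lt with hdy1 | hdy2
  · exact trivial_case fun θ _ =>
      (approxKL_nonpos_of_dy_eq_one h hdy1.symm θ).trans (by positivity)
  have hΔ := le_deltaPre (prior := prior) (P := P) (emb := emb) (R := R) N Tp hδ hδ1
  have hN' : (1 : ℝ) ≤ N := by exact_mod_cast hN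
  have hT' : (1 : ℝ) ≤ Tp := by exact_mod_cast hT
  have hB := one_le_Bbar hc hR
  obtain ⟨hD1, hDD, -⟩ := sizes_le_Dbar hc
  have hD1' : (1 : ℝ) ≤ c.Dbar := by exact_mod_cast hD1
  have : Nontrivial (Fin c.dy) := Fin.nontrivial_iff_two_le.2 hdy2
  have : Nonempty Z := prior.nonempty_of_neZero
  obtain ⟨ht1, htT, -⟩ := mixingTime_spec P hT
  have htT2 := le_mixingTime_add_one P (fun z S x hS h0 => by
    have := h.le_prob z S x hS
    rw [h0] at this
    simp at this
    linarith [h.c₀_pos]) hT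
  have hLd : 0 ≤ Real.log (1 / δ) := Real.log_nonneg (by rw [le_div_iff₀ hδ]; linarith)
  have htm1 : (1 : ℝ) ≤ mixingTime P Tp := by exact_mod_cast ht1
  have htT2' : (Tp : ℝ) ≤ mixingTime P Tp + 1 := by exact_mod_cast htT2
  set n : ℝ := (N : ℝ) * Tp with hn
  have hn1 : 1 ≤ n := one_le_mul_of_one_le_of_one_le hN' hT'
  set tm : ℝ := (mixingTime P Tp : ℝ) with htm
  set X := Real.sqrt tm / Real.sqrt n with hXdef
  have hX0 : 0 < X := by positivity
  have hX2 : X ^ 2 = tm / n := by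
    rw [hXdef, div_pow, Real.sq_sqrt (by linarith), Real.sq_sqrt (by linarith)]
  set LG := Real.log (1 + n * c.Bbar R) with hLG
  have hLG2 : Real.log 2 ≤ LG := by
    refine Real.log_le_log (by norm_num) ?_
    linarith [one_le_mul_of_one_le_of_one_le hn1 hB]
  have hlog2 : 1 / 2 < Real.log 2 := by linarith [Real.log_two_gt_d9]
  have hI0 := approxError_nonneg (prior := prior) (P := P) (emb := emb) Tp
  set I := approxError prior P emb Tp with hI
  -- If X D̄ > 1, the right side already exceeds b*, the largest possible divergence. Otherwise
  -- t_mix D̄² ≤ n, which gives the bound D̄ ≤ n needed for the net.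
  rcases le_or_gt (X * c.Dbar) 1 with hXD | hXD
  swap
  · refine trivial_case fun θ hθ => (approxKL_le_bstar hc h hT hθ).trans ?_
    have h1 : 1 / 2 ≤ X * (c.Dbar * LG + Real.log (1 / δ)) := by
      have h2 : 1 / 2 ≤ X * c.Dbar * LG := by nlinarith
      have h3 : 0 ≤ X * Real.log (1 / δ) := by positivity
      linarith
    have h4 : c.bstar c₀ * (1 / 2) ≤ c.bstar c₀ * deltaPre prior P emb R N Tp δ :=
      mul_le_mul_of_nonneg_left (by linarith) (by linarith)
    linarith
  have hDn : (c.Dbar : ℝ) ≤ n := by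
    have h1 : (X * c.Dbar) ^ 2 ≤ 1 := pow_le_one₀ (by positivity) hXD
    rw [mul_pow, hX2, div_mul_eq_mul_div, div_le_one (by linarith)] at h1
    nlinarith
  obtain ⟨net, hnet, hcard, hcov⟩ := exists_net hc emb hR hn1 hDn
  -- The infimum need not be attained; a slack X is of the order of the target rate.
  obtain ⟨θs, hθs, hs⟩ := exists_sqrt_approxKL_lt (prior := prior) (P := P) (emb := emb) hc Tp hX0
  have hrisk := empirical_risk_bound (prior := prior) hc h hN hT hδ hnet hcov hθs
  have hκsI : approxKL prior P emb Tp θs / c.bstar c₀ ≤ I + X :=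
    (approxKL_div_bstar_le hc h hT hθs).trans hs.le
  have hNn : n ≤ 2 * tm * N := by
    have : (Tp : ℝ) ≤ 2 * tm := by linarith
    nlinarith
  have hlogδ : Real.log (2 / δ) = Real.log 2 + Real.log (1 / δ) := by
    rw [← Real.log_mul (by norm_num) (by positivity)]; congr 1; ring
  rw [hlogδ] at hrisk
  refine hrisk.trans (measureReal_mono fun ω hω θ hθ => ?_)
  have hmain : approxKL prior P emb Tp θ / c.bstar c₀
      ≤ 4 * I + 2400 * (X * (c.Dbar * LG + Real.log (1 / δ))) := by
    refine rate_le (LM := Real.log net.card) hN' hn1 hX2 hX0.le htm1 hNn hXD hD1'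
      (Nat.cast_nonneg (max c.h c.D)) (by exact_mod_cast max_le hc.hD hDD) hLG2 hLd
      (by push_cast at hcard ⊢; exact hcard) hκsI ?_
    refine (hω θ hθ).trans (le_of_eq ?_)
    ring
  have hb0 : 0 < c.bstar c₀ := by linarith
  rw [div_le_iff₀ hb0] at hmain
  have hle : 4 * I + 2400 * (X * (c.Dbar * LG + Real.log (1 / δ)))
      ≤ 2400 * deltaPre prior P emb R N Tp δ := by linarith
  refine (hmain.trans (mul_le_mul_of_nonneg_right hle hb0.le)).trans (le_of_eq ?_)
  ring

end PretrainBound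

/-! ### Expectations under probability mass functions of finite support -/

section Expectation

variable {α β : Type*}

/-- The expectation of a real function. -/
noncomputable def expect (p : PMF α) (f : α → ℝ) : ℝ := ∑' a, (p a).toReal * f a

theorem expect_eq_sum {p : PMF α} {s : Finset α} (hs : p.support ⊆ s) (f : α → ℝ) :
    expect p f = ∑ a ∈ s, (p a).toReal * f a := by
  refine tsum_eq_sum fun a ha => ?_
  have : p a = 0 := by
    by_contra h
    exact ha (hs ((PMF.mem_support_iff _ _).2 h))
  simp [this]

theorem sum_toReal_eq_one {p : PMF α} {s : Finset α} (hs : p.support ⊆ s) :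
    ∑ a ∈ s, (p a).toReal = 1 := by
  rw [← ENNReal.toReal_sum fun a _ => p.apply_ne_top a]
  have h : ∑' a, p a = ∑ a ∈ s, p a := tsum_eq_sum fun a ha => by
    by_contra h
    exact ha (hs ((PMF.mem_support_iff _ _).2 h))
  rw [← h, PMF.tsum_coe, ENNReal.toReal_one]

theorem expect_fintype [Fintype α] (p : PMF α) (f : α → ℝ) :
    expect p f = ∑ a, (p a).toReal * f a := expect_eq_sum (by simp) f

theorem expect_pure (a : α) (f : α → ℝ) : expect (PMF.pure a) f = f a := by
  rw [expect_eq_sum (s := {a}) (by simp)]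
  simp

theorem expect_mono {p : PMF α} (hp : p.support.Finite) {f g : α → ℝ}
    (h : ∀ a ∈ p.support, f a ≤ g a) : expect p f ≤ expect p g := by
  have hs : p.support ⊆ (hp.toFinset : Set α) := by simp
  rw [expect_eq_sum hs, expect_eq_sum hs]
  exact Finset.sum_le_sum fun a ha =>
    mul_le_mul_of_nonneg_left (h a (hp.mem_toFinset.1 ha)) ENNReal.toReal_nonneg

theorem expect_congr {p : PMF α} {f g : α → ℝ} (h : ∀ a ∈ p.support, f a = g a) :
    expect p f = expect p g := by
  refine tsum_congr fun a => ?_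
  by_cases ha : p a = 0
  · simp [ha]
  · rw [h a ((PMF.mem_support_iff _ _).2 ha)]

theorem expect_add {p : PMF α} (hp : p.support.Finite) (f g : α → ℝ) :
    expect p (fun a => f a + g a) = expect p f + expect p g := by
  have hs : p.support ⊆ (hp.toFinset : Set α) := by simp
  rw [expect_eq_sum hs, expect_eq_sum hs, expect_eq_sum hs, ← Finset.sum_add_distrib]
  exact Finset.sum_congr rfl fun a _ => by ring

theorem expect_const_mul (p : PMF α) (r : ℝ) (f : α → ℝ) :
    expect p (fun a => r * f a) = r * expect p f := by
  rw [expect, expect, ← tsum_mul_left]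
  exact tsum_congr fun a => by ring

theorem expect_sub {p : PMF α} (hp : p.support.Finite) (f g : α → ℝ) :
    expect p (fun a => f a - g a) = expect p f - expect p g := by
  have h := expect_add hp f fun a => -1 * g a
  rw [expect_const_mul] at h
  rw [show (fun a => f a - g a) = fun a => f a + -1 * g a by ext; ring, h]
  ring

theorem expect_const {p : PMF α} (hp : p.support.Finite) (r : ℝ) : expect p (fun _ => r) = r := by
  have hs : p.support ⊆ (hp.toFinset : Set α) := by simp
  rw [expect_eq_sum hs, ← Finset.sum_mul, sum_toReal_eq_one hs, one_mul]

theorem finite_support_bind {p : PMF α} {f : α → PMF β} (hp : p.support.Finite)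
    (hf : ∀ a ∈ p.support, (f a).support.Finite) : (p.bind f).support.Finite := by
  rw [PMF.support_bind]
  exact hp.biUnion hf

theorem finite_support_map {p : PMF α} {f : α → β} (hp : p.support.Finite) :
    (p.map f).support.Finite := by
  rw [PMF.support_map]
  exact hp.image f

theorem expect_bind {p : PMF α} {f : α → PMF β} (hp : p.support.Finite)
    (hf : ∀ a ∈ p.support, (f a).support.Finite) (g : β → ℝ) :
    expect (p.bind f) g = expect p fun a => expect (f a) g := by
  have hb := finite_support_bind hp hf
  have hs : p.support ⊆ (hp.toFinset : Set α) := by simp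
  have hsb : (p.bind f).support ⊆ (hb.toFinset : Set β) := by simp
  rw [expect_eq_sum hsb, expect_eq_sum hs]
  have h1 : ∀ b, ((p.bind f) b).toReal = ∑ a ∈ hp.toFinset, (p a).toReal * (f a b).toReal := by
    intro b
    rw [PMF.bind_apply, tsum_eq_sum (s := hp.toFinset), ENNReal.toReal_sum]
    · simp
    · exact fun a _ => ENNReal.mul_ne_top (p.apply_ne_top a) ((f a).apply_ne_top b)
    · intro a ha
      have : p a = 0 := by
        by_contra h
        exact ha (hs ((PMF.mem_support_iff _ _).2 h))
      simp [this]
  simp only [h1, Finset.sum_mul]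
  rw [Finset.sum_comm]
  refine Finset.sum_congr rfl fun a ha => ?_
  have ha' := hp.mem_toFinset.1 ha
  have hsub : (f a).support ⊆ (hb.toFinset : Set β) := by
    rw [Set.Finite.coe_toFinset, PMF.support_bind]
    exact Set.subset_biUnion_of_mem (u := fun a => (f a).support) ha'
  rw [expect_eq_sum hsub, Finset.mul_sum]
  exact Finset.sum_congr rfl fun b _ => by ring

theorem expect_map {p : PMF α} (f : α → β) (hp : p.support.Finite) (g : β → ℝ) :
    expect (p.map f) g = expect p fun a => g (f a) := by
  rw [← PMF.bind_pure_comp, expect_bind hp fun a _ => by simp]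
  simp [expect_pure]

end Expectation

/-! ### Prompts -/

section Prompts

variable {Z V : Type*} {P : Z → List V → PMF V} {K : Z → List V → PMF (List V)}

theorem tokens_concat (E : List (List V × V)) (q : List V) (r : V) :
    tokens (E ++ [(q, r)]) = tokens E ++ q ++ [r] := by simp [tokens]

/-- The sum over the examples of a function of the prompt and the response. -/
noncomputable def exampleSum (g : List V → V → ℝ) (E : List (List V × V)) : ℝ :=
  ∑ t, g (prompt E t) (E.get t).2

theorem exampleSum_concat (g : List V → V → ℝ) (E : List (List V × V)) (q : List V) (r : V) :
    exampleSum g (E ++ [(q, r)]) = exampleSum g E + g (tokens E ++ q) r := by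
  have hlen : (E ++ [(q, r)]).length = E.length + 1 := by simp
  rw [exampleSum, ← (finCongr hlen.symm).sum_comp, Fin.sum_univ_castSucc]
  congr 1
  · refine Finset.sum_congr rfl fun t _ => ?_
    have ht := t.2
    simp [prompt, List.take_append_of_le_length ht.le, List.getElem_append_left ht]
  · simp [prompt]

theorem length_of_mem_support_examplesLaw (z : Z) (t : ℕ) :
    ∀ E ∈ (examplesLaw P K z t).support, E.length = t := by
  induction t with
  | zero => simp [examplesLaw]
  | succ t ih =>
    intro E hE
    simp only [examplesLaw, PMF.mem_support_bind_iff, PMF.mem_support_map_iff] at hE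
    obtain ⟨E', hE', q, -, r, -, rfl⟩ := hE
    simp [ih E' hE']

theorem promptLaw_ne_zero {z : Z} {t : ℕ} {E : List (List V × V)} {q : List V}
    (hE : E ∈ (examplesLaw P K z t).support) (hq : q ∈ (K z (tokens E)).support) :
    promptLaw P K z t (tokens E ++ q) ≠ 0 := by
  rw [← PMF.mem_support_iff, promptLaw, PMF.mem_support_bind_iff]
  exact ⟨E, hE, (PMF.mem_support_map_iff _ _ _).2 ⟨q, hq, rfl⟩⟩

variable [Fintype V]

theorem finite_length_le (n : ℕ) : {S : List V | S.length ≤ n}.Finite := List.finite_length_le V n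

section Bounded

variable {z : Z} {T n : ℕ} (hlen : ∀ t < T, ∀ S, promptLaw P K z t S ≠ 0 → S.length ≤ n)

include hlen

/-- A covariate is the end of a prompt, and prompt lengths are bounded through domination by the
pretraining law. All laws involved therefore have finite support, and expectations are finite sums.
-/
theorem finite_support_covariate {t : ℕ} (ht : t < T) {E : List (List V × V)}
    (hE : E ∈ (examplesLaw P K z t).support) : (K z (tokens E)).support.Finite := by
  refine (finite_length_le n).subset fun q hq => ?_
  have := hlen t ht _ (promptLaw_ne_zero hE hq)
  rw [List.length_append] at this
  exact (Nat.le_add_left _ _).trans this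

theorem finite_support_examplesLaw {t : ℕ} (ht : t ≤ T) : (examplesLaw P K z t).support.Finite := by
  induction t with
  | zero => simp [examplesLaw]
  | succ t ih =>
    exact finite_support_bind (ih (by omega)) fun E hE =>
      finite_support_bind (finite_support_covariate hlen ht hE) fun q _ =>
        finite_support_map (Set.toFinite _)

theorem expect_examplesLaw_succ {t : ℕ} (ht : t < T) (g : List (List V × V) → ℝ) :
    expect (examplesLaw P K z (t + 1)) g = expect (examplesLaw P K z t) fun E =>
      expect (K z (tokens E)) fun q => expect (P z (tokens E ++ q)) fun r => g (E ++ [(q, r)]) := by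
  rw [examplesLaw, expect_bind (finite_support_examplesLaw hlen ht.le) fun E hE =>
      finite_support_bind (finite_support_covariate hlen ht hE) fun q _ =>
        finite_support_map (Set.toFinite _)]
  refine expect_congr fun E hE => ?_
  rw [expect_bind (finite_support_covariate hlen ht hE) fun q _ =>
    finite_support_map (Set.toFinite _)]
  exact expect_congr fun q _ => expect_map _ (Set.toFinite _) _

theorem expect_promptLaw {t : ℕ} (ht : t < T) (f : List V → ℝ) :
    expect (promptLaw P K z t) f = expect (examplesLaw P K z t) fun E =>
      expect (K z (tokens E)) fun q => f (tokens E ++ q) := by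
  rw [promptLaw, expect_bind (finite_support_examplesLaw hlen ht.le) fun E hE =>
    finite_support_map (finite_support_covariate hlen ht hE)]
  exact expect_congr fun E hE => expect_map _ (finite_support_covariate hlen ht hE) _

theorem expect_exampleSum (g : List V → V → ℝ) {t : ℕ} (ht : t ≤ T) :
    expect (examplesLaw P K z t) (exampleSum g) = ∑ s ∈ Finset.range t,
      expect (promptLaw P K z s) fun S => expect (P z S) (g S) := by
  induction t with
  | zero => simp [examplesLaw, expect_pure, exampleSum]
  | succ t ih =>
    rw [Finset.sum_range_succ, ← ih (by omega), expect_examplesLaw_succ hlen ht,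
      expect_promptLaw hlen ht, ← expect_add (finite_support_examplesLaw hlen (by omega))]
    refine expect_congr fun E hE => ?_
    have hK := finite_support_covariate hlen ht hE
    rw [← expect_const hK (exampleSum g E), ← expect_add hK]
    refine expect_congr fun q _ => ?_
    have hV : (P z (tokens E ++ q)).support.Finite := Set.toFinite _
    rw [← expect_const hV (exampleSum g E), ← expect_add hV]
    simp only [exampleSum_concat]

theorem finite_support_promptLaw {t : ℕ} (ht : t < T) : (promptLaw P K z t).support.Finite :=
  (finite_length_le n).subset fun S hS => hlen t ht S ((PMF.mem_support_iff _ _).1 hS)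

theorem sum_expect_promptLaw (f : List V → ℝ) :
    (T : ℝ)⁻¹ * ∑ t ∈ Finset.range T, expect (promptLaw P K z t) f
      = ∑ S ∈ (finite_length_le (V := V) n).toFinset, (promptDist P K T z S).toReal * f S := by
  have h : ∀ t ∈ Finset.range T, expect (promptLaw P K z t) f
      = ∑ S ∈ (finite_length_le (V := V) n).toFinset, (promptLaw P K z t S).toReal * f S :=
    fun t ht => expect_eq_sum (fun S hS => by
      simpa using hlen t (Finset.mem_range.1 ht) S ((PMF.mem_support_iff _ _).1 hS)) f
  rw [Finset.sum_congr rfl h, Finset.sum_comm, Finset.mul_sum]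
  refine Finset.sum_congr rfl fun S _ => ?_
  rw [promptDist, ENNReal.toReal_div, ENNReal.toReal_sum fun t _ => PMF.apply_ne_top _ _,
    ← Finset.sum_mul, ENNReal.toReal_natCast]
  ring

end Bounded

/-! ### Factorization of the prompt probabilities -/

/-- The concept enters only through the likelihood of the token sequence, since the covariate
weights are free of it. Consequently a prompt carries the same posterior as its plain token
sequence. -/
theorem examplesLaw_factor (hK : IsCovariateLaw P K) (t : ℕ) :
    ∃ v : List (List V × V) → ℝ≥0∞, ∀ z E,
      examplesLaw P K z t E = v E * seqProb (P z) [] (tokens E) := by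
  classical
  obtain ⟨w, hw⟩ := hK
  induction t with
  | zero =>
    refine ⟨fun E => if E = [] then 1 else 0, fun z E => ?_⟩
    by_cases h : E = []
    · subst h; simp [examplesLaw, tokens, seqProb]
    · simp [examplesLaw, h]
  | succ t ih =>
    obtain ⟨v, hv⟩ := ih
    refine ⟨fun E => ∑' E', ∑' q, ∑' r, if E = E' ++ [(q, r)] then v E' * w (tokens E') q else 0,
      fun z E => ?_⟩
    simp only [examplesLaw, PMF.bind_apply, PMF.map_apply]
    simp only [← ENNReal.tsum_mul_right, ← ENNReal.tsum_mul_left]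
    refine tsum_congr fun E' => tsum_congr fun q => tsum_congr fun r => ?_
    split_ifs with h
    · subst h
      rw [tokens_concat, seqProb_concat, seqProb_append, hv, hw]
      simp only [List.nil_append]
      ring
    · simp

theorem promptLaw_factor (hK : IsCovariateLaw P K) (t : ℕ) :
    ∃ v : List V → ℝ≥0∞, ∀ z S, promptLaw P K z t S = v S * seqProb (P z) [] S := by
  classical
  obtain ⟨v, hv⟩ := examplesLaw_factor hK t
  obtain ⟨w, hw⟩ := hK
  refine ⟨fun S => ∑' E, ∑' q, if S = tokens E ++ q then v E * w (tokens E) q else 0,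
    fun z S => ?_⟩
  simp only [promptLaw, PMF.bind_apply, PMF.map_apply]
  simp only [← ENNReal.tsum_mul_right, ← ENNReal.tsum_mul_left]
  refine tsum_congr fun E => tsum_congr fun q => ?_
  split_ifs with h
  · subst h
    rw [seqProb_append, hv, hw]
    simp only [List.nil_append]
    ring
  · simp

theorem promptDist_factor (hK : IsCovariateLaw P K) (T : ℕ) :
    ∃ v : List V → ℝ≥0∞, ∀ z S, promptDist P K T z S = v S * seqProb (P z) [] S := by
  choose v hv using promptLaw_factor hK
  refine ⟨fun S => (∑ t ∈ Finset.range T, v t S) / T, fun z S => ?_⟩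
  simp only [promptDist, hv, ← Finset.sum_mul, ENNReal.div_eq_inv_mul]
  ring

end Prompts

/-! ### Splitting the regret at the predictive law -/

section Regret

open MeasureTheory

variable {Z : Type*} [MeasurableSpace Z] {c : Config} {prior : Measure Z}
  [IsProbabilityMeasure prior] {P : Z → List (Fin c.dy) → PMF (Fin c.dy)}
  {K : Z → List (Fin c.dy) → PMF (List (Fin c.dy))}
  {emb : Fin c.dy ↪ (Fin c.d → ℝ)} {R c₀ : ℝ} {Tp T : ℕ}

/-- The prompts of positive probability under the concept `z` are of the kind seen in
pretraining. -/
def PromptsCovered (prior : Measure Z) (P : Z → List (Fin c.dy) → PMF (Fin c.dy))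
    (K : Z → List (Fin c.dy) → PMF (List (Fin c.dy))) (Tp T : ℕ) (z : Z) : Prop :=
  ∀ t < T, ∀ S, promptLaw P K z t S ≠ 0 → S ≠ [] ∧ S.length ≤ Tp ∧ evidence prior P S ≠ 0

theorem pretrainDist_ne_top (hT : 1 ≤ Tp) (S : List (Fin c.dy)) : pretrainDist prior P Tp S ≠ ∞ := by
  refine ENNReal.div_ne_top (ENNReal.sum_ne_top.2 fun t _ => ?_) (by exact_mod_cast (by omega : Tp ≠ 0))
  refine ne_top_of_le_ne_top (b := ∫⁻ _, 1 ∂prior) (by simp) ?_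
  exact lintegral_mono fun z => PMF.coe_le_one _ _

theorem pretrainDist_support (hT : 1 ≤ Tp) {S : List (Fin c.dy)}
    (hS : pretrainDist prior P Tp S ≠ 0) :
    S ≠ [] ∧ S.length ≤ Tp ∧ evidence prior P S ≠ 0 := by
  have h := ENNReal.toReal_pos hS (pretrainDist_ne_top hT S)
  rw [toReal_pretrainDist] at h
  obtain ⟨t, -, ht⟩ := Finset.exists_ne_zero_of_sum_ne_zero h.ne'
  have hlen : S.length = t.val + 1 := by
    by_contra hne
    simp [hne] at ht
  rw [if_pos hlen] at ht
  refine ⟨?_, ?_, ?_⟩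
  · rintro rfl; simp at hlen
  · have := t.2; omega
  · intro h0; simp [h0] at ht

theorem promptLaw_eq_zero_of_promptDist (z : Z) {t : ℕ} (ht : t < T) {S : List (Fin c.dy)}
    (h : promptDist P K T z S = 0) : promptLaw P K z t S = 0 := by
  rw [promptDist, ENNReal.div_eq_zero_iff] at h
  rcases h with h | h
  · exact Finset.sum_eq_zero_iff.1 h t (Finset.mem_range.2 ht)
  · exact absurd h (ENNReal.natCast_ne_top T)

theorem promptsCovered_of_forall (hT : 1 ≤ Tp) {z : Z}
    (h : ∀ S, pretrainDist prior P Tp S = 0 → promptDist P K T z S = 0) :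
    PromptsCovered prior P K Tp T z := by
  intro t ht S hS
  refine pretrainDist_support hT fun h0 => hS ?_
  exact promptLaw_eq_zero_of_promptDist z ht (h S h0)

theorem promptDist_ne_top (z : Z) (S : List (Fin c.dy)) : promptDist P K T z S ≠ ∞ := by
  rcases Nat.eq_zero_or_pos T with rfl | hT
  · simp [promptDist]
  · exact ENNReal.div_ne_top (ENNReal.sum_ne_top.2 fun t _ => PMF.apply_ne_top _ _)
      (by exact_mod_cast hT.ne')

/-- The divergence of the predictive law from the law under the concept `z`. -/
noncomputable def conceptKL (prior : Measure Z) (P : Z → List (Fin c.dy) → PMF (Fin c.dy)) (z : Z)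
    (S : List (Fin c.dy)) : ℝ :=
  ∑ x, (P z S x).toReal * Real.log ((P z S x).toReal / predictive prior P S x)

theorem sum_toReal_prob (z : Z) (S : List (Fin c.dy)) : ∑ x, (P z S x).toReal = 1 :=
  sum_toReal_eq_one (by simp)

theorem Nominal.prob_pos (h : Nominal emb P R c₀ Tp) (z : Z) {S : List (Fin c.dy)} (hS : S ≠ [])
    (x : Fin c.dy) : 0 < (P z S x).toReal := h.c₀_pos.trans_le (h.le_prob z S x hS)

/-- The expected regret splits into the regret of Bayesian model averaging and the error of the
model with respect to the predictive law. -/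
theorem expectedRegret_eq (h : Nominal emb P R c₀ Tp) {z : Z}
    (hz : PromptsCovered prior P K Tp T z) (θ : Param c) :
    expectedRegret P K emb T θ z
      = (T : ℝ)⁻¹ * ∑ t ∈ Finset.range T, expect (promptLaw P K z t) (conceptKL prior P z)
        + (T : ℝ)⁻¹ * ∑ t ∈ Finset.range T, expect (promptLaw P K z t) fun S =>
            ∑ x, (P z S x).toReal * logRatio prior P emb θ S x := by
  have hlen : ∀ t < T, ∀ S, promptLaw P K z t S ≠ 0 → S.length ≤ Tp := fun t ht S hS =>
    (hz t ht S hS).2.1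
  have h1 : expectedRegret P K emb T θ z = expect (examplesLaw P K z T) fun E =>
      (T : ℝ)⁻¹ * exampleSum (fun S x => Real.log (P z S x).toReal -
        Real.log (modelProb emb θ S x)) E := by
    refine expect_congr fun E hE => ?_
    have hE' := length_of_mem_support_examplesLaw z T E hE
    rw [regret, ← mul_sub, ← Finset.sum_sub_distrib, exampleSum, ← hE']
  rw [h1, expect_const_mul, expect_exampleSum hlen _ le_rfl, ← mul_add, ← Finset.sum_add_distrib]
  congr 1
  refine Finset.sum_congr rfl fun t ht => ?_
  have ht' := Finset.mem_range.1 ht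
  rw [← expect_add (finite_support_promptLaw hlen ht')]
  refine expect_congr fun S hS => ?_
  obtain ⟨hS0, -, hM⟩ := hz t ht' S ((PMF.mem_support_iff _ _).1 hS)
  rw [expect_fintype, conceptKL, ← Finset.sum_add_distrib]
  refine Finset.sum_congr rfl fun x _ => ?_
  rw [logRatio_eq h hS0 hM, Real.log_div (h.prob_pos z hS0 x).ne' (h.predictive_pos hS0 hM x).ne']
  ring

/-! ### Bayesian model averaging -/

/-- The logarithm of the ratio of the marginal probability of a token sequence and its
probability under the concept `z`. -/
noncomputable def logEvidenceRatio (prior : Measure Z) (P : Z → List (Fin c.dy) → PMF (Fin c.dy))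
    (z : Z) (S : List (Fin c.dy)) : ℝ :=
  Real.log ((evidence prior P S).toReal / (seqProb (P z) [] S).toReal)

theorem toReal_seqProb_concat (z : Z) (S : List (Fin c.dy)) (x : Fin c.dy) :
    (seqProb (P z) [] (S ++ [x])).toReal = (seqProb (P z) [] S).toReal * (P z S x).toReal := by
  rw [seqProb_concat, ENNReal.toReal_mul, List.nil_append]

theorem seqProb_ne_top (p : List (Fin c.dy) → PMF (Fin c.dy)) (S S' : List (Fin c.dy)) :
    seqProb p S S' ≠ ∞ := ne_top_of_le_ne_top ENNReal.one_ne_top (seqProb_le_one _ _ _)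

/-- One more token multiplies the marginal by its predictive probability and the likelihood by its
probability under z. The divergence is therefore an increment that telescopes. -/
theorem conceptKL_eq (h : Nominal emb P R c₀ Tp) {z : Z} {S : List (Fin c.dy)} (hS : S ≠ [])
    (hM : evidence prior P S ≠ 0) (hF : seqProb (P z) [] S ≠ 0) :
    conceptKL prior P z S = logEvidenceRatio prior P z S -
      expect (P z S) fun x => logEvidenceRatio prior P z (S ++ [x]) := by
  have hM' := ENNReal.toReal_pos hM (evidence_ne_top S)
  have hF' := ENNReal.toReal_pos hF (seqProb_ne_top _ _ _)
  have e : logEvidenceRatio prior P z S = ∑ x, (P z S x).toReal * logEvidenceRatio prior P z S := by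
    rw [← Finset.sum_mul, sum_toReal_prob, one_mul]
  rw [e, expect_fintype, ← Finset.sum_sub_distrib, conceptKL]
  refine Finset.sum_congr rfl fun x _ => ?_
  have hp := h.prob_pos z hS x
  have hq := h.predictive_pos hS hM x
  rw [logEvidenceRatio, logEvidenceRatio, ← evidence_mul_predictive, toReal_seqProb_concat,
    Real.log_div hp.ne' hq.ne', Real.log_div hM'.ne' hF'.ne',
    Real.log_div (by positivity) (by positivity), Real.log_mul hM'.ne' hq.ne',
    Real.log_mul hF'.ne' hp.ne']
  ring

/-- For each concept the weighted likelihoods sum to at most one, as `K` is a probability law;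
integration over the prior keeps the bound. Only an inequality is claimed, because s may omit
covariates possible under other concepts. -/
theorem sum_weight_mul_evidence_le (hP : ∀ S x, Measurable fun z => P z S x)
    {w : List (Fin c.dy) → List (Fin c.dy) → ℝ≥0∞} (hw : ∀ z S q, K z S q = w S q * seqProb (P z) S q)
    (S : List (Fin c.dy)) (s : Finset (List (Fin c.dy))) :
    ∑ q ∈ s, w S q * evidence prior P (S ++ q) ≤ evidence prior P S := by
  calc ∑ q ∈ s, w S q * evidence prior P (S ++ q)
      = ∫⁻ z, ∑ q ∈ s, w S q * seqProb (P z) [] (S ++ q) ∂prior := by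
        rw [lintegral_finsetSum _ fun q _ => (measurable_seqProb hP _ _).const_mul _]
        refine Finset.sum_congr rfl fun q _ => ?_
        rw [lintegral_const_mul _ (measurable_seqProb hP _ _), evidence]
    _ ≤ ∫⁻ z, seqProb (P z) [] S ∂prior := by
        refine lintegral_mono fun z => ?_
        have : ∀ q ∈ s, w S q * seqProb (P z) [] (S ++ q) = seqProb (P z) [] S * K z S q := by
          intro q _
          rw [seqProb_append, hw, List.nil_append]
          ring
        rw [Finset.sum_congr rfl this, ← Finset.mul_sum]
        refine mul_le_of_le_one_right' ?_
        rw [← (K z S).tsum_coe]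
        exact ENNReal.sum_le_tsum s
    _ = _ := rfl

/-- Under z the ratio of marginal to likelihood is a supermartingale, and log x ≤ x - 1 carries this
to its logarithm: covariates cannot increase the potential on average. -/
theorem expect_logEvidenceRatio_le (hP : ∀ S x, Measurable fun z => P z S x)
    (hK : IsCovariateLaw P K) {z : Z} {S : List (Fin c.dy)} (hfin : (K z S).support.Finite)
    (hF : seqProb (P z) [] S ≠ 0) (hM : ∀ q ∈ (K z S).support, evidence prior P (S ++ q) ≠ 0) :
    expect (K z S) (fun q => logEvidenceRatio prior P z (S ++ q)) ≤ logEvidenceRatio prior P z S := by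
  obtain ⟨w, hw⟩ := hK
  have hF' := ENNReal.toReal_pos hF (seqProb_ne_top _ _ _)
  obtain ⟨q₀, hq₀⟩ := (K z S).support_nonempty
  have hMS : evidence prior P S ≠ 0 := fun h0 =>
    hM q₀ hq₀ (le_antisymm (h0 ▸ evidence_append_le S q₀) bot_le)
  have hM' := ENNReal.toReal_pos hMS (evidence_ne_top S)
  have hs : (K z S).support ⊆ (hfin.toFinset : Set _) := by simp
  rw [← sub_nonpos, ← expect_const hfin (logEvidenceRatio prior P z S), ← expect_sub hfin,
    expect_eq_sum hs]
  have hterm : ∀ q ∈ hfin.toFinset, (K z S q).toReal *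
      (logEvidenceRatio prior P z (S ++ q) - logEvidenceRatio prior P z S) ≤
      (w S q * evidence prior P (S ++ q)).toReal / (evidence prior P S).toReal - (K z S q).toReal := by
    intro q hq
    have hKq := (PMF.mem_support_iff _ _).1 (hfin.mem_toFinset.1 hq)
    have hFq : seqProb (P z) S q ≠ 0 := by
      intro h0; apply hKq; rw [hw, h0, mul_zero]
    have hFq' := ENNReal.toReal_pos hFq (seqProb_ne_top _ _ _)
    have hMq' := ENNReal.toReal_pos (hM q (hfin.mem_toFinset.1 hq)) (evidence_ne_top _)
    rw [logEvidenceRatio, logEvidenceRatio, seqProb_append, List.nil_append, ENNReal.toReal_mul,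
      ← Real.log_div (by positivity) (by positivity)]
    have hlog := Real.log_le_sub_one_of_pos
      (x := (evidence prior P (S ++ q)).toReal /
        ((seqProb (P z) [] S).toReal * (seqProb (P z) S q).toReal) /
        ((evidence prior P S).toReal / (seqProb (P z) [] S).toReal)) (by positivity)
    refine (mul_le_mul_of_nonneg_left hlog ENNReal.toReal_nonneg).trans (le_of_eq ?_)
    rw [hw, ENNReal.toReal_mul, ENNReal.toReal_mul]
    field_simp
  refine (Finset.sum_le_sum hterm).trans ?_
  rw [Finset.sum_sub_distrib, sum_toReal_eq_one hs, ← Finset.sum_div, sub_nonpos,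
    div_le_one hM']
  have hle := sum_weight_mul_evidence_le (prior := prior) hP hw S hfin.toFinset
  rw [← ENNReal.toReal_sum]
  · exact ENNReal.toReal_mono (evidence_ne_top (prior := prior) (P := P) S) hle
  · intro q hq
    exact ne_top_of_le_ne_top (evidence_ne_top (prior := prior) (P := P) S)
      ((Finset.single_le_sum (f := fun q => w S q * evidence prior P (S ++ q))
        (fun _ _ => bot_le) hq).trans hle)

variable [MeasurableSingletonClass Z]

theorem prior_mul_seqProb_le_evidence (z : Z) (S : List (Fin c.dy)) :
    seqProb (P z) [] S * prior {z} ≤ evidence prior P S := by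
  rw [evidence, ← lintegral_singleton (fun z => seqProb (P z) [] S) z]
  exact setLIntegral_le_lintegral _ _

theorem neg_le_logEvidenceRatio {z : Z} {β : ℝ} (hz : 0 < prior.real {z})
    (hβ : Real.log (1 / prior.real {z}) ≤ β) {S : List (Fin c.dy)} (hF : seqProb (P z) [] S ≠ 0) :
    -β ≤ logEvidenceRatio prior P z S := by
  have hF' := ENNReal.toReal_pos hF (seqProb_ne_top _ _ _)
  have h1 : prior.real {z} ≤ (evidence prior P S).toReal / (seqProb (P z) [] S).toReal := by
    rw [le_div_iff₀ hF', mul_comm]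
    have := ENNReal.toReal_mono (evidence_ne_top (prior := prior) (P := P) S)
      (prior_mul_seqProb_le_evidence (P := P) z S)
    rwa [ENNReal.toReal_mul] at this
  have h2 := Real.log_le_log hz h1
  rw [one_div, Real.log_inv] at hβ
  rw [logEvidenceRatio]
  linarith

/-- The cumulative regret of Bayesian model averaging is at most the log-inverse of the prior
probability of the concept. -/
theorem sum_expect_conceptKL_le (h : Nominal emb P R c₀ Tp) (hK : IsCovariateLaw P K) {z : Z}
    (hz : PromptsCovered prior P K Tp T z) {β : ℝ} (hpz : 0 < prior.real {z})
    (hβ : Real.log (1 / prior.real {z}) ≤ β) :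
    ∑ t ∈ Finset.range T, expect (promptLaw P K z t) (conceptKL prior P z) ≤ β := by
  have hlen : ∀ t < T, ∀ S, promptLaw P K z t S ≠ 0 → S.length ≤ Tp := fun t ht S hS =>
    (hz t ht S hS).2.1
  have hF : ∀ t, ∀ E ∈ (examplesLaw P K z t).support, seqProb (P z) [] (tokens E) ≠ 0 := by
    intro t E hE h0
    obtain ⟨v, hv⟩ := examplesLaw_factor hK t
    exact (PMF.mem_support_iff _ _).1 hE (by rw [hv, h0, mul_zero])
  have hFp : ∀ t S, promptLaw P K z t S ≠ 0 → seqProb (P z) [] S ≠ 0 := by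
    intro t S hS h0
    obtain ⟨v, hv⟩ := promptLaw_factor hK t
    exact hS (by rw [hv, h0, mul_zero])
  -- The potential after t complete examples; it is 0 at the start and at least -β at the end, and
  -- its decreases dominate the divergences.
  set A : ℕ → ℝ := fun t => expect (examplesLaw P K z t) fun E =>
    logEvidenceRatio prior P z (tokens E) with hA
  have hstep : ∀ t < T, expect (promptLaw P K z t) (conceptKL prior P z) ≤ A t - A (t + 1) := by
    intro t ht
    have hfinE := finite_support_examplesLaw hlen ht.le
    simp only [hA]
    rw [expect_examplesLaw_succ hlen ht, expect_promptLaw hlen ht, ← expect_sub hfinE]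
    refine expect_mono hfinE fun E hE => ?_
    have hfinK := finite_support_covariate hlen ht hE
    have hsup := expect_logEvidenceRatio_le (prior := prior) h.measurable hK hfinK (hF t E hE)
      fun q hq => (hz t ht _ (promptLaw_ne_zero hE hq)).2.2
    refine le_trans (le_of_eq ?_) (sub_le_sub_right hsup _)
    rw [← expect_sub hfinK]
    refine expect_congr fun q hq => ?_
    have hne := promptLaw_ne_zero hE hq
    obtain ⟨hS, -, hM⟩ := hz t ht _ hne
    rw [conceptKL_eq h hS hM (hFp t _ hne)]
    simp only [tokens_concat]
  have hA0 : A 0 = 0 := by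
    simp [hA, examplesLaw, expect_pure, tokens, logEvidenceRatio, evidence_nil, seqProb]
  have hAT : -β ≤ A T := by
    have hfin := finite_support_examplesLaw hlen le_rfl
    rw [← expect_const hfin (-β)]
    exact expect_mono hfin fun E hE => neg_le_logEvidenceRatio hpz hβ (hF T E hE)
  calc _ ≤ ∑ t ∈ Finset.range T, (A t - A (t + 1)) :=
        Finset.sum_le_sum fun t ht => hstep t (Finset.mem_range.1 ht)
    _ = A 0 - A T := Finset.sum_range_sub' A T
    _ ≤ β := by linarith

end Regret

/-! ### Change of measure and the two regret bounds -/

/-- The error from replacing `ps` by `p` is a difference of measures against a log-ratio bounded by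
b. Factoring the difference through square roots leaves a squared Hellinger distance, at most the
divergence of `p` from `ps`, and a second moment of the log-ratio, at most 4b times the divergence
of q from `p`. Thus the bound stays linear in both divergences. -/
theorem sum_mul_log_le_of_three {V : Type*} [Fintype V] {p ps q : V → ℝ} {b : ℝ} (hb : 1 ≤ b)
    (hps : ∀ x, 0 < ps x) (hp : ∀ x, 0 < p x) (hq : ∀ x, 0 < q x) (hps1 : ∑ x, ps x = 1)
    (hp1 : ∑ x, p x = 1) (hq1 : ∑ x, q x = 1) (h : ∀ x, |Real.log (p x / q x)| ≤ b) :
    ∑ x, ps x * Real.log (p x / q x) ≤ 13 * ∑ x, p x * Real.log (p x / q x)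
      + 5 / 2 * b * ∑ x, ps x * Real.log (ps x / p x) := by
  have hsq := sum_mul_log_sq_le hb hp hq hp1 hq1 h
  have hterm : ∀ x, ps x * Real.log (p x / q x) ≤ p x * Real.log (p x / q x)
      + (3 / b * (p x * Real.log (p x / q x) ^ 2)
        + 5 / 2 * b * (ps x * Real.log (ps x / p x) + p x - ps x)) := by
    intro x
    set u := Real.log (p x / q x)
    set s := Real.sqrt (ps x) with hs
    set r := Real.sqrt (p x) with hr
    have hs2 : s ^ 2 = ps x := Real.sq_sqrt (hps x).le
    have hr2 : r ^ 2 = p x := Real.sq_sqrt (hp x).le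
    have hs0 : 0 < s := Real.sqrt_pos.2 (hps x)
    have hr0 : 0 < r := Real.sqrt_pos.2 (hp x)
    -- Termwise Hellinger bound, from log(s/r) ≥ 1 - r/s; the correction `p` - `ps` sums to zero.
    have hKL : (s - r) ^ 2 ≤ ps x * Real.log (ps x / p x) + p x - ps x := by
      have h1 : Real.log (ps x / p x) = 2 * Real.log (s / r) := by
        rw [← hs2, ← hr2, ← div_pow, Real.log_pow]; norm_num
      have h2 := Real.one_sub_inv_le_log_of_pos (div_pos hs0 hr0)
      rw [inv_div] at h2
      have h3 := mul_le_mul_of_nonneg_left h2 (sq_nonneg s)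
      have h4 : s ^ 2 * (1 - r / s) = s ^ 2 - s * r := by field_simp
      rw [h1, ← hs2, ← hr2]
      nlinarith
    have hu2 : u ^ 2 ≤ b ^ 2 := sq_le_sq' (abs_le.1 (h x)).1 (abs_le.1 (h x)).2
    have hb0 : 0 < b := by linarith
    have hcs : (s ^ 2 - r ^ 2) * u ≤ b / 2 * (s - r) ^ 2 + (s + r) ^ 2 * u ^ 2 / (2 * b) := by
      have : 0 ≤ (b * (s - r) - (s + r) * u) ^ 2 / (2 * b) := by positivity
      have e : (b * (s - r) - (s + r) * u) ^ 2 / (2 * b)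
          = b / 2 * (s - r) ^ 2 + (s + r) ^ 2 * u ^ 2 / (2 * b) - (s ^ 2 - r ^ 2) * u := by
        field_simp; ring
      linarith
    -- Trades s for r plus the difference, so that the second moment is taken under `p` only. It
    -- gives 3/b and 5/2 = 1/2 + 2; the former times 4b is 12, whence 13.
    have hsr : (s + r) ^ 2 ≤ 6 * r ^ 2 + 4 * (s - r) ^ 2 := by nlinarith [sq_nonneg (3 * s - 5 * r)]
    have h5 : (s + r) ^ 2 * u ^ 2 / (2 * b) ≤ 3 / b * (r ^ 2 * u ^ 2) + 2 * b * (s - r) ^ 2 := by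
      rw [div_le_iff₀ (by positivity)]
      have e : (3 / b * (r ^ 2 * u ^ 2) + 2 * b * (s - r) ^ 2) * (2 * b)
          = 6 * r ^ 2 * u ^ 2 + 4 * (s - r) ^ 2 * b ^ 2 := by field_simp; ring
      rw [e]
      have h6 := mul_le_mul_of_nonneg_right hsr (sq_nonneg u)
      have h7 := mul_le_mul_of_nonneg_left hu2 (sq_nonneg (s - r))
      linarith
    have h8 := mul_le_mul_of_nonneg_left hKL (by linarith : 0 ≤ 5 / 2 * b)
    rw [← hr2, ← hs2] at *
    linarith
  have hb0 : 0 < b := by linarith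
  have h12 : 3 / b * ∑ x, p x * Real.log (p x / q x) ^ 2 ≤ 12 * ∑ x, p x * Real.log (p x / q x) := by
    rw [div_mul_eq_mul_div, div_le_iff₀ hb0]; linarith
  calc _ ≤ _ := Finset.sum_le_sum fun x _ => hterm x
    _ = ∑ x, p x * Real.log (p x / q x) + (3 / b * ∑ x, p x * Real.log (p x / q x) ^ 2
          + 5 / 2 * b * ∑ x, ps x * Real.log (ps x / p x)) := by
        simp only [Finset.sum_add_distrib, Finset.sum_sub_distrib, ← Finset.mul_sum, hp1, hps1]
        ring
    _ ≤ _ := by linarith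

section Main

open MeasureTheory

variable {Z : Type*} [MeasurableSpace Z] [MeasurableSingletonClass Z] {c : Config}
  {prior : Measure Z}
  [IsProbabilityMeasure prior] {P : Z → List (Fin c.dy) → PMF (Fin c.dy)}
  {K : Z → List (Fin c.dy) → PMF (List (Fin c.dy))}
  {emb : Fin c.dy ↪ (Fin c.d → ℝ)} {R c₀ : ℝ} {Tp T : ℕ}

/-- Domination can be used because the divergences are nonnegative; the log-ratios themselves have
no sign. -/
theorem sum_mul_stepKL_le (hP : ∀ S x, Measurable fun z => P z S x) (hT : 1 ≤ Tp)
    {D : List (Fin c.dy) → ℝ≥0∞} {κ : ℝ≥0} (hD : ∀ S, D S ≤ κ * pretrainDist prior P Tp S)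
    (θ : Param c) :
    ∑ S ∈ (finite_length_le (V := Fin c.dy) Tp).toFinset, (D S).toReal * stepKL prior P emb θ S
      ≤ κ * approxKL prior P emb Tp θ := by
  have h1 : approxKL prior P emb Tp θ = ∑ S ∈ (finite_length_le (V := Fin c.dy) Tp).toFinset,
      (pretrainDist prior P Tp S).toReal * stepKL prior P emb θ S := by
    rw [approxKL_eq]
    refine tsum_eq_sum fun S hS => ?_
    have : pretrainDist prior P Tp S = 0 := by
      by_contra h0
      exact hS (by simpa using (pretrainDist_support hT h0).2.1)
    simp [this]
  rw [h1, Finset.mul_sum]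
  refine Finset.sum_le_sum fun S _ => ?_
  have hle := ENNReal.toReal_mono
    (ENNReal.mul_ne_top ENNReal.coe_ne_top (pretrainDist_ne_top (prior := prior) (P := P) hT S)) (hD S)
  rw [ENNReal.toReal_mul, ENNReal.coe_toReal] at hle
  rw [← mul_assoc]
  by_cases h0 : pretrainDist prior P Tp S = 0
  · have hD0 : D S = 0 := le_antisymm ((hD S).trans (by simp [h0])) bot_le
    simp [h0, hD0]
  · exact mul_le_mul_of_nonneg_right hle (stepKL_nonneg hP θ (pretrainDist_support hT h0).2.2)

/-- The expected regret against a fixed concept. -/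
theorem expectedRegret_le (hc : c.Valid) (h : Nominal emb P R c₀ Tp) (hT : 1 ≤ Tp)
    (hK : IsCovariateLaw P K) {z : Z} {β : ℝ} {κ : ℝ≥0} (hpz : 0 < prior.real {z})
    (hβ : Real.log (1 / prior.real {z}) ≤ β)
    (hD : ∀ S, promptDist P K T z S ≤ κ * pretrainDist prior P Tp S) {θ : Param c}
    (hθ : θ ∈ paramSet c) :
    expectedRegret P K emb T θ z
      ≤ (1 + 5 / 2 * c.bstar c₀) * (β / T) + 13 * (κ * approxKL prior P emb Tp θ) := by
  have hb1 := one_le_bstar hc (one_le_dy prior P) c₀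
  have : NeZero c.dy := ⟨by have := one_le_dy prior P; omega⟩
  have hz : PromptsCovered prior P K Tp T z := promptsCovered_of_forall hT fun S h0 =>
    le_antisymm ((hD S).trans (by simp [h0])) bot_le
  have hlen : ∀ t < T, ∀ S, promptLaw P K z t S ≠ 0 → S.length ≤ Tp := fun t ht S hS =>
    (hz t ht S hS).2.1
  have hBMA : (T : ℝ)⁻¹ * ∑ t ∈ Finset.range T, expect (promptLaw P K z t) (conceptKL prior P z)
      ≤ β / T := by
    rw [div_eq_inv_mul]
    exact mul_le_mul_of_nonneg_left (sum_expect_conceptKL_le h hK hz hpz hβ) (by positivity)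
  have hmodel : (T : ℝ)⁻¹ * ∑ t ∈ Finset.range T, expect (promptLaw P K z t) (stepKL prior P emb θ)
      ≤ κ * approxKL prior P emb Tp θ := by
    rw [sum_expect_promptLaw hlen]
    exact sum_mul_stepKL_le h.measurable hT hD θ
  have hcross : ∑ t ∈ Finset.range T, expect (promptLaw P K z t) (fun S =>
      ∑ x, (P z S x).toReal * logRatio prior P emb θ S x) ≤
      13 * ∑ t ∈ Finset.range T, expect (promptLaw P K z t) (stepKL prior P emb θ)
        + 5 / 2 * c.bstar c₀ *
          ∑ t ∈ Finset.range T, expect (promptLaw P K z t) (conceptKL prior P z) := by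
    rw [Finset.mul_sum, Finset.mul_sum, ← Finset.sum_add_distrib]
    refine Finset.sum_le_sum fun t ht => ?_
    have ht' := Finset.mem_range.1 ht
    have hfin := finite_support_promptLaw hlen ht'
    rw [← expect_const_mul, ← expect_const_mul, ← expect_add hfin]
    refine expect_mono hfin fun S hS => ?_
    obtain ⟨hS0, -, hM⟩ := hz t ht' S ((PMF.mem_support_iff _ _).1 hS)
    exact sum_mul_log_le_of_three hb1 (fun x => h.prob_pos z hS0 x)
      (fun x => h.predictive_pos hS0 hM x) (fun x => modelProb_pos _ _ _ _) (sum_toReal_prob z S)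
      (sum_predictive h.measurable hM) (sum_modelProb _ _ _)
      (fun x => abs_logRatio_le hc h hθ hS0 hM x)
  have hcross' := mul_le_mul_of_nonneg_left hcross (by positivity : (0 : ℝ) ≤ (T : ℝ)⁻¹)
  have h5 := mul_le_mul_of_nonneg_left hBMA (by linarith : 0 ≤ 5 / 2 * c.bstar c₀)
  rw [expectedRegret_eq h hz]
  linarith

/-- The concepts in question are atoms of mass at least exp(-β), and a probability measure has only
finitely many of these. Integrals over the prior become finite sums, and the regret needs no
measurability. -/
theorem exists_finset_atoms {β : ℝ}
    (hβ : ∀ᵐ z ∂prior, 0 < prior.real {z} ∧ Real.log (1 / prior.real {z}) ≤ β) :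
    ∃ A : Finset Z, prior.restrict A = prior ∧
      ∀ z ∈ A, 0 < prior.real {z} ∧ Real.log (1 / prior.real {z}) ≤ β := by
  have hfin : {z : Z | 0 < prior.real {z} ∧ Real.log (1 / prior.real {z}) ≤ β}.Finite := by
    refine (Measure.finite_const_le_meas_of_disjoint_iUnion prior (ε := ENNReal.ofReal (Real.exp (-β)))
      (ENNReal.ofReal_pos.2 (Real.exp_pos _)) (As := fun z : Z => {z})
      (fun z => measurableSet_singleton z) ?_ (measure_ne_top _ _)).subset ?_
    · intro z z' hzz
      simpa using hzz
    · rintro z ⟨h1, h2⟩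
      have h3 : Real.exp (-β) ≤ prior.real {z} := by
        rw [← Real.le_log_iff_exp_le h1]
        rw [one_div, Real.log_inv] at h2
        linarith
      exact ENNReal.ofReal_le_of_le_toReal h3
  refine ⟨hfin.toFinset, Measure.restrict_eq_self_of_ae_mem ?_, fun z hz => hfin.mem_toFinset.1 hz⟩
  filter_upwards [hβ] with z hz
  simpa using hz

/-- The expected regret against a concept drawn from the prior. -/
theorem integral_expectedRegret_le (h : Nominal emb P R c₀ Tp) (hT : 1 ≤ Tp)
    (hK : IsCovariateLaw P K) {β : ℝ} {κ : ℝ≥0}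
    (hβ : ∀ᵐ z ∂prior, 0 < prior.real {z} ∧ Real.log (1 / prior.real {z}) ≤ β)
    (hD : ∀ S, (∫⁻ z, promptDist P K T z S ∂prior) ≤ κ * pretrainDist prior P Tp S)
    (θ : Param c) :
    ∫ z, expectedRegret P K emb T θ z ∂prior ≤ β / T + κ * approxKL prior P emb Tp θ := by
  obtain ⟨A, hA, hAβ⟩ := exists_finset_atoms hβ
  have hint : ∀ f : Z → ℝ, ∫ z, f z ∂prior = ∑ z ∈ A, prior.real {z} * f z := by
    intro f
    conv_lhs => rw [← hA]
    rw [setIntegral_finset _ IntegrableOn.finset]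
    simp
  have hlint : ∀ f : Z → ℝ≥0∞, ∫⁻ z, f z ∂prior = ∑ z ∈ A, f z * prior {z} := by
    intro f
    conv_lhs => rw [← hA]
    rw [lintegral_finset]
  have hz : ∀ z ∈ A, PromptsCovered prior P K Tp T z := by
    intro z hzA
    refine promptsCovered_of_forall hT fun S h0 => ?_
    have h1 : ∫⁻ z, promptDist P K T z S ∂prior = 0 :=
      le_antisymm ((hD S).trans (by simp [h0])) bot_le
    rw [hlint, Finset.sum_eq_zero_iff] at h1
    rcases mul_eq_zero.1 (h1 z hzA) with h2 | h2
    · exact h2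
    · have := (hAβ z hzA).1
      simp [Measure.real, h2] at this
  have hmass : ∑ z ∈ A, prior.real {z} = 1 := by
    have := hint fun _ => 1
    simpa using this.symm
  have hlen : ∀ z ∈ A, ∀ t < T, ∀ S, promptLaw P K z t S ≠ 0 → S.length ≤ Tp :=
    fun z hzA t ht S hS => (hz z hzA t ht S hS).2.1
  set Y : Z → ℝ := fun z => ∑ S ∈ (finite_length_le (V := Fin c.dy) Tp).toFinset,
    (promptDist P K T z S).toReal * ∑ x, (P z S x).toReal * logRatio prior P emb θ S x with hY
  have hsplit : ∀ z ∈ A, expectedRegret P K emb T θ z ≤ β / T + Y z := by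
    intro z hzA
    rw [expectedRegret_eq h (hz z hzA), sum_expect_promptLaw (hlen z hzA) fun S =>
      ∑ x, (P z S x).toReal * logRatio prior P emb θ S x, div_eq_inv_mul]
    gcongr
    exact sum_expect_conceptKL_le h hK (hz z hzA) (hAβ z hzA).1 (hAβ z hzA).2
  obtain ⟨v, hv⟩ := promptDist_factor hK T
  -- Averaged over the concept given the prompt, the response follows the predictive law. The
  -- network term then is a true divergence, with no change of measure and no b* in front of β.
  have hmix : ∀ S x, ∑ z ∈ A, prior.real {z} * ((promptDist P K T z S).toReal * (P z S x).toReal)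
      = (∫⁻ z, promptDist P K T z S ∂prior).toReal * predictive prior P S x := by
    intro S x
    have e1 : ∫⁻ z, promptDist P K T z S ∂prior = v S * evidence prior P S := by
      simp only [hv]
      rw [lintegral_const_mul _ (measurable_seqProb h.measurable _ _), evidence]
    have e2 : ∫⁻ z, promptDist P K T z S * P z S x ∂prior = v S * evidence prior P (S ++ [x]) := by
      rw [evidence, ← lintegral_const_mul _ (measurable_seqProb h.measurable _ _)]
      refine lintegral_congr fun z => ?_
      rw [hv, seqProb_concat, List.nil_append, mul_assoc]
    rw [e1, ENNReal.toReal_mul, mul_assoc, evidence_mul_predictive, ← ENNReal.toReal_mul, ← e2,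
      hlint, ENNReal.toReal_sum]
    · refine Finset.sum_congr rfl fun z _ => ?_
      rw [ENNReal.toReal_mul, ENNReal.toReal_mul, Measure.real]
      ring
    · exact fun z _ => ENNReal.mul_ne_top (ENNReal.mul_ne_top (promptDist_ne_top z S)
        (PMF.apply_ne_top _ _)) (measure_ne_top _ _)
  calc ∫ z, expectedRegret P K emb T θ z ∂prior
      = ∑ z ∈ A, prior.real {z} * expectedRegret P K emb T θ z := hint _
    _ ≤ ∑ z ∈ A, prior.real {z} * (β / T + Y z) :=
        Finset.sum_le_sum fun z hzA => mul_le_mul_of_nonneg_left (hsplit z hzA) measureReal_nonneg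
    _ = β / T + ∑ z ∈ A, prior.real {z} * Y z := by
        simp only [mul_add, Finset.sum_add_distrib, ← Finset.sum_mul, hmass, one_mul]
    _ = β / T + ∑ S ∈ (finite_length_le (V := Fin c.dy) Tp).toFinset,
          (∫⁻ z, promptDist P K T z S ∂prior).toReal * stepKL prior P emb θ S := by
        congr 1
        simp only [hY, Finset.mul_sum]
        rw [Finset.sum_comm]
        refine Finset.sum_congr rfl fun S _ => ?_
        rw [stepKL, Finset.mul_sum, Finset.sum_comm]
        refine Finset.sum_congr rfl fun x _ => ?_
        rw [← mul_assoc, ← hmix, Finset.sum_mul]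
        exact Finset.sum_congr rfl fun z _ => by ring
    _ ≤ _ := by
        gcongr
        exact sum_mul_stepKL_le h.measurable hT hD θ

end Main

end ICL

theorem mainTheorem5 :
    ∃ C : ℝ, 0 < C ∧
    ∀ (c : ICL.Config) (emb : Fin c.dy ↪ (Fin c.d → ℝ))
      (Z : Type u) [MeasurableSpace Z] [MeasurableSingletonClass Z]
      (prior : MeasureTheory.Measure Z) [MeasureTheory.IsProbabilityMeasure prior]
      (P : Z → List (Fin c.dy) → PMF (Fin c.dy))
      (K : Z → List (Fin c.dy) → PMF (List (Fin c.dy)))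
      (R c₀ δ : ℝ) (N Tp T : ℕ),
      1 ≤ c.D → 1 ≤ c.h → c.h ≤ c.Dbar → 0 < c.τ → c.τ ≤ 1 →
      1 ≤ c.BA → 1 ≤ c.BA1 → 1 ≤ c.BA2 → 1 ≤ c.BQ → 1 ≤ c.BK → 1 ≤ c.BV →
      1 ≤ N → 1 ≤ Tp → 1 ≤ T → 0 < δ → δ < 1 →
      (∀ S x, Measurable fun z => P z S x) →
      -- bounded tokens
      1 ≤ R →
      (∀ z S, S.length ≤ Tp → ICL.seqProb (P z) [] S ≠ 0 → ∀ x ∈ S, ICL.l2norm (emb x) ≤ R) →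
      -- positivity
      0 < c₀ →
      (∀ z S x, S ≠ [] → c₀ ≤ (P z S x).toReal) →
      ICL.IsCovariateLaw P K →
      -- the true concept is drawn from the prior
      (∀ (β : ℝ) (κ : NNReal),
        (∀ᵐ z ∂prior, 0 < prior.real {z} ∧ Real.log (1 / prior.real {z}) ≤ β) →
        (∀ S, (∫⁻ z, ICL.promptDist P K T z S ∂prior) ≤ κ * ICL.pretrainDist prior P Tp S) →
        1 - δ ≤ (ICL.datasetLaw prior P N Tp).real
          {ω | ∀ θ, ICL.IsPretrained emb ω θ →
            ∫ z, ICL.expectedRegret P K emb T θ z ∂prior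
              ≤ C * (β / T + c.bstar c₀ * κ * ICL.deltaPre prior P emb R N Tp δ)}) ∧
      -- the true concept is fixed
      (∀ (zs : Z) (β : ℝ) (κ : NNReal),
        0 < prior.real {zs} → Real.log (1 / prior.real {zs}) ≤ β →
        (∀ S, ICL.promptDist P K T zs S ≤ κ * ICL.pretrainDist prior P Tp S) →
        1 - δ ≤ (ICL.datasetLaw prior P N Tp).real
          {ω | ∀ θ, ICL.IsPretrained emb ω θ →
            ICL.expectedRegret P K emb T θ zs
              ≤ C * (c.bstar c₀ * (β / T) + c.bstar c₀ * κ *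
                  ICL.deltaPre prior P emb R N Tp δ)}) := by
  -- This is 13·2400, the constants of the change of measure and of the pretraining bound.
  refine ⟨31200, by norm_num, ?_⟩
  intro c emb Z _ _ prior _ P K R c₀ δ N Tp T hD hh hhD hτ hτ1 hBA hBA1 hBA2 hBQ hBK hBV hN hTp hT hδ hδ1
    hP hR hbdd hc0 hpos hK
  have hc : c.Valid := ⟨hD, hh, hhD, hτ, hτ1, hBA, hBA1, hBA2, hBQ, hBK, hBV⟩
  have h : ICL.Nominal emb P R c₀ Tp := ⟨hP, hR, hbdd, hc0, hpos⟩
  have hprob := ICL.isProbabilityMeasure_trajectoryLaw (prior := prior) hP Tp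
  have hprobN : MeasureTheory.IsProbabilityMeasure (ICL.datasetLaw prior P N Tp) := by
    rw [ICL.datasetLaw]; infer_instance
  have hpre := ICL.approxKL_pretrained_le (prior := prior) hc h hN hTp hδ hδ1
  have hb1 := ICL.one_le_bstar hc (ICL.one_le_dy prior P) c₀
  have hΔ := ICL.deltaPre_nonneg (prior := prior) (P := P) (emb := emb) hc hR N Tp hδ hδ1
  have hβ_nonneg : ∀ (z : Z) (β : ℝ), 0 < prior.real {z} → Real.log (1 / prior.real {z}) ≤ β →
      0 ≤ β := fun z β hz hβ => by
    refine le_trans (Real.log_nonneg ?_) hβ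
    rw [le_div_iff₀ hz, one_mul]
    exact MeasureTheory.measureReal_le_one
  refine ⟨fun β κ hβ hdom => ?_, fun zs β κ hz hβ hdom => ?_⟩
  · refine hpre.trans (MeasureTheory.measureReal_mono fun ω hω θ hθ => ?_)
    obtain ⟨z, hz⟩ := hβ.exists
    have hβT : 0 ≤ β / T := div_nonneg (hβ_nonneg z β hz.1 hz.2) (Nat.cast_nonneg T)
    refine (ICL.integral_expectedRegret_le h hTp hK hβ hdom θ).trans ?_
    have h1 := mul_le_mul_of_nonneg_left (hω θ hθ) κ.coe_nonneg
    have h2 : 0 ≤ c.bstar c₀ * κ * ICL.deltaPre prior P emb R N Tp δ := by positivity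
    linarith
  · refine hpre.trans (MeasureTheory.measureReal_mono fun ω hω θ hθ => ?_)
    have hβT : 0 ≤ β / T := div_nonneg (hβ_nonneg zs β hz hβ) (Nat.cast_nonneg T)
    refine (ICL.expectedRegret_le hc h hTp hK hz hβ hdom hθ.1).trans ?_
    have h1 := mul_le_mul_of_nonneg_left (hω θ hθ) κ.coe_nonneg
    have h2 : β / T ≤ c.bstar c₀ * (β / T) := le_mul_of_one_le_left hβT hb1
    linarith
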